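/- Let $n\ge 1$, let $V=\mathbb C^n$ be the basic representation of $\mathfrak{gl}_n=\mathfrak{gl}_n(\mathbb C)$ and $V^*$ its dual. Identify $\mathbb C[\mathfrak{gl}_n]\simeq S(\mathfrak{gl}_n)$ through the trace form $(A,B)\mapsto \operatorname{tr}(AB)$. For $j\ge 0$, $y\in V$, $x\in V^*$ define $\alpha_j(y,x)\in\mathbb C[\mathfrak{gl}_n]$ by $$\bigl(x,(1-\tau A)^{-1}y\bigr)\,\det(1-\tau A)^{-1}=\sum_{j\ge 0}\alpha_j(y,x)(A)\,\tau^j,\qquad A\in\mathfrak{gl}_n,$$ and let $r_j(y,x)\in U(\mathfrak{gl}_n)$ be the symmetrization of $\alpha_j(y,x)$. A *deformation* is a pairing $\zeta=\sum_{j\ge0}\zeta_j r_j: V\times V^*\to U(\mathfrak{gl}_n)$ with $\zeta_j\in\mathbb C$, almost all zero; its *length* is $l(\zeta)=\min\{m\in\mathbb Z_{\ge -1}\mid \zeta_j=0 \text{ for all } j\ge m+1\}$. Let $H_\zeta(\mathfrak{gl}_n)$ be the quotient of the semidirect product algebra $U(\mathfrak{gl}_n)\ltimes T(V\oplus V^*)$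 by the relations $[y,x]=\zeta(y,x)$ and $[x,x']=[y,y']=0$ for all $x,x'\in V^*$, $y,y'\in V$. For $N>l(\zeta)$, its *$N$-th standard filtration* is the algebra filtration induced from the grading of the tensor algebra $T(\mathfrak{gl}_n\oplus V\oplus V^*)$ with $\deg\mathfrak{gl}_n=2$ and $\deg(V\oplus V^*)=N$. An isomorphism of filtered algebras is an isomorphism of $\mathbb C$-algebras that maps each filtration term onto the corresponding one. For $\lambda\in\mathbb C$ let $\varphi_\lambda$ be the automorphism of the algebra $U(\mathfrak{gl}_n)$ with $\varphi_\lambda(A)=A+\lambda\operatorname{tr}A$ for $A\in\mathfrak{gl}_n$, and put $\zeta^+=\zeta$, $\zeta^-=\sum_{j\ge0}(-1)^j\zeta_j r_j$. (a) Let $\zeta,\zeta'$ be deformations and $N\ge\max\{l(\zeta)+1,\,l(\zeta')+1,\,3\}$ an integer. Then $H_\zeta(\mathfrak{gl}_n)$ and $H_{\zeta'}(\mathfrak{gl}_n)$ with their $N$-th standard filtrations are isomorphic as filtered algebras if and only if there are $\lambda\in\mathbb C$, $\theta\in\mathbb C\setminus\{0\}$ and a sign $s\in\{+,-\}$ such that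 $\zeta'=\theta\,\varphi_\lambda(\zeta^{s})$, that is, $\zeta'(y,x)=\theta\,\varphi_\lambda(\zeta^s(y,x))$ for all $y\in V$, $x\in V^*$. (b) For every deformation $\zeta$ of length $m\ge 0$ there is a deformation $\zeta'$ of length $m$ with $\zeta'_m=1$ and, if $m\ge1$, $\zeta'_{m-1}=0$, such that for every integer $N\ge\max\{m+1,3\}$ the algebras $H_\zeta(\mathfrak{gl}_n)$ and $H_{\zeta'}(\mathfrak{gl}_n)$ with their $N$-th standard filtrations are isomorphic as filtered algebras. -/

import Mathlib

open scoped Matrix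

noncomputable section

namespace InfCherednik

attribute [local instance] LieRing.ofAssociativeRing

/-- The Lie algebra `gl_n` over `ℂ`, with the commutator bracket. -/
abbrev Gl (n : ℕ) : Type := Matrix (Fin n) (Fin n) ℂ

/-- The basic representation `V_n`, in coordinates with respect to the basis `y_1, …, y_n`.
A matrix `A` acts on `v` by `A *ᵥ v`. -/
abbrev V (n : ℕ) : Type := Fin n → ℂ

/-- The dual representation `V_n^*`, in coordinates with respect to the dual basis
`x_1, …, x_n`; the canonical pairing of `w` with `v : V n` is `∑ i, w i * v i`, and therefore
`A` acts on `w` by `- (w ᵥ* A)`. -/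
abbrev VDual (n : ℕ) : Type := Fin n → ℂ

/-- The universal enveloping algebra `U(gl_n)`. -/
abbrev U (n : ℕ) : Type := UniversalEnvelopingAlgebra ℂ (Gl n)

/-- The canonical map `gl_n → U(gl_n)`. -/
def toU (n : ℕ) (A : Gl n) : U n := UniversalEnvelopingAlgebra.ι ℂ A

/-! ### The invariant pairings `r_j` -/

/-- The matrix `1 - τ A`, where `A` is the generic matrix: its entries are power series in `τ`
over the ring `ℂ[gl_n]` of polynomials in the matrix entries `A i j`. -/
def oneSubTauA (n : ℕ) :
    Matrix (Fin n) (Fin n) (PowerSeries (MvPolynomial (Fin n × Fin n) ℂ)) :=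
  1 - (PowerSeries.X : PowerSeries (MvPolynomial (Fin n × Fin n) ℂ)) •
    (Matrix.mvPolynomialX (Fin n) (Fin n) ℂ).map PowerSeries.C

/-- `det (1 - τ A)` is invertible, so that the inverses below are genuine inverses. -/
theorem isUnit_det_oneSubTauA (n : ℕ) : IsUnit (oneSubTauA n).det := by
  rw [PowerSeries.isUnit_iff_constantCoeff]
  have h : (PowerSeries.constantCoeff
      (R := MvPolynomial (Fin n × Fin n) ℂ)).mapMatrix (oneSubTauA n) = 1 := by
    ext i j : 1
    by_cases hij : i = j <;> simp [oneSubTauA, Matrix.one_apply, hij]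
  rw [RingHom.map_det, h, Matrix.det_one]
  exact isUnit_one

/-- The generating series `(x, (1 - τ A)⁻¹ y) · det (1 - τ A)⁻¹` in `ℂ[gl_n][[τ]]`. -/
def alphaSeries (n : ℕ) (y : V n) (x : VDual n) :
    PowerSeries (MvPolynomial (Fin n × Fin n) ℂ) :=
  (∑ i, algebraMap ℂ _ (x i) *
      ((oneSubTauA n)⁻¹ *ᵥ fun k => algebraMap ℂ _ (y k)) i) *
    Ring.inverse (oneSubTauA n).det

/-- `α_j(y, x)`, the coefficient of `τ ^ j` in the generating series: a polynomial function
on `gl_n`. -/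
def alpha (n j : ℕ) (y : V n) (x : VDual n) : MvPolynomial (Fin n × Fin n) ℂ :=
  PowerSeries.coeff j (alphaSeries n y x)

/-- The symmetrized product `(1 / k!) ∑_σ a_{σ 1} ⋯ a_{σ k}` of `k` elements of an algebra. -/
def symProd {R : Type*} [Ring R] [Algebra ℂ R] {k : ℕ} (a : Fin k → R) : R :=
  ((k.factorial : ℂ)⁻¹) •
    ∑ σ : Equiv.Perm (Fin k), (List.ofFn fun i => a (σ i)).prod

/-- The identification `gl_n ≃ gl_n^*` through the trace form `(B, A) ↦ tr (B A)`: the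
coordinate function `A ↦ A i j = tr (E_{ji} A)` corresponds to the matrix unit `E_{ji}`. -/
def coordElt (n : ℕ) (p : Fin n × Fin n) : Gl n := Matrix.single p.2 p.1 1

/-- The symmetrization map `ℂ[gl_n] ≃ S(gl_n) → U(gl_n)`: the linear map which sends a
commutative monomial `a_1 ⋯ a_k` (in elements of `gl_n`) to the average of the products of its
factors in `U(gl_n)` over all orderings. -/
def symmetrization (n : ℕ) : MvPolynomial (Fin n × Fin n) ℂ →ₗ[ℂ] U n :=
  (MvPolynomial.basisMonomials (Fin n × Fin n) ℂ).constr ℂ fun m =>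
    symProd fun i : Fin (Finsupp.toMultiset m).toList.length =>
      toU n (coordElt n ((Finsupp.toMultiset m).toList.get i))

/-- The invariant pairing `r_j : V_n × V_n^* → U(gl_n)`. -/
def r (n j : ℕ) (y : V n) (x : VDual n) : U n := symmetrization n (alpha n j y x)

/-! ### Deformation parameters -/

/-- The pairing `ζ = ∑_j ζ_j r_j` attached to a finitely supported sequence of coefficients. -/
def pairing (n : ℕ) (ζ : ℕ →₀ ℂ) (y : V n) (x : VDual n) : U n :=
  ζ.sum fun j c => c • r n j y x

/-- The length `l(ζ) = min {m ∈ ℤ_{≥ -1} | ζ_j = 0 for all j ≥ m + 1}`. -/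
def length (ζ : ℕ →₀ ℂ) : ℤ :=
  sInf {m : ℤ | -1 ≤ m ∧ ∀ j : ℕ, m + 1 ≤ (j : ℤ) → ζ j = 0}

/-- The minimum in the definition of the length is attained. -/
theorem length_isLeast (ζ : ℕ →₀ ℂ) :
    IsLeast {m : ℤ | -1 ≤ m ∧ ∀ j : ℕ, m + 1 ≤ (j : ℤ) → ζ j = 0} (length ζ) := by
  have hb : BddBelow {m : ℤ | -1 ≤ m ∧ ∀ j : ℕ, m + 1 ≤ (j : ℤ) → ζ j = 0} :=
    ⟨-1, fun m hm => hm.1⟩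
  refine ⟨Int.csInf_mem ⟨(ζ.support.sup id : ℕ), by omega, fun j hj => ?_⟩ hb,
    fun m hm => csInf_le hb hm⟩
  by_contra h
  have h2 : id j ≤ ζ.support.sup id := Finset.le_sup (Finsupp.mem_support_iff.mpr h)
  simp only [id] at h2
  omega

/-- `ζ^s` for a sign `s`: here `ζ^+ = ζ` and `ζ^- = ζ_0 r_0 - ζ_1 r_1 + ζ_2 r_2 - ⋯`. -/
def signTwist (s : ℤˣ) (ζ : ℕ →₀ ℂ) : ℕ →₀ ℂ :=
  Finsupp.onFinset ζ.support (fun j => ((s : ℤ) : ℂ) ^ j * ζ j) fun _ hj =>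
    Finsupp.mem_support_iff.mpr (right_ne_zero_of_mul hj)

/-- The algebra map `φ_λ : U(gl_n) → U(gl_n)` determined by `A ↦ A + λ tr A` for `A ∈ gl_n`. -/
def phi (n : ℕ) (lam : ℂ) : U n →ₐ[ℂ] U n :=
  UniversalEnvelopingAlgebra.lift ℂ
    { toFun := fun A => toU n A + algebraMap ℂ (U n) (lam * Matrix.trace A)
      map_add' := fun A B => by
        simp only [toU, map_add, Matrix.trace_add, mul_add]
        abel
      map_smul' := fun c A => by
        simp only [toU, map_smul, Matrix.trace_smul, RingHom.id_apply, smul_add,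
          Algebra.algebraMap_eq_smul_one, smul_smul, smul_eq_mul]
        rw [mul_left_comm]
      map_lie' := fun {A B} => by
        have h : Matrix.trace ⁅A, B⁆ = 0 := by
          rw [LieRing.of_associative_ring_bracket, Matrix.trace_sub, Matrix.trace_mul_comm,
            sub_self]
        rw [h]
        simp only [toU, LieHom.map_lie, mul_zero, map_zero, add_zero]
        simp only [LieRing.of_associative_ring_bracket, add_mul, mul_add,
          (Algebra.commutes (lam * Matrix.trace A) _).symm, Algebra.commutes (lam * Matrix.trace B)]
        abel }

/-! ### The algebras `H_ζ(gl_n)` -/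

/-- The tensor algebra `T(gl_n ⊕ V_n ⊕ V_n^*)`. -/
abbrev TAlg (n : ℕ) : Type := TensorAlgebra ℂ (Gl n × V n × VDual n)

/-- The generator of the tensor algebra given by `A ∈ gl_n`. -/
def tGl (n : ℕ) (A : Gl n) : TAlg n := TensorAlgebra.ι ℂ (A, 0, 0)

/-- The generator of the tensor algebra given by `y ∈ V_n`. -/
def tV (n : ℕ) (y : V n) : TAlg n := TensorAlgebra.ι ℂ (0, y, 0)

/-- The generator of the tensor algebra given by `x ∈ V_n^*`. -/
def tVDual (n : ℕ) (x : VDual n) : TAlg n := TensorAlgebra.ι ℂ (0, 0, x)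

/-- The defining relations `[A, B] = ⁅A, B⁆`, `[A, y] = A(y)`, `[A, x] = A(x)` of the
semidirect product `U(gl_n) ⋉ T(V_n ⊕ V_n^*)`. -/
inductive SemiRel (n : ℕ) : TAlg n → TAlg n → Prop
  | gl (A B : Gl n) : SemiRel n (tGl n A * tGl n B - tGl n B * tGl n A) (tGl n ⁅A, B⁆)
  | v (A : Gl n) (y : V n) :
      SemiRel n (tGl n A * tV n y - tV n y * tGl n A) (tV n (A *ᵥ y))
  | vdual (A : Gl n) (x : VDual n) :
      SemiRel n (tGl n A * tVDual n x - tVDual n x * tGl n A) (tVDual n (-(x ᵥ* A)))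

/-- The semidirect product algebra `U(gl_n) ⋉ T(V_n ⊕ V_n^*)`. -/
abbrev Semi (n : ℕ) : Type := RingQuot (SemiRel n)

/-- The canonical algebra map `U(gl_n) → U(gl_n) ⋉ T(V_n ⊕ V_n^*)`, `A ↦ A` for `A ∈ gl_n`. -/
def uToSemi (n : ℕ) : U n →ₐ[ℂ] Semi n :=
  UniversalEnvelopingAlgebra.lift ℂ
    { toFun := fun A => RingQuot.mkAlgHom ℂ (SemiRel n) (tGl n A)
      map_add' := fun A B => by
        rw [← map_add, tGl, tGl, tGl, ← map_add]
        simp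
      map_smul' := fun c A => by
        rw [RingHom.id_apply, ← map_smul, tGl, tGl, ← map_smul]
        simp
      map_lie' := fun {A B} => by
        rw [← RingQuot.mkAlgHom_rel ℂ (SemiRel.gl A B), map_sub, map_mul, map_mul]
        rfl }

/-- An element of `V_n` in the semidirect product. -/
def sV (n : ℕ) (y : V n) : Semi n := RingQuot.mkAlgHom ℂ (SemiRel n) (tV n y)

/-- An element of `V_n^*` in the semidirect product. -/
def sVDual (n : ℕ) (x : VDual n) : Semi n := RingQuot.mkAlgHom ℂ (SemiRel n) (tVDual n x)

/-- The relations `[y, y'] = 0`, `[x, x'] = 0` and `[y, x] = η(y, x)`, for a pairing `η`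
of `V_n` and `V_n^*` with values in `U(gl_n)`. -/
inductive HRel (n : ℕ) (η : V n → VDual n → U n) : Semi n → Semi n → Prop
  | yy (y y' : V n) : HRel n η (sV n y * sV n y' - sV n y' * sV n y) 0
  | xx (x x' : VDual n) : HRel n η (sVDual n x * sVDual n x' - sVDual n x' * sVDual n x) 0
  | yx (y : V n) (x : VDual n) :
      HRel n η (sV n y * sVDual n x - sVDual n x * sV n y) (uToSemi n (η y x))

/-- The algebra `H_ζ(gl_n)` for `ζ = ∑_j ζ_j r_j`. -/
abbrev H (n : ℕ) (ζ : ℕ →₀ ℂ) : Type := RingQuot (HRel n (pairing n ζ))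

/-! ### The standard filtrations -/

/-- The projection `T(gl_n ⊕ V_n ⊕ V_n^*) → H_ζ(gl_n)`. -/
def proj (n : ℕ) (ζ : ℕ →₀ ℂ) : TAlg n →ₐ[ℂ] H n ζ :=
  (RingQuot.mkAlgHom ℂ (HRel n (pairing n ζ))).comp (RingQuot.mkAlgHom ℂ (SemiRel n))

/-- The element of the tensor algebra given by a homogeneous generator, i.e. by an element
of `gl_n`, of `V_n` or of `V_n^*`. -/
def letter (n : ℕ) : Gl n ⊕ V n ⊕ VDual n → TAlg n
  | Sum.inl A => tGl n A
  | Sum.inr (Sum.inl y) => tV n y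
  | Sum.inr (Sum.inr x) => tVDual n x

/-- The degrees of the generators: `deg gl_n = 2` and `deg (V_n ⊕ V_n^*) = N`. -/
def letterDeg (n N : ℕ) : Gl n ⊕ V n ⊕ VDual n → ℕ
  | Sum.inl _ => 2
  | Sum.inr _ => N

/-- The sum of the components of degree at most `k` in the tensor algebra, for the grading with
`deg gl_n = 2` and `deg (V_n ⊕ V_n^*) = N`: the span of the words in homogeneous generators
of total degree at most `k`. -/
def tensorFiltration (n N k : ℕ) : Submodule ℂ (TAlg n) :=
  Submodule.span ℂ {u | ∃ w : List (Gl n ⊕ V n ⊕ VDual n),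
    (w.map (letterDeg n N)).sum ≤ k ∧ u = (w.map (letter n)).prod}

/-- The `k`-th term of the `N`-th standard filtration of `H_ζ(gl_n)`, induced from the grading
of the tensor algebra. -/
def stdFiltration (n N : ℕ) (ζ : ℕ →₀ ℂ) (k : ℕ) : Submodule ℂ (H n ζ) :=
  (tensorFiltration n N k).map (proj n ζ).toLinearMap

/-- `H_ζ(gl_n)` and `H_ζ'(gl_n)`, with their `N`-th standard filtrations, are isomorphic as
filtered algebras. -/
def FilteredIso (n N : ℕ) (ζ ζ' : ℕ →₀ ℂ) : Prop :=
  ∃ e : H n ζ ≃ₐ[ℂ] H n ζ',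
    ∀ k : ℕ, (stdFiltration n N ζ k).map e.toLinearMap = stdFiltration n N ζ' k

end InfCherednik

end

open scoped Matrix

noncomputable section

namespace InfCherednik

attribute [local instance] LieRing.ofAssociativeRing

section

/-! ### The Wick functional -/

/-! The pairings `r_j` are Gaussian moments. For two families of variables `u_i`, `v_i`, let `⟨·⟩`
be the functional with `⟨u^a v^b⟩ = δ_{ab} a!`. Formally, integrating `exp(τ (u, A v))` against the
Gaussian gives `det(1 - τA)⁻¹`, and inserting `(u, y)(x, v)` gives `(x, (1 - τA)⁻¹ y) det(1 -
τA)⁻¹`. Hence `α_j(y, x) = ⟨(u, y)(x, v)(u, A v)^j⟩ / j!` (`alpha_eq_wickPairing`). With the entries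
of `A` replaced by matrix units in `U(gl_n)`, the power is already symmetrized, because the
coefficient of a word depends only on its multiset of letters. So the same formula computes `r_j`
(`r_eq_wickPairing`).

What is needed about `r_j` now follows from integration by parts, `⟨v_i f⟩ = ⟨∂f/∂u_i⟩`. Invariance
of the functional gives `GL_n`-invariance (`conjU_r`, `toU_r_commutator`). The exchange of `u` and
`v` gives the symmetry behind `ζ^-` (`negTransposeU_r`). Since `φ_λ` adds the central term `λ (u,
v)` to the generic element, `φ_λ(r_j)` is a combination of the `r_i` with `i ≤ j` (`phi_r`). The
commutator of the generic element with `y` is divisible by `(u, y)`, which yields the Jacobi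
identities (`map_r_commutator_symm` and its dual).

The Jacobi identities make `U(gl_n) ⋉ S(V^*)` a module over `H_ζ`, with `V` annihilating `1`.
Therefore `U(gl_n)`, `V^*` and, by duality, `V` embed in `H_ζ`. This is as much of a PBW theorem as
the argument needs.

For sufficiency in (a), `φ_λ` and a rescaling of `V` give an isomorphism, while `A ↦ -Aᵀ` with `V`
and `V^*` exchanged gives `H_ζ ≃ H_{-ζ^-}`; the sign goes into `θ`.

For necessity, `N ≥ 3` forces the term of degree 2 to be `gl_n + ℂ` and puts the term of degree `N`
inside `U(gl_n) + V + V^*`. A filtered isomorphism sends the identity matrix to `c · 1 + χ`, and its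
adjoint weights `0, 1, -1` force `c = ±1`. If `c = 1`, then `V`, `V^*` and `gl_n` are mapped by `y ↦
M y`, `x ↦ q x M⁻¹` and `A ↦ M A M⁻¹ + λ tr A`, and the relation `[y, x] = ζ(y, x)` gives `ζ' = q⁻¹
φ_λ(ζ)`. If `c = -1`, the exchange of `V` and `V^*` reduces to `c = 1`.

For (b), the coefficient of `r_{m-1}` in `φ_λ(ζ)` is affine in `λ` with nonzero slope, so a suitable
`λ` kills it and `θ` normalizes the top coefficient. -/

open MvPolynomial in
/-- Polynomials in two families of variables `u_i`, `v_i`. -/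
abbrev WickPoly (n : ℕ) : Type := MvPolynomial (Fin n ⊕ Fin n) ℂ

def wu {n : ℕ} (i : Fin n) : WickPoly n := MvPolynomial.X (Sum.inl i)

def wv {n : ℕ} (i : Fin n) : WickPoly n := MvPolynomial.X (Sum.inr i)

def du {n : ℕ} (i : Fin n) : Derivation ℂ (WickPoly n) (WickPoly n) :=
  MvPolynomial.pderiv (Sum.inl i)

def dv {n : ℕ} (i : Fin n) : Derivation ℂ (WickPoly n) (WickPoly n) :=
  MvPolynomial.pderiv (Sum.inr i)

section Derivatives

variable {n : ℕ} (i j : Fin n)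

lemma du_wu : du i (wu j) = if i = j then 1 else 0 := by
  rw [du, wu, MvPolynomial.pderiv_X, Pi.single_apply]; simp [eq_comm]

lemma dv_wv : dv i (wv j) = if i = j then 1 else 0 := by
  rw [dv, wv, MvPolynomial.pderiv_X, Pi.single_apply]; simp [eq_comm]

lemma du_wv : du i (wv j) = 0 := by
  rw [du, wv, MvPolynomial.pderiv_X, Pi.single_apply]; simp

lemma dv_wu : dv i (wu j) = 0 := by
  rw [dv, wu, MvPolynomial.pderiv_X, Pi.single_apply]; simp

lemma du_dv_comm (f : WickPoly n) : du i (dv j f) = dv j (du i f) := by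
  have h : ⁅du i, dv j⁆ = 0 := by
    refine MvPolynomial.derivation_ext fun k => ?_
    rw [Derivation.commutator_apply]
    rcases k with k | k
    · change du i (dv j (wu k)) - dv j (du i (wu k)) = 0
      rw [dv_wu, du_wu]; split_ifs <;> simp
    · change du i (dv j (wv k)) - dv j (du i (wv k)) = 0
      rw [du_wv, dv_wv]; split_ifs <;> simp
  have := congrArg (fun D => D f) h
  rwa [Derivation.commutator_apply, Derivation.zero_apply, sub_eq_zero] at this

end Derivatives

/-- The moments of the standard complex Gaussian: `u^a v^b ↦ δ_{ab} a!`. -/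
def wick (n : ℕ) : WickPoly n →ₗ[ℂ] ℂ :=
  (MvPolynomial.basisMonomials (Fin n ⊕ Fin n) ℂ).constr ℂ fun m =>
    ∏ i, if m (Sum.inl i) = m (Sum.inr i) then ((m (Sum.inl i)).factorial : ℂ) else 0

lemma wick_monomial {n : ℕ} (m : Fin n ⊕ Fin n →₀ ℕ) (c : ℂ) :
    wick n (MvPolynomial.monomial m c) =
      c * ∏ i, if m (Sum.inl i) = m (Sum.inr i) then ((m (Sum.inl i)).factorial : ℂ) else 0 := by
  have h : MvPolynomial.monomial m c = c • MvPolynomial.basisMonomials (Fin n ⊕ Fin n) ℂ m := by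
    simp [MvPolynomial.smul_monomial]
  rw [h, map_smul, wick, Module.Basis.constr_basis, smul_eq_mul]

lemma wick_one (n : ℕ) : wick n 1 = 1 := by
  rw [← MvPolynomial.C_1, MvPolynomial.C_apply, wick_monomial]; simp

/-- Gaussian integration by parts. On monomials, multiplying by `v_i` raises one exponent while the
derivative lowers the other, so the matching condition is the same, and the factorials differ by the
factor produced by the derivative. -/
lemma wick_wv_mul {n : ℕ} (i : Fin n) (f : WickPoly n) : wick n (wv i * f) = wick n (du i f) := by
  induction f using MvPolynomial.induction_on' with
  | add p q hp hq => rw [mul_add, map_add, map_add, map_add, hp, hq]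
  | monomial m c =>
    rw [du, MvPolynomial.pderiv_monomial, wv, MvPolynomial.X, MvPolynomial.monomial_mul,
      wick_monomial, wick_monomial, one_mul, mul_assoc]
    congr 1
    rw [← Finset.mul_prod_erase _ _ (Finset.mem_univ i),
      ← Finset.mul_prod_erase _ _ (Finset.mem_univ i), ← mul_assoc]
    congr 1
    · simp only [Finsupp.coe_add, Finsupp.coe_tsub, Pi.add_apply, Pi.sub_apply,
        Finsupp.single_apply]
      rcases h : m (Sum.inl i) with _ | a
      -- Without `u_i` both sides vanish: the exponent of `v_i` is positive on the left, and the
      -- derivative is zero on the right.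
      · simp; omega
      · by_cases h2 : a = m (Sum.inr i)
        · rw [← h2]; simp [add_comm 1 a, Nat.factorial_succ]
        · have h3 : ¬ (a + 1 = 1 + m (Sum.inr i)) := by omega
          simp [h2, h3]
    · refine Finset.prod_congr rfl fun k hk => ?_
      have hk' : i ≠ k := (Finset.ne_of_mem_erase hk).symm
      simp [hk']

/-- The exchange of the variables `u` and `v`. -/
def wswap (n : ℕ) : WickPoly n →ₐ[ℂ] WickPoly n := MvPolynomial.rename Sum.swap

lemma wswap_wu {n : ℕ} (i : Fin n) : wswap n (wu i) = wv i := by simp [wswap, wu, wv]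

lemma wswap_wv {n : ℕ} (i : Fin n) : wswap n (wv i) = wu i := by simp [wswap, wu, wv]

lemma wick_wswap {n : ℕ} (f : WickPoly n) : wick n (wswap n f) = wick n f := by
  induction f using MvPolynomial.induction_on' with
  | add p q hp hq => rw [map_add, map_add, map_add, hp, hq]
  | monomial m c =>
    rw [wswap, MvPolynomial.rename_monomial, wick_monomial, wick_monomial]
    congr 1
    refine Finset.prod_congr rfl fun i _ => ?_
    have h1 : Finsupp.mapDomain Sum.swap m (Sum.inl i) = m (Sum.inr i) :=
      Finsupp.mapDomain_apply Sum.swap_leftInverse.injective m (Sum.inr i)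
    have h2 : Finsupp.mapDomain Sum.swap m (Sum.inr i) = m (Sum.inl i) :=
      Finsupp.mapDomain_apply Sum.swap_leftInverse.injective m (Sum.inl i)
    rw [h1, h2]
    by_cases h : m (Sum.inl i) = m (Sum.inr i)
    · simp [h]
    · simp [h, Ne.symm h]

lemma wswap_du {n : ℕ} (i : Fin n) (f : WickPoly n) : wswap n (du i f) = dv i (wswap n f) := by
  induction f using MvPolynomial.induction_on with
  | C a =>
    have h1 : du i (MvPolynomial.C a : WickPoly n) = 0 := MvPolynomial.pderiv_C
    have h2 : dv i (MvPolynomial.C a : WickPoly n) = 0 := MvPolynomial.pderiv_C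
    rw [h1, map_zero, wswap, MvPolynomial.rename_C, h2]
  | add p q hp hq => simp only [map_add, hp, hq]
  | mul_X p k hp =>
    rw [Derivation.leibniz, map_mul, Derivation.leibniz, map_add, smul_eq_mul, smul_eq_mul,
      smul_eq_mul, smul_eq_mul, map_mul, map_mul, hp]
    congr 2
    rcases k with k | k
    · change wswap n (du i (wu k)) = dv i (wswap n (wu k))
      rw [wswap_wu, du_wu, dv_wv]; split_ifs <;> simp
    · change wswap n (du i (wv k)) = dv i (wswap n (wv k))
      rw [wswap_wv, du_wv, dv_wu, map_zero]

lemma wick_wu_mul {n : ℕ} (i : Fin n) (f : WickPoly n) : wick n (wu i * f) = wick n (dv i f) := by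
  have hs : wswap n (wswap n f) = f := by
    rw [wswap, MvPolynomial.rename_rename]
    have : (Sum.swap ∘ Sum.swap : Fin n ⊕ Fin n → Fin n ⊕ Fin n) = id := by
      funext x; simp
    rw [this, MvPolynomial.rename_id_apply]
  rw [← wick_wswap, map_mul, wswap_wu, wick_wv_mul, ← wick_wswap, wswap_du, hs]

/-- Integration by parts characterizes the Wick functional. -/
lemma eq_wick {n : ℕ} (L : WickPoly n →ₗ[ℂ] ℂ) (h1 : L 1 = 1)
    (hv : ∀ i f, L (wv i * f) = L (du i f)) (hu : ∀ i f, L (wu i * f) = L (dv i f)) :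
    L = wick n := by
  -- Induction on the degree: splitting off one variable and integrating by parts leaves derivatives
  -- of a monomial of smaller degree.
  have key : ∀ (d : ℕ) (m : Fin n ⊕ Fin n →₀ ℕ), m.degree = d →
      L (MvPolynomial.monomial m 1) = wick n (MvPolynomial.monomial m 1) := by
    intro d
    induction d using Nat.strong_induction_on with
    | _ d ih =>
      intro m hm
      by_cases h0 : m = 0
      · subst h0
        change L 1 = wick n 1
        rw [h1, wick_one]
      · obtain ⟨k, hk⟩ : ∃ k, m k ≠ 0 := by
          by_contra! h
          exact h0 (Finsupp.ext h)
        have hdec : m = Finsupp.single k 1 + (m - Finsupp.single k 1) :=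
          (add_tsub_cancel_of_le (by simpa [Nat.one_le_iff_ne_zero] using hk)).symm
        generalize m - Finsupp.single k 1 = m' at hdec
        have hd : d = 1 + m'.degree := by rw [← hm, hdec, map_add, Finsupp.degree_single]
        have hmon : (MvPolynomial.monomial m 1 : WickPoly n) =
            MvPolynomial.X k * MvPolynomial.monomial m' 1 := by
          rw [hdec, MvPolynomial.X, MvPolynomial.monomial_mul, one_mul]
        have hder : ∀ l, L (MvPolynomial.pderiv l (MvPolynomial.monomial m' 1)) =
            wick n (MvPolynomial.pderiv l (MvPolynomial.monomial m' 1)) := by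
          intro l
          rw [MvPolynomial.pderiv_monomial, one_mul, ← mul_one ((m' l : ℂ)), ← smul_eq_mul,
            ← MvPolynomial.smul_monomial, map_smul, map_smul]
          rw [ih _ _ _ rfl]
          -- The subtraction truncates when the variable does not occur. A weak inequality is
          -- enough, since `m'` has degree `d - 1`.
          have h2 : (m' - Finsupp.single l 1).degree ≤ m'.degree :=
            Finsupp.degree_mono tsub_le_self
          omega
        rw [hmon]
        rcases k with k | k
        · exact (hu k _).trans ((hder _).trans (wick_wu_mul k _).symm)
        · exact (hv k _).trans ((hder _).trans (wick_wv_mul k _).symm)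
  refine (MvPolynomial.basisMonomials _ ℂ).ext fun m => ?_
  rw [MvPolynomial.coe_basisMonomials]
  exact key _ m rfl

/-- The substitution `v ↦ B v`, `u ↦ u C`. -/
def wsubst {n : ℕ} (B C : Matrix (Fin n) (Fin n) ℂ) : WickPoly n →ₐ[ℂ] WickPoly n :=
  MvPolynomial.aeval (Sum.elim (fun k => ∑ l, C l k • wu l) (fun i => ∑ k, B i k • wv k))

lemma wsubst_wu {n : ℕ} (B C : Matrix (Fin n) (Fin n) ℂ) (k : Fin n) :
    wsubst B C (wu k) = ∑ l, C l k • wu l := by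
  rw [wsubst, wu, MvPolynomial.aeval_X]; rfl

lemma wsubst_wv {n : ℕ} (B C : Matrix (Fin n) (Fin n) ℂ) (i : Fin n) :
    wsubst B C (wv i) = ∑ k, B i k • wv k := by
  rw [wsubst, wv, MvPolynomial.aeval_X]; rfl

lemma sum_smul_derivation_mul {n : ℕ} (c : Fin n → ℂ)
    (D : Fin n → Derivation ℂ (WickPoly n) (WickPoly n)) (a b : WickPoly n) :
    ∑ k, c k • D k (a * b) = a * ∑ k, c k • D k b + b * ∑ k, c k • D k a := by
  rw [Finset.mul_sum, Finset.mul_sum, ← Finset.sum_add_distrib]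
  refine Finset.sum_congr rfl fun k _ => ?_
  rw [Derivation.leibniz, smul_eq_mul, smul_eq_mul, smul_add, mul_smul_comm, mul_smul_comm]

/-- The chain rule, with the Jacobian of the substitution inverted by `B`. Both sides satisfy the
same product rule, so it is enough to compare them on the variables. -/
lemma wsubst_du {n : ℕ} {B C : Matrix (Fin n) (Fin n) ℂ} (hBC : C * B = 1) (i : Fin n)
    (f : WickPoly n) : ∑ k, B i k • du k (wsubst B C f) = wsubst B C (du i f) := by
  have hBC' : B * C = 1 := mul_eq_one_comm.mp hBC
  induction f using MvPolynomial.induction_on with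
  | C a =>
    have h1 : ∀ i, du i (MvPolynomial.C a : WickPoly n) = 0 := fun i => MvPolynomial.pderiv_C
    have h2 : wsubst B C (MvPolynomial.C a) = MvPolynomial.C a := by
      rw [wsubst, MvPolynomial.aeval_C]; rfl
    simp [h1, h2]
  | add p q hp hq => simp only [map_add, smul_add, Finset.sum_add_distrib, hp, hq]
  | mul_X p k hp =>
    have hX : ∑ l, B i l • du l (wsubst B C (MvPolynomial.X k)) =
        wsubst B C (du i (MvPolynomial.X k)) := by
      rcases k with k | k
      · change ∑ l, B i l • du l (wsubst B C (wu k)) = wsubst B C (du i (wu k))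
        rw [wsubst_wu, du_wu]
        simp only [map_sum, Derivation.map_smul, du_wu, smul_ite, smul_zero,
          Finset.sum_ite_eq, Finset.mem_univ, if_true]
        simp only [smul_smul, ← Finset.sum_smul]
        rw [← Matrix.mul_apply, hBC', Matrix.one_apply]
        split_ifs <;> simp
      · change ∑ l, B i l • du l (wsubst B C (wv k)) = wsubst B C (du i (wv k))
        rw [wsubst_wv, du_wv]
        simp [map_sum, Derivation.map_smul, du_wv]
    rw [map_mul, sum_smul_derivation_mul, hp, hX, Derivation.leibniz, smul_eq_mul, smul_eq_mul,
      map_add, map_mul, map_mul]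

lemma wsubst_dv {n : ℕ} {B C : Matrix (Fin n) (Fin n) ℂ} (hBC : C * B = 1) (i : Fin n)
    (f : WickPoly n) : ∑ k, C k i • dv k (wsubst B C f) = wsubst B C (dv i f) := by
  induction f using MvPolynomial.induction_on with
  | C a =>
    have h1 : ∀ i, dv i (MvPolynomial.C a : WickPoly n) = 0 := fun i => MvPolynomial.pderiv_C
    have h2 : wsubst B C (MvPolynomial.C a) = MvPolynomial.C a := by
      rw [wsubst, MvPolynomial.aeval_C]; rfl
    simp [h1, h2]
  | add p q hp hq => simp only [map_add, smul_add, Finset.sum_add_distrib, hp, hq]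
  | mul_X p k hp =>
    have hX : ∑ l, C l i • dv l (wsubst B C (MvPolynomial.X k)) =
        wsubst B C (dv i (MvPolynomial.X k)) := by
      rcases k with k | k
      · change ∑ l, C l i • dv l (wsubst B C (wu k)) = wsubst B C (dv i (wu k))
        rw [wsubst_wu, dv_wu]
        simp [map_sum, Derivation.map_smul, dv_wu]
      · change ∑ l, C l i • dv l (wsubst B C (wv k)) = wsubst B C (dv i (wv k))
        have hBC' : B * C = 1 := mul_eq_one_comm.mp hBC
        rw [wsubst_wv, dv_wv]
        simp only [map_sum, Derivation.map_smul, dv_wv, smul_ite, smul_zero,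
          Finset.sum_ite_eq, Finset.mem_univ, if_true]
        simp only [smul_smul, ← Finset.sum_smul, mul_comm (C _ i)]
        rw [← Matrix.mul_apply, hBC', Matrix.one_apply]
        simp only [eq_comm (a := k)]
        split_ifs <;> simp
    rw [map_mul, sum_smul_derivation_mul, hp, hX, Derivation.leibniz, smul_eq_mul, smul_eq_mul,
      map_add, map_mul, map_mul]

/-- The substitution preserves the form `∑ u_i v_i`, and with it the Gaussian. Formally, the pulled
back functional still satisfies integration by parts, which characterizes `wick`. -/
lemma wick_wsubst {n : ℕ} {B C : Matrix (Fin n) (Fin n) ℂ} (hBC : C * B = 1) (f : WickPoly n) :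
    wick n (wsubst B C f) = wick n f := by
  have h : (wick n).comp (wsubst B C).toLinearMap = wick n := by
    refine eq_wick _ ?_ (fun i f => ?_) (fun i f => ?_)
    · simp [wick_one]
    · simp only [LinearMap.comp_apply, AlgHom.toLinearMap_apply, map_mul, wsubst_wv,
        Finset.sum_mul, smul_mul_assoc, map_sum, map_smul, wick_wv_mul, ← wsubst_du hBC]
    · simp only [LinearMap.comp_apply, AlgHom.toLinearMap_apply, map_mul, wsubst_wu,
        Finset.sum_mul, smul_mul_assoc, map_sum, map_smul, wick_wu_mul, ← wsubst_dv hBC]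
  exact LinearMap.congr_fun h f

/-- The derivation induced by a matrix `A`: `v ↦ A v`, `u ↦ - u A`. -/
def wad {n : ℕ} (A : Matrix (Fin n) (Fin n) ℂ) : Derivation ℂ (WickPoly n) (WickPoly n) :=
  ∑ i, ∑ k, A i k • ((wv k : WickPoly n) • dv i - (wu i : WickPoly n) • du k)

lemma wad_apply {n : ℕ} (A : Matrix (Fin n) (Fin n) ℂ) (f : WickPoly n) :
    wad A f = ∑ i, ∑ k, A i k • (wv k * dv i f - wu i * du k f) := by
  have hs : ∀ (s : Finset (Fin n)) (D : Fin n → Derivation ℂ (WickPoly n) (WickPoly n)),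
      (∑ i ∈ s, D i) f = ∑ i ∈ s, D i f := fun s D => by
    rw [← Derivation.coeFnAddMonoidHom_apply, map_sum, Finset.sum_apply]; rfl
  simp only [wad, hs]
  rfl

lemma wad_wv {n : ℕ} (A : Matrix (Fin n) (Fin n) ℂ) (i : Fin n) :
    wad A (wv i) = ∑ k, A i k • wv k := by
  rw [wad_apply, Finset.sum_eq_single i]
  · simp [du_wv, dv_wv]
  · intro j _ hj; simp [du_wv, dv_wv, hj]
  · simp

lemma wad_wu {n : ℕ} (A : Matrix (Fin n) (Fin n) ℂ) (k : Fin n) :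
    wad A (wu k) = - ∑ l, A l k • wu l := by
  rw [wad_apply, ← Finset.sum_neg_distrib]
  refine Finset.sum_congr rfl fun l _ => ?_
  rw [Finset.sum_eq_single k]
  · simp [du_wu, dv_wu]
  · intro j _ hj; simp [du_wu, dv_wu, hj]
  · simp

/-- The infinitesimal form of the invariance: after integration by parts both terms become the same
mixed second derivative. -/
lemma wick_wad {n : ℕ} (A : Matrix (Fin n) (Fin n) ℂ) (f : WickPoly n) :
    wick n (wad A f) = 0 := by
  simp only [wad_apply, map_sum, map_smul, map_sub, wick_wv_mul, wick_wu_mul, du_dv_comm,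
    sub_self, smul_zero, Finset.sum_const_zero]

/-- The Euler derivation in the variables `u`. -/
def weuler (n : ℕ) : Derivation ℂ (WickPoly n) (WickPoly n) :=
  ∑ i, (wu i : WickPoly n) • du i

lemma weuler_apply {n : ℕ} (f : WickPoly n) : weuler n f = ∑ i, wu i * du i f := by
  rw [weuler, ← Derivation.coeFnAddMonoidHom_apply, map_sum, Finset.sum_apply]; rfl

lemma weuler_wu {n : ℕ} (i : Fin n) : weuler n (wu i) = wu i := by
  simp [weuler_apply, du_wu]

lemma weuler_wv {n : ℕ} (i : Fin n) : weuler n (wv i) = 0 := by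
  simp [weuler_apply, du_wv]

/-- The pairing of the two families of variables. -/
def wpair (n : ℕ) : WickPoly n := ∑ i, wu i * wv i

/-- Integrating by parts in `v_i`, the derivative falls either on `u_i`, for a total of `n`, or on
`f`, for the Euler operator. -/
lemma wick_wpair_mul {n : ℕ} (f : WickPoly n) :
    wick n (wpair n * f) = n * wick n f + wick n (weuler n f) := by
  have h : ∀ i : Fin n, wick n (wu i * wv i * f) = wick n f + wick n (wu i * du i f) := by
    intro i
    rw [mul_comm (wu i), mul_assoc, wick_wv_mul, Derivation.leibniz, du_wu, if_pos rfl,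
      smul_eq_mul, smul_eq_mul, mul_one, map_add, add_comm]
  simp only [wpair, Finset.sum_mul, map_sum, h, Finset.sum_add_distrib, weuler_apply]
  simp

end

section

/-! ### The Wick functional with coefficients in an algebra -/

open scoped TensorProduct

variable {n : ℕ} {E F : Type*} [Ring E] [Algebra ℂ E] [Ring F] [Algebra ℂ F]

def wickT (n : ℕ) (E : Type*) [Ring E] [Algebra ℂ E] : WickPoly n ⊗[ℂ] E →ₗ[ℂ] E :=
  (TensorProduct.lid ℂ E).toLinearMap ∘ₗ (wick n).rTensor E

lemma wickT_tmul (p : WickPoly n) (e : E) : wickT n E (p ⊗ₜ e) = wick n p • e := by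
  simp [wickT]

lemma map_wickT (f : E →ₗ[ℂ] F) (z : WickPoly n ⊗[ℂ] E) :
    f (wickT n E z) = wickT n F (f.lTensor _ z) := by
  induction z using TensorProduct.induction_on with
  | zero => simp
  | tmul p e => simp [wickT_tmul]
  | add a b ha hb => simp only [map_add, ha, hb]

lemma wickT_mul_tmul (z : WickPoly n ⊗[ℂ] E) (e : E) :
    wickT n E (z * 1 ⊗ₜ e) = wickT n E z * e := by
  induction z using TensorProduct.induction_on with
  | zero => simp
  | tmul p e => simp [wickT_tmul]
  | add a b ha hb => simp only [add_mul, map_add, ha, hb]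

lemma wickT_tmul_mul (z : WickPoly n ⊗[ℂ] E) (e : E) :
    wickT n E (1 ⊗ₜ e * z) = e * wickT n E z := by
  induction z using TensorProduct.induction_on with
  | zero => simp
  | tmul p e => simp [wickT_tmul]
  | add a b ha hb => simp only [mul_add, map_add, ha, hb]

lemma tmul_one_comm (p : WickPoly n) (z : WickPoly n ⊗[ℂ] E) :
    z * p ⊗ₜ 1 = p ⊗ₜ 1 * z := by
  induction z using TensorProduct.induction_on with
  | zero => simp
  | tmul q e => simp [mul_comm]
  | add a b ha hb => simp only [mul_add, add_mul, ha, hb]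

lemma wickT_map (σ : WickPoly n →ₐ[ℂ] WickPoly n) (hσ : ∀ f, wick n (σ f) = wick n f)
    (z : WickPoly n ⊗[ℂ] E) :
    wickT n E (Algebra.TensorProduct.map σ (AlgHom.id ℂ E) z) = wickT n E z := by
  induction z using TensorProduct.induction_on with
  | zero => simp
  | tmul q e => simp [wickT_tmul, hσ]
  | add a b ha hb => simp only [map_add, ha, hb]

/-- The derivation of `WickPoly n ⊗ E` induced by a derivation of `WickPoly n`. -/
def extD (E : Type*) [Ring E] [Algebra ℂ E] (D : Derivation ℂ (WickPoly n) (WickPoly n)) :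
    WickPoly n ⊗[ℂ] E →ₗ[ℂ] WickPoly n ⊗[ℂ] E :=
  D.toLinearMap.rTensor E

lemma extD_tmul (D : Derivation ℂ (WickPoly n) (WickPoly n)) (p : WickPoly n) (e : E) :
    extD E D (p ⊗ₜ e) = D p ⊗ₜ e := rfl

lemma extD_mul (D : Derivation ℂ (WickPoly n) (WickPoly n)) (z w : WickPoly n ⊗[ℂ] E) :
    extD E D (z * w) = z * extD E D w + extD E D z * w := by
  induction z using TensorProduct.induction_on with
  | zero => simp
  | add a b ha hb => simp only [map_add, add_mul, ha, hb]; abel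
  | tmul p e =>
    induction w using TensorProduct.induction_on with
    | zero => simp
    | add a b ha hb => simp only [map_add, mul_add, ha, hb]; abel
    | tmul q f =>
      rw [Algebra.TensorProduct.tmul_mul_tmul, extD_tmul, extD_tmul, extD_tmul,
        Algebra.TensorProduct.tmul_mul_tmul, Algebra.TensorProduct.tmul_mul_tmul,
        Derivation.leibniz, TensorProduct.add_tmul, smul_eq_mul, smul_eq_mul, mul_comm q]

lemma extD_tmul_one_mul (D : Derivation ℂ (WickPoly n) (WickPoly n)) (m : WickPoly n)
    (z : WickPoly n ⊗[ℂ] E) :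
    extD E D (m ⊗ₜ 1 * z) = m ⊗ₜ 1 * extD E D z + D m ⊗ₜ 1 * z := by
  rw [extD_mul, extD_tmul]

lemma wickT_extD (D : Derivation ℂ (WickPoly n) (WickPoly n)) (hD : ∀ f, wick n (D f) = 0)
    (z : WickPoly n ⊗[ℂ] E) : wickT n E (extD E D z) = 0 := by
  induction z using TensorProduct.induction_on with
  | zero => simp
  | add a b ha hb => rw [map_add, map_add, ha, hb, add_zero]
  | tmul p e => rw [extD_tmul, wickT_tmul, hD, zero_smul]

lemma wickT_wpair_mul (z : WickPoly n ⊗[ℂ] E) :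
    wickT n E (wpair n ⊗ₜ 1 * z) = (n : ℂ) • wickT n E z + wickT n E (extD E (weuler n) z) := by
  induction z using TensorProduct.induction_on with
  | zero => simp
  | add a b ha hb => simp only [mul_add, map_add, ha, hb, smul_add]; abel
  | tmul p e =>
    rw [Algebra.TensorProduct.tmul_mul_tmul, extD_tmul, wickT_tmul, wickT_tmul, wickT_tmul,
      wick_wpair_mul, one_mul, add_smul, mul_smul]

/-- The linear form `(u, y)`. -/
def lu (y : V n) : WickPoly n := ∑ i, y i • wu i

/-- The linear form `(x, v)`. -/
def lv (x : VDual n) : WickPoly n := ∑ i, x i • wv i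

/-- The generic rank one element `∑ u_i v_k ⊗ a (i, k)`. -/
def gen (a : Fin n × Fin n → E) : WickPoly n ⊗[ℂ] E :=
  ∑ p, (wu p.1 * wv p.2) ⊗ₜ a p

/-- The pairing `(1 / j!) ⟨(u, y) (x, v) gen(a) ^ j⟩`. -/
def wickPairing (a : Fin n × Fin n → E) (j : ℕ) (y : V n) (x : VDual n) : E :=
  (j.factorial : ℂ)⁻¹ • wickT n E ((lu y * lv x) ⊗ₜ 1 * gen a ^ j)

lemma map_gen (f : E →ₐ[ℂ] F) (a : Fin n × Fin n → E) :
    Algebra.TensorProduct.map (AlgHom.id ℂ (WickPoly n)) f (gen a) = gen (f ∘ a) := by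
  simp [gen]

lemma map_wickT_mul_gen_pow (f : E →ₐ[ℂ] F) (a : Fin n × Fin n → E) (m : WickPoly n) (j : ℕ) :
    f (wickT n E (m ⊗ₜ 1 * gen a ^ j)) = wickT n F (m ⊗ₜ 1 * gen (f ∘ a) ^ j) := by
  have h : ∀ z : WickPoly n ⊗[ℂ] E, f.toLinearMap.lTensor (WickPoly n) z =
      Algebra.TensorProduct.map (AlgHom.id ℂ (WickPoly n)) f z := fun z => rfl
  rw [← AlgHom.toLinearMap_apply, map_wickT, h, map_mul, map_pow, map_gen,
    Algebra.TensorProduct.map_tmul, map_one]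
  rfl

lemma map_wickPairing (f : E →ₐ[ℂ] F) (a : Fin n × Fin n → E) (j : ℕ) (y : V n) (x : VDual n) :
    f (wickPairing a j y x) = wickPairing (f ∘ a) j y x := by
  rw [wickPairing, map_smul, map_wickT_mul_gen_pow, wickPairing]

lemma wickT_map_mul_gen_pow (σ : WickPoly n →ₐ[ℂ] WickPoly n)
    (hσ : ∀ f, wick n (σ f) = wick n f) (a b : Fin n × Fin n → E)
    (hab : Algebra.TensorProduct.map σ (AlgHom.id ℂ E) (gen a) = gen b) (m : WickPoly n) (j : ℕ) :
    wickT n E (σ m ⊗ₜ 1 * gen b ^ j) = wickT n E (m ⊗ₜ 1 * gen a ^ j) := by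
  rw [← wickT_map σ hσ (m ⊗ₜ 1 * gen a ^ j),
    map_mul (Algebra.TensorProduct.map σ (AlgHom.id ℂ E)), map_pow, hab,
    Algebra.TensorProduct.map_tmul, map_one]

/-- A commutator with `c` which acts on `gen a` like a derivation annihilated by the Wick
functional. -/
lemma commutator_wickT (D : Derivation ℂ (WickPoly n) (WickPoly n)) (hD : ∀ f, wick n (D f) = 0)
    (a : Fin n × Fin n → E) (c : E)
    (h : 1 ⊗ₜ c * gen a - gen a * 1 ⊗ₜ c = extD E D (gen a)) (m : WickPoly n) (j : ℕ) :
    c * wickT n E (m ⊗ₜ 1 * gen a ^ j) - wickT n E (m ⊗ₜ 1 * gen a ^ j) * c =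
      - wickT n E (D m ⊗ₜ 1 * gen a ^ j) := by
  -- The commutator with `c` and `D` are both derivations and agree on `gen a`, so they agree on its
  -- powers. The claim is then the product rule for `D` on `m · gen a ^ j`, a total derivative that
  -- the functional kills.
  have hp : ∀ j : ℕ, 1 ⊗ₜ c * gen a ^ j - gen a ^ j * 1 ⊗ₜ c = extD E D (gen a ^ j) := by
    intro j
    induction j with
    | zero =>
      rw [pow_zero, mul_one, one_mul, sub_self, Algebra.TensorProduct.one_def, extD_tmul,
        Derivation.map_one_eq_zero, TensorProduct.zero_tmul]
    | succ j ih =>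
      rw [pow_succ, extD_mul, ← ih, ← h]
      simp only [mul_sub, sub_mul, mul_assoc]
      abel
  rw [← wickT_mul_tmul, ← wickT_tmul_mul, ← map_sub, eq_neg_iff_add_eq_zero, ← map_add,
    ← wickT_extD D hD (m ⊗ₜ 1 * gen a ^ j), extD_tmul_one_mul, ← hp, mul_sub, ← mul_assoc,
    tmul_one_comm, ← mul_assoc, ← mul_assoc]

/-- Since `c m` is central, the commutator of `gen a ^ j` with `w m` is `c m` times an element `K`
that does not depend on `m`. Both sides are then the moment of `p · c m · c m' · K`, symmetric in
`m` and `m'`. -/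
lemma commutator_wickPairing_symm {M : Type*} (a : Fin n × Fin n → E) (w : M → E)
    (c : M → WickPoly n) (z : WickPoly n ⊗[ℂ] E)
    (h : ∀ m, gen a * 1 ⊗ₜ w m - 1 ⊗ₜ w m * gen a = c m ⊗ₜ 1 * z) (j : ℕ) (p : WickPoly n)
    (m m' : M) :
    wickT n E ((p * c m') ⊗ₜ 1 * gen a ^ j) * w m - w m * wickT n E ((p * c m') ⊗ₜ 1 * gen a ^ j) =
      wickT n E ((p * c m) ⊗ₜ 1 * gen a ^ j) * w m' -
        w m' * wickT n E ((p * c m) ⊗ₜ 1 * gen a ^ j) := by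
  obtain ⟨K, hK⟩ : ∃ K, ∀ m, gen a ^ j * 1 ⊗ₜ w m - 1 ⊗ₜ w m * gen a ^ j = c m ⊗ₜ 1 * K := by
    induction j with
    | zero => exact ⟨0, fun m => by simp⟩
    | succ j ih =>
      obtain ⟨K, hK⟩ := ih
      -- The Leibniz rule for the commutator of `gen a · gen a ^ j` with `w m`.
      refine ⟨z * gen a ^ j + gen a * K, fun m => ?_⟩
      have h1 : gen a * (c m ⊗ₜ 1 * K) = c m ⊗ₜ 1 * (gen a * K) := by
        rw [← mul_assoc, tmul_one_comm, mul_assoc]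
      rw [mul_add, ← mul_assoc, ← h, ← h1, ← hK, pow_succ']
      simp only [mul_sub, sub_mul, mul_assoc]
      abel
  have key : ∀ m m', wickT n E ((p * c m') ⊗ₜ 1 * gen a ^ j) * w m -
      w m * wickT n E ((p * c m') ⊗ₜ 1 * gen a ^ j) = wickT n E ((p * c m' * c m) ⊗ₜ 1 * K) := by
    intro m m'
    rw [← wickT_mul_tmul, ← wickT_tmul_mul, ← map_sub, ← mul_assoc, tmul_one_comm, mul_assoc,
      mul_assoc, ← mul_sub, hK, ← mul_assoc, Algebra.TensorProduct.tmul_mul_tmul, one_mul]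
  rw [key, key, mul_right_comm]

/-- The coefficient of `λ ^ (j - i) r_i` in `φ_λ(r_j)`. -/
def shiftCoeff (n j i : ℕ) : ℂ :=
  (j.factorial : ℂ)⁻¹ * (j.choose i * (i.factorial * ∏ b ∈ Finset.range (j - i), (n + i + 1 + b : ℂ)))

lemma extD_weuler_gen_pow (a : Fin n × Fin n → E) (j : ℕ) :
    extD E (weuler n) (gen a ^ j) = (j : ℂ) • gen a ^ j := by
  have h1 : extD E (weuler n) (gen a) = gen a := by
    rw [gen, map_sum]
    refine Finset.sum_congr rfl fun p _ => ?_
    rw [extD_tmul, Derivation.leibniz, weuler_wu, weuler_wv, smul_zero, zero_add, smul_eq_mul,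
      mul_comm]
  induction j with
  | zero =>
    rw [pow_zero, Algebra.TensorProduct.one_def, extD_tmul, Derivation.map_one_eq_zero]
    simp
  | succ j ih =>
    rw [pow_succ, extD_mul, ih, h1, smul_mul_assoc, Nat.cast_succ, add_smul, one_smul, add_comm]

lemma weuler_lu (y : V n) : weuler n (lu y) = lu y := by
  simp only [lu, map_sum, Derivation.map_smul, weuler_wu]

lemma weuler_lv (x : VDual n) : weuler n (lv x) = 0 := by
  simp [lv, map_sum, Derivation.map_smul, weuler_wv]

lemma weuler_wpair_pow (b : ℕ) : weuler n (wpair n ^ b) = (b : ℂ) • wpair n ^ b := by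
  have h1 : weuler n (wpair n) = wpair n := by
    rw [wpair, map_sum]
    refine Finset.sum_congr rfl fun p _ => ?_
    rw [Derivation.leibniz, weuler_wu, weuler_wv, smul_zero, zero_add, smul_eq_mul, mul_comm]
  induction b with
  | zero => simp
  | succ b ih =>
    rw [pow_succ, Derivation.leibniz, ih, h1, smul_eq_mul, smul_eq_mul, mul_smul_comm,
      Nat.cast_succ, add_smul, one_smul, add_comm, mul_comm (wpair n)]

/-- By `wick_wpair_mul`, removing one factor `(u, v)` costs `n` plus the degree in `u` of what
remains. That degree is `1 + b + i`, from `(u, y)`, the remaining `b` factors and `gen a ^ i`. -/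
lemma wickT_wpair_pow_mul (a : Fin n × Fin n → E) (i b : ℕ) (y : V n) (x : VDual n) :
    wickT n E ((lu y * lv x * wpair n ^ b) ⊗ₜ 1 * gen a ^ i) =
      (∏ k ∈ Finset.range b, (n + i + 1 + k : ℂ)) • wickT n E ((lu y * lv x) ⊗ₜ 1 * gen a ^ i) := by
  induction b with
  | zero => simp
  | succ b ih =>
    have hw : weuler n (lu y * lv x * wpair n ^ b) =
        ((1 : ℂ) + b) • (lu y * lv x * wpair n ^ b) := by
      rw [Derivation.leibniz, Derivation.leibniz, weuler_lu, weuler_lv, weuler_wpair_pow]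
      simp only [smul_eq_mul, mul_zero, zero_add, mul_smul_comm, add_smul, one_smul]
      ring
    have h1 : (lu y * lv x * wpair n ^ (b + 1)) ⊗ₜ[ℂ] (1 : E) * gen a ^ i =
        wpair n ⊗ₜ 1 * ((lu y * lv x * wpair n ^ b) ⊗ₜ 1 * gen a ^ i) := by
      rw [← mul_assoc, Algebra.TensorProduct.tmul_mul_tmul, one_mul]
      congr 2
      ring
    rw [h1, wickT_wpair_mul, extD_tmul_one_mul, hw, extD_weuler_gen_pow, mul_smul_comm,
      ← TensorProduct.smul_tmul', smul_mul_assoc, map_add, map_smul, map_smul, ih,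
      Finset.prod_range_succ, ← add_smul, ← add_smul, smul_smul]
    congr 1
    ring

/-- The scalars on the diagonal add the central element `λ (u, v)` to the generic one, so the
binomial theorem applies and `wickT_wpair_pow_mul` evaluates each term. -/
lemma wickPairing_shift (a : Fin n × Fin n → E) (lam : ℂ) (j : ℕ) (y : V n) (x : VDual n) :
    wickPairing (fun p => a p + algebraMap ℂ E (if p.1 = p.2 then lam else 0)) j y x =
      ∑ i ∈ Finset.range (j + 1), (shiftCoeff n j i * lam ^ (j - i)) • wickPairing a i y x := by
  have hg : gen (fun p => a p + algebraMap ℂ E (if p.1 = p.2 then lam else 0)) =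
      gen a + (lam • wpair n) ⊗ₜ 1 := by
    simp only [gen, TensorProduct.tmul_add, Finset.sum_add_distrib]
    congr 1
    rw [wpair, Finset.smul_sum, TensorProduct.sum_tmul, Fintype.sum_prod_type]
    refine Finset.sum_congr rfl fun i _ => ?_
    rw [Finset.sum_eq_single i]
    · rw [if_pos rfl, Algebra.algebraMap_eq_smul_one, TensorProduct.smul_tmul]
    · intro k _ hk
      simp [Ne.symm hk]
    · simp
  have hc : Commute (gen a) ((lam • wpair n) ⊗ₜ (1 : E)) := tmul_one_comm _ _
  rw [wickPairing, hg, hc.add_pow, Finset.mul_sum, map_sum, Finset.smul_sum]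
  refine Finset.sum_congr rfl fun i hi => ?_
  have h1 : (lu y * lv x) ⊗ₜ[ℂ] (1 : E) *
      (gen a ^ i * ((lam • wpair n) ⊗ₜ[ℂ] (1 : E)) ^ (j - i) * ((j.choose i : ℕ) : WickPoly n ⊗[ℂ] E)) =
      ((j.choose i : ℂ) * lam ^ (j - i)) •
        ((lu y * lv x * wpair n ^ (j - i)) ⊗ₜ 1 * gen a ^ i) := by
    rw [Algebra.TensorProduct.tmul_pow, one_pow, tmul_one_comm, ← mul_assoc, ← mul_assoc,
      Algebra.TensorProduct.tmul_mul_tmul, one_mul, smul_pow, mul_smul_comm,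
      ← TensorProduct.smul_tmul', smul_mul_assoc, mul_smul, ← Nat.cast_comm, ← nsmul_eq_mul,
      Nat.cast_smul_eq_nsmul]
  rw [h1, map_smul, wickT_wpair_pow_mul, wickPairing, shiftCoeff, smul_smul, smul_smul, smul_smul]
  congr 1
  have : (i.factorial : ℂ) ≠ 0 := by exact_mod_cast i.factorial_ne_zero
  field_simp

lemma shiftCoeff_self (n j : ℕ) : shiftCoeff n j j = 1 := by
  have : (j.factorial : ℂ) ≠ 0 := by exact_mod_cast j.factorial_ne_zero
  simp [shiftCoeff, this]

/-- The value is `n + j + 1`. -/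
lemma shiftCoeff_succ_ne_zero (n j : ℕ) : shiftCoeff n (j + 1) j ≠ 0 := by
  have h1 : ((j + 1).factorial : ℂ) ≠ 0 := by exact_mod_cast (j + 1).factorial_ne_zero
  have h2 : (j.factorial : ℂ) ≠ 0 := by exact_mod_cast j.factorial_ne_zero
  have h3 : (n + j + 1 : ℂ) ≠ 0 := by exact_mod_cast (n + j).succ_ne_zero
  have h4 : (j + 1 : ℂ) ≠ 0 := by exact_mod_cast j.succ_ne_zero
  simp [shiftCoeff, h1, h2, h3, h4]

end

section

/-! ### The symmetrization of a power of a linear form -/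

open scoped TensorProduct

variable {n : ℕ}

lemma sum_pow_eq_sum_prod_ofFn {ι R : Type*} [Fintype ι] [Semiring R] (b : ι → R) (j : ℕ) :
    (∑ p, b p) ^ j = ∑ f : Fin j → ι, (List.ofFn fun i => b (f i)).prod := by
  induction j with
  | zero => simp
  | succ j ih =>
    rw [pow_succ', ih, Finset.sum_mul_sum, ← Fintype.sum_prod_type',
      ← (Fin.consEquiv fun _ : Fin (j + 1) => ι).sum_comp]
    refine Finset.sum_congr rfl fun q _ => ?_
    rw [List.ofFn_succ, List.prod_cons]
    simp [Fin.consEquiv]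

lemma prod_ofFn_tmul {E : Type*} [Ring E] [Algebra ℂ E] (j : ℕ) (c : Fin j → WickPoly n)
    (e : Fin j → E) :
    (List.ofFn fun i => c i ⊗ₜ[ℂ] e i).prod = (∏ i, c i) ⊗ₜ (List.ofFn e).prod := by
  induction j with
  | zero => simp [Algebra.TensorProduct.one_def]
  | succ j ih =>
    rw [List.ofFn_succ, List.prod_cons, ih, Algebra.TensorProduct.tmul_mul_tmul,
      Fin.prod_univ_succ, List.ofFn_succ, List.prod_cons]

lemma gen_pow {E : Type*} [Ring E] [Algebra ℂ E] (a : Fin n × Fin n → E) (j : ℕ) :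
    gen a ^ j = ∑ f : Fin j → Fin n × Fin n,
      (∏ i, wu (f i).1 * wv (f i).2) ⊗ₜ (List.ofFn fun i => a (f i)).prod := by
  rw [gen, sum_pow_eq_sum_prod_ofFn]
  exact Finset.sum_congr rfl fun f _ => prod_ofFn_tmul _ _ _

lemma symProd_comp_perm {R : Type*} [Ring R] [Algebra ℂ R] {k : ℕ} (a : Fin k → R)
    (e : Equiv.Perm (Fin k)) : symProd (a ∘ e) = symProd a := by
  rw [symProd, symProd]
  congr 1
  exact Fintype.sum_equiv (Equiv.mulLeft e) _ _ fun σ => rfl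

/-- Equal multisets of values mean fibres of equal size, and bijections between the fibres glue to a
permutation. -/
lemma exists_perm_of_map_univ_eq {k : ℕ} {ι : Type*} (f g : Fin k → ι)
    (h : Multiset.map f Finset.univ.val = Multiset.map g Finset.univ.val) :
    ∃ e : Equiv.Perm (Fin k), f = g ∘ e := by
  classical
  have hc : ∀ c, Nonempty ({i // f i = c} ≃ {i // g i = c}) := fun c => by
    refine ⟨Fintype.equivOfCardEq ?_⟩
    have := congrArg (Multiset.count c) h
    rw [Multiset.count_map, Multiset.count_map] at this
    simp only [Fintype.card_subtype, Finset.card_def, Finset.filter_val]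
    simpa only [eq_comm] using this
  exact ⟨Equiv.ofFiberEquiv fun c => (hc c).some,
    funext fun i => (Equiv.ofFiberEquiv_map _ i).symm⟩

/-- The order in which `toList` enumerates a multiset is arbitrary; this shows that `symmetrization`
does not depend on it. -/
lemma symProd_list {R : Type*} [Ring R] [Algebra ℂ R] {ι : Type*} (a : ι → R) {k : ℕ}
    (f : Fin k → ι) (l : List ι) (h : (l : Multiset ι) = Multiset.map f Finset.univ.val) :
    symProd (fun i : Fin l.length => a (l.get i)) = symProd (fun i => a (f i)) := by
  have hk : l.length = k := by
    have := congrArg Multiset.card h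
    simpa using this
  subst hk
  obtain ⟨e, he⟩ := exists_perm_of_map_univ_eq l.get f (by
    rw [← h]
    have : (Finset.univ : Finset (Fin l.length)).val = (List.finRange l.length : Multiset _) := rfl
    rw [this, Multiset.map_coe, List.map_get_finRange])
  have : (fun i : Fin l.length => a (l.get i)) = (fun i => a (f i)) ∘ e := by
    funext i
    rw [he]; rfl
  rw [this, symProd_comp_perm]

lemma symmetrization_prod_X {k : ℕ} (f : Fin k → Fin n × Fin n) :
    symmetrization n (List.ofFn fun i => MvPolynomial.X (f i)).prod =
      symProd fun i => toU n (coordElt n (f i)) := by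
  have h : (List.ofFn fun i => (MvPolynomial.X (f i) : MvPolynomial (Fin n × Fin n) ℂ)).prod =
      MvPolynomial.basisMonomials (Fin n × Fin n) ℂ (∑ i, Finsupp.single (f i) 1) := by
    rw [List.prod_ofFn, MvPolynomial.coe_basisMonomials]
    exact (MvPolynomial.monomial_sum_one _ _).symm
  rw [h, symmetrization, Module.Basis.constr_basis]
  refine symProd_list (fun p => toU n (coordElt n p)) f _ ?_
  rw [Multiset.coe_toList, map_sum]
  simp only [Finsupp.toMultiset_single, one_smul]
  rw [← Multiset.sum_map_singleton (Multiset.map f _), Multiset.map_map]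
  rfl

/-- The weight of a word in the expansion of `gen ^ j` is a moment of a commutative monomial, hence
invariant under permutations of the letters. All `j!` orderings therefore contribute equally, and
averaging over them changes nothing. -/
lemma symmetrization_wickT (m : WickPoly n) (j : ℕ) :
    symmetrization n (wickT n _ (m ⊗ₜ 1 * gen (fun p => MvPolynomial.X p) ^ j)) =
      wickT n _ (m ⊗ₜ 1 * gen (fun p => toU n (coordElt n p)) ^ j) := by
  set w : (Fin j → Fin n × Fin n) → ℂ := fun f => wick n (m * ∏ i, wu (f i).1 * wv (f i).2)
  have hw : ∀ f (σ : Equiv.Perm (Fin j)), w (f ∘ σ) = w f := fun f σ => by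
    simp only [w, Function.comp_apply]
    rw [Equiv.prod_comp σ (fun i => (wu (f i).1 * wv (f i).2 : WickPoly n))]
  simp only [gen_pow, Finset.mul_sum, Algebra.TensorProduct.tmul_mul_tmul, map_sum, wickT_tmul,
    one_mul, map_smul, symmetrization_prod_X]
  change ∑ f, w f • symProd _ = ∑ f, w f • _
  have h1 : ∀ σ : Equiv.Perm (Fin j),
      ∑ f, w f • (List.ofFn fun i => toU n (coordElt n (f (σ i)))).prod =
      ∑ f, w f • (List.ofFn fun i => toU n (coordElt n (f i))).prod := fun σ =>
    Fintype.sum_equiv (σ.symm.arrowCongr (Equiv.refl _)) _ _ fun f => by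
      have : (σ.symm.arrowCongr (Equiv.refl (Fin n × Fin n))) f = f ∘ σ := rfl
      rw [this, hw]; rfl
  simp only [symProd, smul_comm (w _)]
  rw [← Finset.smul_sum]
  conv_lhs =>
    enter [2, 2, f]
    rw [Finset.smul_sum]
  rw [Finset.sum_comm]
  simp only [h1, Finset.sum_const, Finset.card_univ, Fintype.card_perm, Fintype.card_fin]
  rw [← Nat.cast_smul_eq_nsmul ℂ, smul_smul, inv_mul_cancel₀, one_smul]
  exact_mod_cast j.factorial_ne_zero

/-! ### The generating series -/

/-- Jacobi's formula for a derivation of a commutative ring. -/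
lemma derivation_det {k R ι : Type*} [CommRing k] [CommRing R] [Algebra k R] [Fintype ι]
    [DecidableEq ι] (D : Derivation k R R) (M : Matrix ι ι R) :
    D M.det = (M.adjugate * M.map D).trace := by
  have hprod : ∀ (s : Finset ι) (f : ι → R),
      D (∏ i ∈ s, f i) = ∑ i ∈ s, (∏ j ∈ s.erase i, f j) * D (f i) := by
    intro s f
    induction s using Finset.induction_on with
    | empty => simp
    | insert a s ha ih =>
      rw [Finset.prod_insert ha, Derivation.leibniz, ih, Finset.sum_insert ha,
        Finset.erase_insert ha, smul_eq_mul, smul_eq_mul, add_comm, Finset.mul_sum]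
      congr 1
      refine Finset.sum_congr rfl fun i hi => ?_
      have hne : a ≠ i := fun h => ha (h ▸ hi)
      rw [Finset.erase_insert_of_ne hne, Finset.prod_insert (fun h => ha (Finset.mem_of_mem_erase h)),
        mul_assoc]
  have htr : (M.adjugate * M.map D).trace = ∑ i, (M.updateCol i fun k => D (M k i)).det := by
    refine Finset.sum_congr rfl fun i _ => ?_
    rw [← Matrix.cramer_apply, Matrix.cramer_eq_adjugate_mulVec]
    rfl
  rw [htr, Matrix.det_apply, map_sum]
  simp only [Matrix.det_apply, map_zsmul, Units.smul_def, hprod]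
  rw [Finset.sum_comm]
  refine Finset.sum_congr rfl fun σ _ => ?_
  rw [← Finset.smul_sum]
  congr 1
  refine Finset.sum_congr rfl fun i _ => ?_
  rw [← Finset.prod_erase_mul _ _ (Finset.mem_univ i), Matrix.updateCol_self]
  congr 1
  refine Finset.prod_congr rfl fun l hl => ?_
  rw [Matrix.updateCol_ne (Finset.ne_of_mem_erase hl)]

/-! ### Gaussian moments over a commutative ring: the determinant formula. -/

section Moments

variable {S : Type*} [CommRing S] [Algebra ℂ S] (a : Fin n × Fin n → S)

lemma wickT_wv_mul (i : Fin n) (z : WickPoly n ⊗[ℂ] S) :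
    wickT n S (wv i ⊗ₜ 1 * z) = wickT n S (extD S (du i) z) := by
  induction z using TensorProduct.induction_on with
  | zero => simp
  | add x y hx hy => rw [mul_add, map_add, map_add, map_add, hx, hy]
  | tmul p e => rw [Algebra.TensorProduct.tmul_mul_tmul, one_mul, extD_tmul, wickT_tmul,
      wickT_tmul, wick_wv_mul]

lemma extD_du_gen_pow (i : Fin n) (j : ℕ) :
    extD S (du i) (gen a ^ (j + 1)) =
      ((j + 1 : ℕ) : ℂ) • ((∑ l, wv l ⊗ₜ a (i, l)) * gen a ^ j) := by
  have h1 : extD S (du i) (gen a) = ∑ l, wv l ⊗ₜ a (i, l) := by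
    rw [gen, map_sum, Fintype.sum_prod_type, Finset.sum_eq_single i]
    · refine Finset.sum_congr rfl fun l _ => ?_
      rw [extD_tmul, Derivation.leibniz, du_wu, du_wv, if_pos rfl]
      simp
    · intro k _ hk
      refine Finset.sum_eq_zero fun l _ => ?_
      rw [extD_tmul, Derivation.leibniz, du_wu, du_wv, if_neg hk.symm]
      simp
    · simp
  induction j with
  | zero => simp [h1]
  | succ j ih =>
    rw [pow_succ, extD_mul, ih, h1, smul_mul_assoc, mul_assoc, ← pow_succ,
      mul_comm (gen a ^ (j + 1)), Nat.cast_succ (j + 1), add_smul, one_smul, add_comm]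

/-- The normalized moments `⟨gen(a) ^ j⟩ / j!`. -/
def moment (j : ℕ) : S := (j.factorial : ℂ)⁻¹ • wickT n S (gen a ^ j)

/-- The normalized moments `⟨v_i u_k gen(a) ^ j⟩ / j!`. -/
def moment₂ (j : ℕ) (i k : Fin n) : S :=
  (j.factorial : ℂ)⁻¹ • wickT n S ((wv i * wu k) ⊗ₜ 1 * gen a ^ j)

lemma moment_zero : moment a 0 = 1 := by
  simp [moment, Algebra.TensorProduct.one_def, wickT_tmul, wick_one]

lemma wickT_tmul_mul_gen_pow (m : WickPoly n) (s : S) (z : WickPoly n ⊗[ℂ] S) :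
    wickT n S (m ⊗ₜ s * z) = s * wickT n S (m ⊗ₜ 1 * z) := by
  rw [← wickT_tmul_mul, ← mul_assoc, Algebra.TensorProduct.tmul_mul_tmul, one_mul, mul_one]

lemma moment₂_zero (i k : Fin n) : moment₂ a 0 i k = if i = k then 1 else 0 := by
  rw [moment₂, pow_zero, mul_one, wickT_tmul, wick_wv_mul, du_wu]
  split_ifs <;> simp [wick_one]

/-- Integration by parts in `v_i`: the derivative falls on `u_k` or on one of the `j + 1` factors
`gen a`. -/
lemma moment₂_succ (j : ℕ) (i k : Fin n) :
    moment₂ a (j + 1) i k =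
      (if i = k then moment a (j + 1) else 0) + ∑ l, a (i, l) * moment₂ a j l k := by
  have hsplit : ∀ z : WickPoly n ⊗[ℂ] S,
      (wv i * wu k) ⊗ₜ 1 * z = wv i ⊗ₜ 1 * (wu k ⊗ₜ 1 * z) := fun z => by
    rw [← mul_assoc, Algebra.TensorProduct.tmul_mul_tmul, one_mul]
  have h1 : (((j + 1).factorial : ℂ)⁻¹) * ((j + 1 : ℕ) : ℂ) = (j.factorial : ℂ)⁻¹ := by
    have h2 : (j.factorial : ℂ) ≠ 0 := by exact_mod_cast j.factorial_ne_zero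
    have h4 : ((j + 1 : ℕ) : ℂ) ≠ 0 := by exact_mod_cast j.succ_ne_zero
    rw [Nat.factorial_succ, Nat.cast_mul]
    field_simp
  rw [moment₂, hsplit, wickT_wv_mul, extD_tmul_one_mul, extD_du_gen_pow, map_add, smul_add,
    mul_smul_comm, map_smul, smul_smul, h1, add_comm]
  congr 1
  · rw [du_wu]
    split_ifs
    · rw [moment, ← Algebra.TensorProduct.one_def, one_mul]
    · simp
  · rw [Finset.sum_mul, Finset.mul_sum, map_sum, Finset.smul_sum]
    refine Finset.sum_congr rfl fun l _ => ?_
    rw [← mul_assoc, Algebra.TensorProduct.tmul_mul_tmul, one_mul, wickT_tmul_mul_gen_pow,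
      moment₂, mul_smul_comm, mul_comm (wu k)]

lemma succ_smul_moment (j : ℕ) :
    ((j + 1 : ℕ) : ℂ) • moment a (j + 1) = ∑ i, ∑ l, a (i, l) * moment₂ a j l i := by
  have h1 : ((j + 1 : ℕ) : ℂ) * (((j + 1).factorial : ℂ)⁻¹) = (j.factorial : ℂ)⁻¹ := by
    have h2 : (j.factorial : ℂ) ≠ 0 := by exact_mod_cast j.factorial_ne_zero
    have h4 : ((j + 1 : ℕ) : ℂ) ≠ 0 := by exact_mod_cast j.succ_ne_zero
    rw [Nat.factorial_succ, Nat.cast_mul]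
    field_simp
  rw [moment, smul_smul, h1, pow_succ', ← Fintype.sum_prod_type']
  conv_lhs => rw [gen, Finset.sum_mul, map_sum, Finset.smul_sum]
  refine Finset.sum_congr rfl fun p _ => ?_
  rw [wickT_tmul_mul_gen_pow, moment₂, mul_smul_comm, mul_comm (wu p.1)]
  rfl

def momentSeries : PowerSeries S := PowerSeries.mk (moment a)

def moment₂Series : Matrix (Fin n) (Fin n) (PowerSeries S) :=
  fun i k => PowerSeries.mk fun j => moment₂ a j i k

/-- The matrix with the entries `a (i, k)`, as constant power series. -/
def coeffMatrix : Matrix (Fin n) (Fin n) (PowerSeries S) := fun i k => PowerSeries.C (a (i, k))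

/-- The recursion `moment₂_succ` as an identity of series: the second moments are the zeroth moment
times `(1 - τA)⁻¹`. -/
lemma one_sub_mul_moment₂Series :
    (1 - (PowerSeries.X : PowerSeries S) • coeffMatrix a) * moment₂Series a =
      momentSeries a • (1 : Matrix (Fin n) (Fin n) (PowerSeries S)) := by
  rw [sub_mul, one_mul, sub_eq_iff_eq_add, Matrix.smul_mul]
  ext i k j
  have h1 : PowerSeries.coeff j ((momentSeries a • (1 : Matrix (Fin n) (Fin n) (PowerSeries S))) i k)
      = if i = k then moment a j else 0 := by
    rw [Matrix.smul_apply, Matrix.one_apply, smul_eq_mul]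
    split_ifs <;> simp [momentSeries]
  rw [Matrix.add_apply, map_add, h1, Matrix.smul_apply, smul_eq_mul]
  rcases j with _ | j
  · simp [moment₂Series, moment₂_zero, moment_zero]
  · rw [PowerSeries.coeff_succ_X_mul, Matrix.mul_apply, map_sum]
    simp only [moment₂Series, coeffMatrix, PowerSeries.coeff_mk, PowerSeries.coeff_C_mul,
      moment₂_succ]

lemma derivative_momentSeries :
    PowerSeries.derivative S (momentSeries a) = (coeffMatrix a * moment₂Series a).trace := by
  ext j
  have h := succ_smul_moment a j
  rw [PowerSeries.coeff_derivative, momentSeries, PowerSeries.coeff_mk, Matrix.trace, map_sum]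
  simp only [Matrix.diag, Matrix.mul_apply, map_sum, coeffMatrix, moment₂Series,
    PowerSeries.coeff_C_mul, PowerSeries.coeff_mk]
  rw [← h, Algebra.smul_def, mul_comm]
  simp

/-- The product has constant term 1, and its derivative vanishes: by Jacobi's formula the derivative
of the determinant contributes `-tr(A adj)` times the moment series, which cancels the term from
`derivative_momentSeries`. -/
lemma momentSeries_mul_det :
    momentSeries a * (1 - (PowerSeries.X : PowerSeries S) • coeffMatrix a).det = 1 := by
  -- Torsion-freeness makes a power series determined by its derivative and its constant term.
  have : IsAddTorsionFree S := ⟨fun k hk s t h => by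
    have hk' : (k : ℂ) ≠ 0 := by exact_mod_cast hk
    simp only [← Nat.cast_smul_eq_nsmul ℂ] at h
    simpa [smul_smul, inv_mul_cancel₀ hk'] using congrArg ((k : ℂ)⁻¹ • ·) h⟩
  set M := 1 - (PowerSeries.X : PowerSeries S) • coeffMatrix a with hM
  refine PowerSeries.derivative.ext ?_ ?_
  · have hMD : M.map (PowerSeries.derivative S) = - coeffMatrix a := by
      ext1 i k
      rw [Matrix.map_apply, hM, Matrix.sub_apply, Matrix.smul_apply, map_sub, Matrix.neg_apply,
        smul_eq_mul, Derivation.leibniz, PowerSeries.derivative_X, coeffMatrix,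
        PowerSeries.derivative_C, Matrix.one_apply]
      split_ifs <;> simp
    have hG : M.det • moment₂Series a = momentSeries a • M.adjugate := by
      have := congrArg (M.adjugate * ·) (one_sub_mul_moment₂Series a)
      simpa [← hM, ← mul_assoc, Matrix.adjugate_mul] using this
    have htr := congrArg (fun Z => (coeffMatrix a * Z).trace) hG
    simp only [Matrix.mul_smul, Matrix.trace_smul, smul_eq_mul] at htr
    rw [Derivation.leibniz, derivation_det, hMD, derivative_momentSeries, smul_eq_mul,
      smul_eq_mul, htr, mul_neg, Matrix.trace_neg, Matrix.trace_mul_comm, mul_neg,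
      neg_add_cancel, Derivation.map_one_eq_zero]
  · have h : (PowerSeries.constantCoeff (R := S)).mapMatrix M = 1 := by
      ext i k
      rw [hM]
      by_cases hik : i = k <;> simp [Matrix.one_apply, hik]
    rw [map_mul, RingHom.map_det, h]
    simp [momentSeries, moment_zero]

end Moments

/-- By the two series identities the moment series is `det(1 - τA)⁻¹` and the matrix of second
moments is that series times `(1 - τA)⁻¹`; contracting with `x` and `y` gives the generating series
of the `α_j`. -/
lemma alpha_eq_wickPairing (j : ℕ) (y : V n) (x : VDual n) :
    alpha n j y x = wickPairing (fun p => (MvPolynomial.X p : MvPolynomial _ ℂ)) j y x := by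
  set a : Fin n × Fin n → MvPolynomial (Fin n × Fin n) ℂ := fun p => MvPolynomial.X p
  have hM : oneSubTauA n = 1 - (PowerSeries.X : PowerSeries _) • coeffMatrix a := rfl
  have hdet := momentSeries_mul_det a
  have hG := one_sub_mul_moment₂Series a
  rw [← hM] at hdet hG
  have hu := isUnit_det_oneSubTauA n
  have hinv : Ring.inverse (oneSubTauA n).det = momentSeries a := by
    rw [← one_mul (Ring.inverse _), ← hdet, mul_assoc, Ring.mul_inverse_cancel _ hu, mul_one]
  have hMinv : momentSeries a • (oneSubTauA n)⁻¹ = moment₂Series a := by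
    have := congrArg ((oneSubTauA n)⁻¹ * ·) hG
    simp only [← mul_assoc, Matrix.nonsing_inv_mul _ hu, one_mul, Matrix.mul_smul, mul_one] at this
    exact this.symm
  have hs : alphaSeries n y x =
      ∑ i, ∑ k, algebraMap ℂ _ (x i * y k) * moment₂Series a i k := by
    rw [alphaSeries, hinv, ← hMinv, Finset.sum_mul]
    refine Finset.sum_congr rfl fun i _ => ?_
    rw [Matrix.mulVec, dotProduct, Finset.mul_sum, Finset.sum_mul]
    refine Finset.sum_congr rfl fun k _ => ?_
    rw [Matrix.smul_apply, smul_eq_mul, map_mul]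
    ring
  have hp : lu y * lv x = ∑ i, ∑ k, (x i * y k) • (wv i * wu k) := by
    rw [lu, lv, mul_comm, Finset.sum_mul_sum]
    refine Finset.sum_congr rfl fun i _ => Finset.sum_congr rfl fun k _ => ?_
    rw [smul_mul_smul_comm]
  rw [alpha, hs, wickPairing, hp]
  simp only [TensorProduct.sum_tmul, Finset.sum_mul, map_sum, Finset.smul_sum,
    ← TensorProduct.smul_tmul', smul_mul_assoc, map_smul]
  refine Finset.sum_congr rfl fun i _ => Finset.sum_congr rfl fun k _ => ?_
  rw [smul_comm, ← Algebra.smul_def, PowerSeries.coeff_smul, moment₂Series, PowerSeries.coeff_mk,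
    moment₂]

lemma r_eq_wickPairing (j : ℕ) (y : V n) (x : VDual n) :
    r n j y x = wickPairing (fun p => toU n (coordElt n p)) j y x := by
  rw [r, alpha_eq_wickPairing, wickPairing, wickPairing, map_smul, symmetrization_wickT]

end

section

/-! ### Properties of the invariant pairings -/

open scoped TensorProduct

variable {n : ℕ} {E : Type*} [Ring E] [Algebra ℂ E]

lemma toU_eq_linear (A : Gl n) :
    toU n A = (UniversalEnvelopingAlgebra.ι ℂ : Gl n →ₗ⁅ℂ⁆ U n).toLinearMap A := rfl

lemma toU_add (A B : Gl n) : toU n (A + B) = toU n A + toU n B := map_add _ _ _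

lemma toU_smul (c : ℂ) (A : Gl n) : toU n (c • A) = c • toU n A := map_smul _ _ _

lemma toU_neg (A : Gl n) : toU n (-A) = -toU n A := by
  simp only [toU_eq_linear, map_neg]

lemma toU_lie (A B : Gl n) : toU n A * toU n B - toU n B * toU n A = toU n (A * B - B * A) :=
  (LieHom.map_lie (UniversalEnvelopingAlgebra.ι ℂ : Gl n →ₗ⁅ℂ⁆ U n) A B).symm

/-- The algebra map from `U(gl_n)` which extends a representation of `gl_n`. -/
def uLift (g : Gl n →ₗ[ℂ] E) (h : ∀ A B, g A * g B - g B * g A = g (A * B - B * A)) :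
    U n →ₐ[ℂ] E :=
  UniversalEnvelopingAlgebra.lift ℂ
    { g with
      map_lie' := fun {A B} => (h A B).symm }

lemma uLift_toU (g : Gl n →ₗ[ℂ] E) (h : ∀ A B, g A * g B - g B * g A = g (A * B - B * A))
    (A : Gl n) : uLift g h (toU n A) = g A :=
  UniversalEnvelopingAlgebra.lift_ι_apply ℂ _ A

lemma u_hom_ext {f g : U n →ₐ[ℂ] E} (h : ∀ A, f (toU n A) = g (toU n A)) : f = g :=
  UniversalEnvelopingAlgebra.hom_ext ℂ (LieHom.ext h)

lemma uLift_comp (f : U n →ₐ[ℂ] E) (h) :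
    uLift (f.toLinearMap ∘ₗ (UniversalEnvelopingAlgebra.ι ℂ : Gl n →ₗ⁅ℂ⁆ U n).toLinearMap) h = f :=
  u_hom_ext fun A => uLift_toU _ h A

lemma phi_toU (lam : ℂ) (A : Gl n) :
    phi n lam (toU n A) = toU n A + algebraMap ℂ (U n) (lam * Matrix.trace A) :=
  UniversalEnvelopingAlgebra.lift_ι_apply ℂ _ A

lemma map_r (f : U n →ₐ[ℂ] E) (j : ℕ) (y : V n) (x : VDual n) :
    f (r n j y x) = wickPairing (fun p => f (toU n (coordElt n p))) j y x := by
  rw [r_eq_wickPairing, map_wickPairing]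
  rfl

lemma phi_r (lam : ℂ) (j : ℕ) (y : V n) (x : VDual n) :
    phi n lam (r n j y x) =
      ∑ i ∈ Finset.range (j + 1), (shiftCoeff n j i * lam ^ (j - i)) • r n i y x := by
  rw [map_r]
  simp only [r_eq_wickPairing]
  rw [← wickPairing_shift]
  congr 1
  funext p
  rw [phi_toU, coordElt]
  congr 2
  by_cases h : p.1 = p.2
  · simp [h]
  · rw [if_neg h, Matrix.trace_single_eq_of_ne _ _ _ (Ne.symm h), mul_zero]

/-- The generic element is the rank one matrix `v u`, and `B (v u) C = (B v)(u C)`. Multiplications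
on `gl_n` thus become substitutions in the variables. -/
lemma sum_tmul_mul_coordElt_mul (g : Gl n →ₗ[ℂ] E) (B C : Gl n) :
    ∑ p : Fin n × Fin n, (wu p.1 * wv p.2 : WickPoly n) ⊗ₜ[ℂ] g (B * coordElt n p * C) =
      ∑ p : Fin n × Fin n,
        ((∑ l, C l p.1 • wu l) * (∑ m, B p.2 m • wv m) : WickPoly n) ⊗ₜ[ℂ] g (coordElt n p) := by
  have h : ∀ p : Fin n × Fin n, B * coordElt n p * C =
      ∑ q : Fin n × Fin n, (C p.1 q.1 * B q.2 p.2) • coordElt n q := by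
    intro p
    ext a b
    rw [Fintype.sum_prod_type, Matrix.sum_apply, Finset.sum_eq_single b]
    · rw [Matrix.sum_apply, Finset.sum_eq_single a]
      · simp [coordElt, Matrix.mul_apply, Matrix.single_apply, Finset.sum_ite_eq, ite_and, mul_comm]
      · intro c _ hc
        simp [coordElt, hc]
      · simp
    · intro c _ hc
      rw [Matrix.sum_apply]
      exact Finset.sum_eq_zero fun d _ => by simp [coordElt, hc]
    · simp
  simp only [h, map_sum, map_smul, TensorProduct.tmul_sum, TensorProduct.tmul_smul]
  rw [Finset.sum_comm]
  refine Finset.sum_congr rfl fun q _ => ?_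
  rw [Finset.sum_mul_sum, ← Fintype.sum_prod_type', TensorProduct.sum_tmul]
  refine Finset.sum_congr rfl fun p _ => ?_
  rw [smul_mul_smul_comm, TensorProduct.smul_tmul']

/-- Conjugation on `U(gl_n)`. -/
def conjU (B C : Gl n) (h : C * B = 1) : U n →ₐ[ℂ] U n :=
  uLift ((UniversalEnvelopingAlgebra.ι ℂ : Gl n →ₗ⁅ℂ⁆ U n).toLinearMap ∘ₗ
    LinearMap.mulLeft ℂ B ∘ₗ LinearMap.mulRight ℂ C) fun X Y => by
      have h1 : ∀ X Y : Gl n, B * (X * C) * (B * (Y * C)) = B * (X * Y * C) := fun X Y => by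
        calc B * (X * C) * (B * (Y * C)) = B * (X * (C * B) * (Y * C)) := by noncomm_ring
          _ = _ := by rw [h]; noncomm_ring
      simp only [LinearMap.comp_apply, LinearMap.mulLeft_apply, LinearMap.mulRight_apply,
        ← toU_eq_linear, toU_lie, h1, sub_mul, mul_sub]

lemma conjU_toU (B C : Gl n) (h : C * B = 1) (A : Gl n) :
    conjU B C h (toU n A) = toU n (B * A * C) := by
  rw [conjU, uLift_toU, mul_assoc]; rfl

lemma wsubst_lu (B C : Gl n) (y : V n) : wsubst B C (lu y) = lu (C *ᵥ y) := by
  simp only [lu, map_sum, map_smul, wsubst_wu, Finset.smul_sum, Matrix.mulVec, dotProduct,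
    Finset.sum_smul, smul_smul]
  rw [Finset.sum_comm]
  simp only [mul_comm]

lemma wsubst_lv (B C : Gl n) (x : VDual n) : wsubst B C (lv x) = lv (x ᵥ* B) := by
  simp only [lv, map_sum, map_smul, wsubst_wv, Finset.smul_sum, Matrix.vecMul, dotProduct,
    Finset.sum_smul, smul_smul]
  rw [Finset.sum_comm]

lemma conjU_r (B C : Gl n) (h : C * B = 1) (j : ℕ) (y : V n) (x : VDual n) :
    conjU B C h (r n j y x) = r n j (B *ᵥ y) (x ᵥ* C) := by
  have h1 : lu y * lv x = wsubst B C (lu (B *ᵥ y) * lv (x ᵥ* C)) := by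
    rw [map_mul, wsubst_lu, wsubst_lv, Matrix.mulVec_mulVec, Matrix.vecMul_vecMul, h,
      Matrix.one_mulVec, Matrix.vecMul_one]
  rw [map_r, r_eq_wickPairing, wickPairing, wickPairing, h1]
  congr 1
  refine wickT_map_mul_gen_pow _ (wick_wsubst h) _ _ ?_ _ _
  simp only [conjU_toU, gen, map_sum, Algebra.TensorProduct.map_tmul, map_mul, wsubst_wu, wsubst_wv,
    AlgHom.id_apply]
  exact (sum_tmul_mul_coordElt_mul
    (UniversalEnvelopingAlgebra.ι ℂ : Gl n →ₗ⁅ℂ⁆ U n).toLinearMap B C).symm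

/-- The automorphism `A ↦ - Aᵀ` of `U(gl_n)`. -/
def negTransposeU (n : ℕ) : U n →ₐ[ℂ] U n :=
  uLift
    { toFun := fun A => -toU n Aᵀ
      map_add' := fun A B => by rw [Matrix.transpose_add, toU_add, neg_add]
      map_smul' := fun c A => by rw [Matrix.transpose_smul, toU_smul, smul_neg, RingHom.id_apply] }
    fun X Y => by
      simp only [LinearMap.coe_mk, AddHom.coe_mk, neg_mul_neg, toU_lie]
      rw [← toU_neg, Matrix.transpose_sub, Matrix.transpose_mul, Matrix.transpose_mul, neg_sub]

lemma negTransposeU_toU (A : Gl n) : negTransposeU n (toU n A) = -toU n Aᵀ := by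
  rw [negTransposeU, uLift_toU]; rfl

lemma wswap_lu (y : V n) : wswap n (lu y) = lv y := by
  simp only [lu, lv, map_sum, map_smul, wswap_wu]

lemma wswap_lv (y : V n) : wswap n (lv y) = lu y := by
  simp only [lu, lv, map_sum, map_smul, wswap_wv]

/-- On the generic element, `A ↦ -Aᵀ` acts as the exchange of `u` and `v` together with a sign,
which occurs once for each of the `j` factors. -/
lemma negTransposeU_r (j : ℕ) (y : V n) (x : VDual n) :
    negTransposeU n (r n j y x) = (-1 : ℂ) ^ j • r n j x y := by
  have h1 : lu y * lv x = wswap n (lu x * lv y) := by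
    rw [map_mul, wswap_lu, wswap_lv, mul_comm]
  have h2 : gen (fun p => negTransposeU n (toU n (coordElt n p))) =
      (-1 : ℂ) • gen (fun p => toU n (coordElt n p.swap)) := by
    rw [gen, gen, Finset.smul_sum]
    refine Finset.sum_congr rfl fun p _ => ?_
    rw [negTransposeU_toU, coordElt, coordElt, Matrix.transpose_single, ← neg_one_smul ℂ,
      TensorProduct.tmul_smul]
    rfl
  rw [map_r, r_eq_wickPairing, wickPairing, wickPairing, h1, h2, smul_pow, mul_smul_comm, map_smul,
    smul_comm]
  congr 2
  refine wickT_map_mul_gen_pow _ wick_wswap _ _ ?_ _ _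
  simp only [gen, map_sum, Algebra.TensorProduct.map_tmul, map_mul, wswap_wu, wswap_wv,
    AlgHom.id_apply]
  rw [← (Equiv.prodComm (Fin n) (Fin n)).sum_comp]
  refine Finset.sum_congr rfl fun p _ => ?_
  simp [mul_comm]

lemma wad_lu (A : Gl n) (y : V n) : wad A (lu y) = - lu (A *ᵥ y) := by
  simp only [lu, map_sum, Derivation.map_smul, wad_wu, smul_neg, Finset.smul_sum, Matrix.mulVec,
    dotProduct, Finset.sum_smul, smul_smul, Finset.sum_neg_distrib]
  rw [Finset.sum_comm]
  simp only [mul_comm]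

lemma wad_lv (A : Gl n) (x : VDual n) : wad A (lv x) = lv (x ᵥ* A) := by
  simp only [lv, map_sum, Derivation.map_smul, wad_wv, Finset.smul_sum, Matrix.vecMul,
    dotProduct, Finset.sum_smul, smul_smul]
  rw [Finset.sum_comm]

/-- The adjoint action of `A` on the generic element is the derivation `wad A`, which the Wick
functional annihilates. What survives is its action on `(u, y)(x, v)`. -/
lemma toU_r_commutator (A : Gl n) (j : ℕ) (y : V n) (x : VDual n) :
    toU n A * r n j y x - r n j y x * toU n A = r n j (A *ᵥ y) x - r n j y (x ᵥ* A) := by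
  have h : 1 ⊗ₜ[ℂ] toU n A * gen (fun p => toU n (coordElt n p)) -
      gen (fun p => toU n (coordElt n p)) * 1 ⊗ₜ[ℂ] toU n A =
        extD (U n) (wad A) (gen fun p => toU n (coordElt n p)) := by
    have e1 := sum_tmul_mul_coordElt_mul
      (UniversalEnvelopingAlgebra.ι ℂ : Gl n →ₗ⁅ℂ⁆ U n).toLinearMap A 1
    have e2 := sum_tmul_mul_coordElt_mul
      (UniversalEnvelopingAlgebra.ι ℂ : Gl n →ₗ⁅ℂ⁆ U n).toLinearMap 1 A
    have hone : ∀ i (w : Fin n → WickPoly n), ∑ l, (1 : Gl n) i l • w l = w i := by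
      intro i w
      simp [Matrix.one_apply]
    have hone' : ∀ i (w : Fin n → WickPoly n), ∑ l, (1 : Gl n) l i • w l = w i := by
      intro i w
      simp [Matrix.one_apply]
    simp only [mul_one, one_mul, hone, hone', ← toU_eq_linear] at e1 e2
    have e3 : extD (U n) (wad A) (gen fun p => toU n (coordElt n p)) =
        ∑ p : Fin n × Fin n, (wu p.1 * ∑ m, A p.2 m • wv m : WickPoly n) ⊗ₜ[ℂ] toU n (coordElt n p)
        - ∑ p : Fin n × Fin n, ((∑ l, A l p.1 • wu l) * wv p.2 : WickPoly n) ⊗ₜ[ℂ]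
          toU n (coordElt n p) := by
      rw [gen, map_sum, ← Finset.sum_sub_distrib]
      refine Finset.sum_congr rfl fun p _ => ?_
      rw [extD_tmul, Derivation.leibniz, wad_wu, wad_wv, ← TensorProduct.sub_tmul, smul_eq_mul,
        smul_eq_mul, mul_neg, sub_eq_add_neg, mul_comm (wv p.2)]
    rw [e3, ← e1, ← e2, gen, Finset.mul_sum, Finset.sum_mul, ← Finset.sum_sub_distrib,
      ← Finset.sum_sub_distrib]
    refine Finset.sum_congr rfl fun p _ => ?_
    rw [Algebra.TensorProduct.tmul_mul_tmul, Algebra.TensorProduct.tmul_mul_tmul, one_mul, mul_one,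
      ← TensorProduct.tmul_sub, toU_lie, ← TensorProduct.tmul_sub]
    simp only [toU_eq_linear, map_sub]
  have key := commutator_wickT (wad A) (wick_wad A) _ _ h (lu y * lv x) j
  simp only [r_eq_wickPairing, wickPairing, mul_smul_comm, smul_mul_assoc]
  have hD : wad A (lu y * lv x) = lu y * lv (x ᵥ* A) - lu (A *ᵥ y) * lv x := by
    rw [Derivation.leibniz, wad_lu, wad_lv, smul_eq_mul, smul_eq_mul]
    ring
  rw [← smul_sub, key, hD, TensorProduct.sub_tmul, sub_mul, map_sub, neg_sub, smul_sub]

/-- The Jacobi identity for `y, y', x`. A matrix unit sends `y` to a coordinate of `y` times a basis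
vector, so the commutator of the generic element with `w y` has the central factor `(u, y)`. The
target algebra is arbitrary because the identity is applied to operators on the Verma module before
anything is known about `H_ζ`. -/
lemma map_r_commutator_symm (f : U n →ₐ[ℂ] E) (w : V n →ₗ[ℂ] E)
    (hw : ∀ A y, f (toU n A) * w y - w y * f (toU n A) = w (A *ᵥ y)) (j : ℕ) (x : VDual n)
    (y y' : V n) :
    f (r n j y' x) * w y - w y * f (r n j y' x) = f (r n j y x) * w y' - w y' * f (r n j y x) := by
  have h : ∀ y, gen (fun p => f (toU n (coordElt n p))) * 1 ⊗ₜ w y -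
      1 ⊗ₜ w y * gen (fun p => f (toU n (coordElt n p))) =
        lu y ⊗ₜ 1 * ∑ k, wv k ⊗ₜ w (Pi.single k 1) := by
    intro y
    rw [gen, Finset.sum_mul, Finset.mul_sum, ← Finset.sum_sub_distrib, lu, TensorProduct.sum_tmul,
      Finset.sum_mul_sum, ← Fintype.sum_prod_type']
    refine Finset.sum_congr rfl fun p _ => ?_
    have : coordElt n p *ᵥ y = y p.1 • (Pi.single p.2 1 : Fin n → ℂ) := by
      rw [coordElt, Matrix.single_mulVec]
      ext i
      by_cases h : i = p.2 <;> simp [h]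
    rw [Algebra.TensorProduct.tmul_mul_tmul, Algebra.TensorProduct.tmul_mul_tmul,
      Algebra.TensorProduct.tmul_mul_tmul, one_mul, mul_one, one_mul, ← TensorProduct.tmul_sub, hw,
      this, map_smul, smul_mul_assoc, TensorProduct.smul_tmul]
  have key := commutator_wickPairing_symm _ w lu _ h j (lv x) y y'
  simp only [map_r, wickPairing, mul_smul_comm, smul_mul_assoc, ← smul_sub, mul_comm (lu _)]
  rw [key]

lemma map_r_commutator_symm' (f : U n →ₐ[ℂ] E) (w : VDual n →ₗ[ℂ] E)
    (hw : ∀ A x, f (toU n A) * w x - w x * f (toU n A) = w (-(x ᵥ* A))) (j : ℕ) (y : V n)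
    (x x' : VDual n) :
    f (r n j y x') * w x - w x * f (r n j y x') = f (r n j y x) * w x' - w x' * f (r n j y x) := by
  have h : ∀ x, gen (fun p => f (toU n (coordElt n p))) * 1 ⊗ₜ w x -
      1 ⊗ₜ w x * gen (fun p => f (toU n (coordElt n p))) =
        lv x ⊗ₜ 1 * ∑ k, wu k ⊗ₜ w (-Pi.single k 1) := by
    intro x
    rw [gen, Finset.sum_mul, Finset.mul_sum, ← Finset.sum_sub_distrib, lv, TensorProduct.sum_tmul,
      Finset.sum_mul_sum, Finset.sum_comm, ← Fintype.sum_prod_type']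
    refine Finset.sum_congr rfl fun p _ => ?_
    have : x ᵥ* coordElt n p = x p.2 • (Pi.single p.1 1 : Fin n → ℂ) := by
      ext i
      rw [coordElt, Matrix.vecMul, dotProduct, Finset.sum_eq_single p.2]
      · by_cases h : i = p.1 <;> simp [h, eq_comm]
      · intro k _ hk
        simp [hk.symm]
      · simp
    rw [Algebra.TensorProduct.tmul_mul_tmul, Algebra.TensorProduct.tmul_mul_tmul,
      Algebra.TensorProduct.tmul_mul_tmul, one_mul, mul_one, one_mul, ← TensorProduct.tmul_sub, hw,
      this, ← smul_neg, map_smul, smul_mul_assoc, TensorProduct.smul_tmul, mul_comm (wv p.2)]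
  have key := commutator_wickPairing_symm _ w lv _ h j (lu y) x x'
  simp only [map_r, wickPairing, mul_smul_comm, smul_mul_assoc, ← smul_sub]
  rw [key]

lemma wickPairing_add_left (a : Fin n × Fin n → E) (j : ℕ) (y y' : V n) (x : VDual n) :
    wickPairing a j (y + y') x = wickPairing a j y x + wickPairing a j y' x := by
  have h : lu (y + y') = lu y + lu y' := by
    simp only [lu, Pi.add_apply, add_smul, Finset.sum_add_distrib]
  simp only [wickPairing, h, add_mul, TensorProduct.add_tmul, map_add, smul_add]

lemma wickPairing_smul_left (a : Fin n × Fin n → E) (j : ℕ) (c : ℂ) (y : V n) (x : VDual n) :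
    wickPairing a j (c • y) x = c • wickPairing a j y x := by
  have h : lu (c • y) = c • lu y := by
    simp only [lu, Pi.smul_apply, smul_eq_mul, mul_smul, Finset.smul_sum]
  simp only [wickPairing, h, smul_mul_assoc, ← TensorProduct.smul_tmul', map_smul]
  rw [smul_comm]

lemma wickPairing_add_right (a : Fin n × Fin n → E) (j : ℕ) (y : V n) (x x' : VDual n) :
    wickPairing a j y (x + x') = wickPairing a j y x + wickPairing a j y x' := by
  have h : lv (x + x') = lv x + lv x' := by
    simp only [lv, Pi.add_apply, add_smul, Finset.sum_add_distrib]
  simp only [wickPairing, h, mul_add, add_mul, TensorProduct.add_tmul, map_add, smul_add]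

lemma wickPairing_smul_right (a : Fin n × Fin n → E) (j : ℕ) (c : ℂ) (y : V n) (x : VDual n) :
    wickPairing a j y (c • x) = c • wickPairing a j y x := by
  have h : lv (c • x) = c • lv x := by
    simp only [lv, Pi.smul_apply, smul_eq_mul, mul_smul, Finset.smul_sum]
  simp only [wickPairing, h, mul_smul_comm, smul_mul_assoc, ← TensorProduct.smul_tmul', map_smul]
  rw [smul_comm]

/-! ### Properties of the deformations -/

variable (ζ : ℕ →₀ ℂ)

lemma pairing_eq_sum (y : V n) (x : VDual n) :
    pairing n ζ y x = ∑ j ∈ ζ.support, ζ j • r n j y x := rfl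

lemma pairing_eq_sum_range {m : ℕ} (h : ∀ j, m ≤ j → ζ j = 0) (y : V n) (x : VDual n) :
    pairing n ζ y x = ∑ j ∈ Finset.range m, ζ j • r n j y x := by
  refine Finset.sum_subset (fun j hj => ?_) (fun j _ hj => ?_)
  · rw [Finset.mem_range]
    by_contra hjm
    exact Finsupp.mem_support_iff.mp hj (h j (not_lt.mp hjm))
  · simp only [Finsupp.notMem_support_iff.mp hj, zero_smul]

/-- A deformation, as a bilinear map. -/
def pairingHom : V n →ₗ[ℂ] VDual n →ₗ[ℂ] U n :=
  LinearMap.mk₂ ℂ (pairing n ζ)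
    (fun y y' x => by
      simp only [pairing_eq_sum, r_eq_wickPairing, wickPairing_add_left, smul_add,
        Finset.sum_add_distrib])
    (fun c y x => by
      simp only [pairing_eq_sum, r_eq_wickPairing, wickPairing_smul_left, Finset.smul_sum,
        smul_comm c])
    (fun y x x' => by
      simp only [pairing_eq_sum, r_eq_wickPairing, wickPairing_add_right, smul_add,
        Finset.sum_add_distrib])
    (fun c y x => by
      simp only [pairing_eq_sum, r_eq_wickPairing, wickPairing_smul_right, Finset.smul_sum,
        smul_comm c])

lemma pairingHom_apply (y : V n) (x : VDual n) : pairingHom ζ y x = pairing n ζ y x := rfl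

lemma conjU_pairing (B C : Gl n) (h : C * B = 1) (y : V n) (x : VDual n) :
    conjU B C h (pairing n ζ y x) = pairing n ζ (B *ᵥ y) (x ᵥ* C) := by
  simp only [pairing_eq_sum, map_sum, map_smul, conjU_r]

lemma pairing_signTwist (s : ℤˣ) (y : V n) (x : VDual n) :
    pairing n (signTwist s ζ) y x =
      ∑ j ∈ ζ.support, (((s : ℤ) : ℂ) ^ j * ζ j) • r n j y x := by
  refine Finset.sum_subset (fun j hj => ?_) (fun j _ hj => ?_)
  · exact Finsupp.support_onFinset_subset hj
  · simp only [Finsupp.notMem_support_iff.mp hj, zero_smul]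

lemma signTwist_one : signTwist 1 ζ = ζ := by
  ext j
  simp [signTwist]

lemma negTransposeU_pairing (y : V n) (x : VDual n) :
    negTransposeU n (pairing n ζ y x) = pairing n (signTwist (-1) ζ) x y := by
  rw [pairing_eq_sum, pairing_signTwist, map_sum]
  refine Finset.sum_congr rfl fun j _ => ?_
  rw [map_smul, negTransposeU_r, smul_smul, mul_comm]
  simp

lemma toU_pairing_commutator (A : Gl n) (y : V n) (x : VDual n) :
    toU n A * pairing n ζ y x - pairing n ζ y x * toU n A =
      pairing n ζ (A *ᵥ y) x - pairing n ζ y (x ᵥ* A) := by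
  simp only [pairing_eq_sum, Finset.mul_sum, Finset.sum_mul, ← Finset.sum_sub_distrib,
    mul_smul_comm, smul_mul_assoc, ← smul_sub, toU_r_commutator]

lemma map_pairing_commutator_symm (f : U n →ₐ[ℂ] E) (w : V n →ₗ[ℂ] E)
    (hw : ∀ A y, f (toU n A) * w y - w y * f (toU n A) = w (A *ᵥ y)) (x : VDual n)
    (y y' : V n) :
    f (pairing n ζ y' x) * w y - w y * f (pairing n ζ y' x) =
      f (pairing n ζ y x) * w y' - w y' * f (pairing n ζ y x) := by
  simp only [pairing_eq_sum, map_sum, map_smul, Finset.mul_sum, Finset.sum_mul,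
    ← Finset.sum_sub_distrib, mul_smul_comm, smul_mul_assoc, ← smul_sub,
    map_r_commutator_symm f w hw _ x y y']

lemma map_pairing_commutator_symm' (f : U n →ₐ[ℂ] E) (w : VDual n →ₗ[ℂ] E)
    (hw : ∀ A x, f (toU n A) * w x - w x * f (toU n A) = w (-(x ᵥ* A))) (y : V n)
    (x x' : VDual n) :
    f (pairing n ζ y x') * w x - w x * f (pairing n ζ y x') =
      f (pairing n ζ y x) * w x' - w x' * f (pairing n ζ y x) := by
  simp only [pairing_eq_sum, map_sum, map_smul, Finset.mul_sum, Finset.sum_mul,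
    ← Finset.sum_sub_distrib, mul_smul_comm, smul_mul_assoc, ← smul_sub,
    map_r_commutator_symm' f w hw _ y x x']

end

section

/-! ### Generators of the semidirect product -/

variable {n : ℕ} {E : Type*} [Ring E] [Algebra ℂ E]

/-- An element of `gl_n` in the semidirect product. -/
def sGl (n : ℕ) (A : Gl n) : Semi n := RingQuot.mkAlgHom ℂ (SemiRel n) (tGl n A)

lemma uToSemi_toU (A : Gl n) : uToSemi n (toU n A) = sGl n A :=
  UniversalEnvelopingAlgebra.lift_ι_apply ℂ _ A

lemma sGl_sV (A : Gl n) (y : V n) : sGl n A * sV n y - sV n y * sGl n A = sV n (A *ᵥ y) := by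
  rw [sV, sV, sGl, ← RingQuot.mkAlgHom_rel ℂ (SemiRel.v A y), map_sub, map_mul, map_mul]

lemma sGl_sVDual (A : Gl n) (x : VDual n) :
    sGl n A * sVDual n x - sVDual n x * sGl n A = sVDual n (-(x ᵥ* A)) := by
  rw [sVDual, sVDual, sGl, ← RingQuot.mkAlgHom_rel ℂ (SemiRel.vdual A x), map_sub, map_mul, map_mul]

/-- The inclusion of `V_n` in the semidirect product, as a linear map. -/
def sVHom (n : ℕ) : V n →ₗ[ℂ] Semi n :=
  (RingQuot.mkAlgHom ℂ (SemiRel n)).toLinearMap ∘ₗ TensorAlgebra.ι ℂ ∘ₗ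
    LinearMap.inr ℂ (Gl n) (V n × VDual n) ∘ₗ LinearMap.inl ℂ (V n) (VDual n)

/-- The inclusion of `V_n^*` in the semidirect product, as a linear map. -/
def sVDualHom (n : ℕ) : VDual n →ₗ[ℂ] Semi n :=
  (RingQuot.mkAlgHom ℂ (SemiRel n)).toLinearMap ∘ₗ TensorAlgebra.ι ℂ ∘ₗ
    LinearMap.inr ℂ (Gl n) (V n × VDual n) ∘ₗ LinearMap.inr ℂ (V n) (VDual n)

lemma sVDualHom_apply (x : VDual n) : sVDualHom n x = sVDual n x := rfl

/-- The universal property of the semidirect product. -/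
def semiLift (g : Gl n →ₗ[ℂ] E) (gv : V n →ₗ[ℂ] E) (gx : VDual n →ₗ[ℂ] E)
    (h : ∀ A B, g A * g B - g B * g A = g (A * B - B * A))
    (hv : ∀ A y, g A * gv y - gv y * g A = gv (A *ᵥ y))
    (hx : ∀ A x, g A * gx x - gx x * g A = gx (-(x ᵥ* A))) : Semi n →ₐ[ℂ] E :=
  RingQuot.liftAlgHom ℂ ⟨TensorAlgebra.lift ℂ (g.coprod (gv.coprod gx)), fun {a b} hab => by
    cases hab with
    | gl A B =>
      simp only [tGl, map_sub, map_mul, TensorAlgebra.lift_ι_apply, LinearMap.coprod_apply,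
        map_zero, add_zero, h]
      rw [LieRing.of_associative_ring_bracket, map_sub]
    | v A y =>
      simp only [tGl, tV, map_sub, map_mul, TensorAlgebra.lift_ι_apply, LinearMap.coprod_apply,
        map_zero, add_zero, zero_add, hv]
    | vdual A x =>
      simp only [tGl, tVDual, map_sub, map_mul, TensorAlgebra.lift_ι_apply, LinearMap.coprod_apply,
        map_zero, add_zero, zero_add, hx]⟩

section

variable (g : Gl n →ₗ[ℂ] E) (gv : V n →ₗ[ℂ] E) (gx : VDual n →ₗ[ℂ] E)
    (h : ∀ A B, g A * g B - g B * g A = g (A * B - B * A))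
    (hv : ∀ A y, g A * gv y - gv y * g A = gv (A *ᵥ y))
    (hx : ∀ A x, g A * gx x - gx x * g A = gx (-(x ᵥ* A)))

lemma semiLift_sGl (A : Gl n) : semiLift g gv gx h hv hx (sGl n A) = g A := by
  simp [semiLift, sGl, RingQuot.liftAlgHom_mkAlgHom_apply, tGl, TensorAlgebra.lift_ι_apply]

lemma semiLift_sV (y : V n) : semiLift g gv gx h hv hx (sV n y) = gv y := by
  simp [semiLift, sV, RingQuot.liftAlgHom_mkAlgHom_apply, tV, TensorAlgebra.lift_ι_apply]

lemma semiLift_sVDual (x : VDual n) : semiLift g gv gx h hv hx (sVDual n x) = gx x := by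
  simp [semiLift, sVDual, RingQuot.liftAlgHom_mkAlgHom_apply, tVDual, TensorAlgebra.lift_ι_apply]

lemma semiLift_uToSemi (u : U n) : semiLift g gv gx h hv hx (uToSemi n u) = uLift g h u := by
  have : (semiLift g gv gx h hv hx).comp (uToSemi n) = uLift g h := u_hom_ext fun A => by
    rw [AlgHom.comp_apply, uToSemi_toU, semiLift_sGl, uLift_toU]
  exact DFunLike.congr_fun this u

end

lemma semi_hom_ext {f f' : Semi n →ₐ[ℂ] E} (h : ∀ A, f (sGl n A) = f' (sGl n A))
    (hv : ∀ y, f (sV n y) = f' (sV n y)) (hx : ∀ x, f (sVDual n x) = f' (sVDual n x)) :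
    f = f' := by
  refine RingQuot.ringQuot_ext' _ _ _ (TensorAlgebra.hom_ext (LinearMap.ext fun z => ?_))
  have hz : z = (z.1, 0, 0) + (0, z.2.1, 0) + (0, 0, z.2.2) := by simp
  rw [hz, map_add, map_add, map_add, map_add]
  exact congrArg₂ _ (congrArg₂ _ (h z.1) (hv z.2.1)) (hx z.2.2)

/-! ### The semidirect product of `U(gl_n)` with the symmetric algebra of `V_n^*` -/

/-- The relations of the semidirect product, together with `y = 0` and `[x, x'] = 0`. -/
inductive SymRel (n : ℕ) : TAlg n → TAlg n → Prop
  | semi {a b : TAlg n} (h : SemiRel n a b) : SymRel n a b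
  | v (y : V n) : SymRel n (tV n y) 0
  | xx (x x' : VDual n) : SymRel n (tVDual n x * tVDual n x' - tVDual n x' * tVDual n x) 0

/-- The semidirect product `U(gl_n) ⋉ S(V_n^*)`. -/
abbrev SymSemi (n : ℕ) : Type := RingQuot (SymRel n)

/-- The projection onto `U(gl_n) ⋉ S(V_n^*)`. -/
def symMk (n : ℕ) : Semi n →ₐ[ℂ] SymSemi n :=
  RingQuot.liftAlgHom ℂ ⟨RingQuot.mkAlgHom ℂ (SymRel n), fun {_ _} h =>
    RingQuot.mkAlgHom_rel ℂ (SymRel.semi h)⟩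

lemma symMk_mk (t : TAlg n) :
    symMk n (RingQuot.mkAlgHom ℂ (SemiRel n) t) = RingQuot.mkAlgHom ℂ (SymRel n) t :=
  RingQuot.liftAlgHom_mkAlgHom_apply ..

/-- The canonical map `U(gl_n) → U(gl_n) ⋉ S(V_n^*)`. -/
def bU (n : ℕ) : U n →ₐ[ℂ] SymSemi n := (symMk n).comp (uToSemi n)

/-- The canonical map `V_n^* → U(gl_n) ⋉ S(V_n^*)`. -/
def bX (n : ℕ) : VDual n →ₗ[ℂ] SymSemi n := (symMk n).toLinearMap ∘ₗ sVDualHom n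

lemma bU_toU (A : Gl n) : bU n (toU n A) = RingQuot.mkAlgHom ℂ (SymRel n) (tGl n A) := by
  rw [bU, AlgHom.comp_apply, uToSemi_toU, sGl, symMk_mk]

lemma bX_apply (x : VDual n) : bX n x = RingQuot.mkAlgHom ℂ (SymRel n) (tVDual n x) := by
  rw [bX, LinearMap.comp_apply, sVDualHom_apply, sVDual, AlgHom.toLinearMap_apply, symMk_mk]

lemma bU_bX (A : Gl n) (x : VDual n) :
    bU n (toU n A) * bX n x - bX n x * bU n (toU n A) = bX n (-(x ᵥ* A)) := by
  have := congrArg (symMk n) (sGl_sVDual A x)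
  rw [← uToSemi_toU, map_sub, map_mul, map_mul] at this
  exact this

lemma bX_comm (x x' : VDual n) : bX n x * bX n x' = bX n x' * bX n x := by
  have := RingQuot.mkAlgHom_rel ℂ (SymRel.xx x x')
  rwa [map_sub, map_mul, map_mul, map_zero, sub_eq_zero, ← bX_apply, ← bX_apply] at this

section

variable (g : Gl n →ₗ[ℂ] E) (gx : VDual n →ₗ[ℂ] E)
    (h : ∀ A B, g A * g B - g B * g A = g (A * B - B * A))
    (hx : ∀ A x, g A * gx x - gx x * g A = gx (-(x ᵥ* A)))
    (hxx : ∀ x x', gx x * gx x' = gx x' * gx x)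

/-- The universal property of `U(gl_n) ⋉ S(V_n^*)`. -/
def symSemiLift : SymSemi n →ₐ[ℂ] E :=
  RingQuot.liftAlgHom ℂ ⟨(semiLift g 0 gx h (by simp) hx).comp (RingQuot.mkAlgHom ℂ (SemiRel n)),
    fun {a b} hab => by
      cases hab with
      | semi hs => rw [AlgHom.comp_apply, AlgHom.comp_apply, RingQuot.mkAlgHom_rel ℂ hs]
      | v y =>
        rw [map_zero, AlgHom.comp_apply]
        exact semiLift_sV ..
      | xx x x' =>
        have hs : ∀ x, (semiLift g 0 gx h (by simp) hx).comp (RingQuot.mkAlgHom ℂ (SemiRel n))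
            (tVDual n x) = gx x := fun x => semiLift_sVDual ..
        rw [map_sub, map_mul, map_mul, hs, hs, map_zero, hxx, sub_self]⟩

lemma symSemiLift_mk (t : TAlg n) : symSemiLift g gx h hx hxx (RingQuot.mkAlgHom ℂ (SymRel n) t) =
    semiLift g 0 gx h (by simp) hx (RingQuot.mkAlgHom ℂ (SemiRel n) t) :=
  RingQuot.liftAlgHom_mkAlgHom_apply ..

lemma symSemiLift_bU (u : U n) : symSemiLift g gx h hx hxx (bU n u) = uLift g h u := by
  have : (symSemiLift g gx h hx hxx).comp (bU n) = uLift g h := u_hom_ext fun A => by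
    rw [AlgHom.comp_apply, bU_toU, symSemiLift_mk, uLift_toU]
    exact semiLift_sGl ..
  exact DFunLike.congr_fun this u

lemma symSemiLift_bX (x : VDual n) : symSemiLift g gx h hx hxx (bX n x) = gx x := by
  rw [bX_apply, symSemiLift_mk]
  exact semiLift_sVDual ..

end

lemma mem_subalgebra_symSemi (S : Subalgebra ℂ (SymSemi n)) (h : ∀ A, bU n (toU n A) ∈ S)
    (hx : ∀ x, bX n x ∈ S) (b : SymSemi n) : b ∈ S := by
  obtain ⟨t, rfl⟩ := RingQuot.mkAlgHom_surjective ℂ (SymRel n) b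
  induction t using TensorAlgebra.induction with
  | algebraMap c =>
    rw [AlgHom.commutes]
    exact S.algebraMap_mem c
  | mul a b ha hb =>
    rw [map_mul]
    exact S.mul_mem ha hb
  | add a b ha hb =>
    rw [map_add]
    exact S.add_mem ha hb
  | ι z =>
    have hz : z = (z.1, 0, 0) + (0, z.2.1, 0) + (0, 0, z.2.2) := by simp
    rw [hz]
    simp only [map_add]
    refine S.add_mem (S.add_mem ?_ ?_) ?_
    · have := h z.1
      rwa [bU_toU] at this
    · have := RingQuot.mkAlgHom_rel ℂ (SymRel.v z.2.1)
      rw [map_zero] at this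
      exact (congrArg (· ∈ S) this).mpr S.zero_mem
    · have := hx z.2.2
      rwa [bX_apply] at this

/-- Sending `V^*` to zero gives a retraction onto `U(gl_n)`. -/
lemma bU_injective (n : ℕ) : Function.Injective (bU n) := by
  let f : SymSemi n →ₐ[ℂ] U n := symSemiLift
    (UniversalEnvelopingAlgebra.ι ℂ : Gl n →ₗ⁅ℂ⁆ U n).toLinearMap 0
    (fun A B => toU_lie A B) (by simp) (by simp)
  have hf : f.comp (bU n) = AlgHom.id ℂ _ := u_hom_ext fun A =>
    (symSemiLift_bU _ _ _ _ _ _).trans (uLift_toU _ _ _)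
  exact Function.LeftInverse.injective (g := f) fun u => DFunLike.congr_fun hf u

/-- The algebra acts on `ℂ ⊕ V^*`, the symmetric algebra truncated above degree one, and `x` is
recovered as the image of `1`. -/
lemma bX_injective (n : ℕ) : Function.Injective (bX n) := by
  let f : SymSemi n →ₐ[ℂ] Module.End ℂ (ℂ × VDual n) := symSemiLift
    { toFun := fun A => LinearMap.inr ℂ ℂ (VDual n) ∘ₗ (-A.vecMulLinear) ∘ₗ LinearMap.snd ℂ ℂ (VDual n)
      map_add' := fun A B => LinearMap.ext fun z => by
        simp [add_comm]
      map_smul' := fun c A => LinearMap.ext fun z => by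
        simp }
    { toFun := fun x => LinearMap.inr ℂ ℂ (VDual n) ∘ₗ (LinearMap.fst ℂ ℂ (VDual n)).smulRight x
      map_add' := fun A B => LinearMap.ext fun z => by simp
      map_smul' := fun c A => LinearMap.ext fun z => by simp [smul_comm c] }
    (fun A B => LinearMap.ext fun z => by
      simp)
    (fun A x => LinearMap.ext fun z => by
      simp)
    (fun x x' => LinearMap.ext fun z => by simp)
  intro x x' hxx
  have h1 : ∀ x, f (bX n x) (1, 0) = (0, x) := fun x =>
    (LinearMap.congr_fun (symSemiLift_bX _ _ _ _ _ _) _).trans (by simp)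
  have := h1 x
  rw [hxx, h1] at this
  exact (Prod.ext_iff.mp this).2.symm

end

section

/-! ### Generators of `H_ζ(gl_n)` -/

variable {n : ℕ} {E : Type*} [Ring E] [Algebra ℂ E]

/-- The canonical map `U(gl_n) → H_ζ(gl_n)`. -/
def hU (n : ℕ) (ζ : ℕ →₀ ℂ) : U n →ₐ[ℂ] H n ζ :=
  (RingQuot.mkAlgHom ℂ (HRel n (pairing n ζ))).comp (uToSemi n)

/-- The canonical map `V_n → H_ζ(gl_n)`. -/
def hV (n : ℕ) (ζ : ℕ →₀ ℂ) : V n →ₗ[ℂ] H n ζ :=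
  (RingQuot.mkAlgHom ℂ (HRel n (pairing n ζ))).toLinearMap ∘ₗ sVHom n

/-- The canonical map `V_n^* → H_ζ(gl_n)`. -/
def hX (n : ℕ) (ζ : ℕ →₀ ℂ) : VDual n →ₗ[ℂ] H n ζ :=
  (RingQuot.mkAlgHom ℂ (HRel n (pairing n ζ))).toLinearMap ∘ₗ sVDualHom n

variable (ζ : ℕ →₀ ℂ)

lemma proj_tGl (A : Gl n) : proj n ζ (tGl n A) = hU n ζ (toU n A) := by
  rw [hU, AlgHom.comp_apply, uToSemi_toU]; rfl

lemma proj_tV (y : V n) : proj n ζ (tV n y) = hV n ζ y := rfl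

lemma proj_tVDual (x : VDual n) : proj n ζ (tVDual n x) = hX n ζ x := rfl

lemma hU_hV (A : Gl n) (y : V n) :
    hU n ζ (toU n A) * hV n ζ y - hV n ζ y * hU n ζ (toU n A) = hV n ζ (A *ᵥ y) := by
  have := congrArg (RingQuot.mkAlgHom ℂ (HRel n (pairing n ζ))) (sGl_sV A y)
  rw [← uToSemi_toU, map_sub, map_mul, map_mul] at this
  exact this

lemma hU_hX (A : Gl n) (x : VDual n) :
    hU n ζ (toU n A) * hX n ζ x - hX n ζ x * hU n ζ (toU n A) = hX n ζ (-(x ᵥ* A)) := by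
  have := congrArg (RingQuot.mkAlgHom ℂ (HRel n (pairing n ζ))) (sGl_sVDual A x)
  rw [← uToSemi_toU, map_sub, map_mul, map_mul] at this
  exact this

lemma hV_comm (y y' : V n) : hV n ζ y * hV n ζ y' = hV n ζ y' * hV n ζ y := by
  have := RingQuot.mkAlgHom_rel ℂ (HRel.yy (η := pairing n ζ) y y')
  rw [map_sub, map_mul, map_mul, map_zero, sub_eq_zero] at this
  exact this

lemma hX_comm (x x' : VDual n) : hX n ζ x * hX n ζ x' = hX n ζ x' * hX n ζ x := by
  have := RingQuot.mkAlgHom_rel ℂ (HRel.xx (η := pairing n ζ) x x')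
  rw [map_sub, map_mul, map_mul, map_zero, sub_eq_zero] at this
  exact this

lemma hV_hX (y : V n) (x : VDual n) :
    hV n ζ y * hX n ζ x - hX n ζ x * hV n ζ y = hU n ζ (pairing n ζ y x) := by
  have := RingQuot.mkAlgHom_rel ℂ (HRel.yx (η := pairing n ζ) y x)
  rw [map_sub, map_mul, map_mul] at this
  exact this

section

variable (g : Gl n →ₗ[ℂ] E) (gv : V n →ₗ[ℂ] E) (gx : VDual n →ₗ[ℂ] E)
    (h : ∀ A B, g A * g B - g B * g A = g (A * B - B * A))
    (hv : ∀ A y, g A * gv y - gv y * g A = gv (A *ᵥ y))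
    (hx : ∀ A x, g A * gx x - gx x * g A = gx (-(x ᵥ* A)))
    (hvv : ∀ y y', gv y * gv y' = gv y' * gv y)
    (hxx : ∀ x x', gx x * gx x' = gx x' * gx x)
    (hvx : ∀ y x, gv y * gx x - gx x * gv y = uLift g h (pairing n ζ y x))

/-- The universal property of `H_ζ(gl_n)`. -/
def hLift : H n ζ →ₐ[ℂ] E :=
  RingQuot.liftAlgHom ℂ ⟨semiLift g gv gx h hv hx, fun {a b} hab => by
    cases hab with
    | yy y y' => rw [map_sub, map_mul, map_mul, semiLift_sV, semiLift_sV, map_zero, hvv, sub_self]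
    | xx x x' => rw [map_sub, map_mul, map_mul, semiLift_sVDual, semiLift_sVDual, map_zero, hxx,
        sub_self]
    | yx y x => rw [map_sub, map_mul, map_mul, semiLift_sVDual, semiLift_sV, semiLift_uToSemi, hvx]⟩

lemma hLift_hU (u : U n) : hLift ζ g gv gx h hv hx hvv hxx hvx (hU n ζ u) = uLift g h u := by
  rw [hLift, hU, AlgHom.comp_apply, RingQuot.liftAlgHom_mkAlgHom_apply]
  exact semiLift_uToSemi ..

lemma hLift_hV (y : V n) : hLift ζ g gv gx h hv hx hvv hxx hvx (hV n ζ y) = gv y := by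
  rw [hLift, hV, LinearMap.comp_apply, AlgHom.toLinearMap_apply,
    RingQuot.liftAlgHom_mkAlgHom_apply]
  exact semiLift_sV ..

lemma hLift_hX (x : VDual n) : hLift ζ g gv gx h hv hx hvv hxx hvx (hX n ζ x) = gx x := by
  rw [hLift, hX, LinearMap.comp_apply, AlgHom.toLinearMap_apply,
    RingQuot.liftAlgHom_mkAlgHom_apply]
  exact semiLift_sVDual ..

end

variable {ζ} in
lemma h_hom_ext {f f' : H n ζ →ₐ[ℂ] E}
    (h : ∀ A, f (hU n ζ (toU n A)) = f' (hU n ζ (toU n A)))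
    (hv : ∀ y, f (hV n ζ y) = f' (hV n ζ y)) (hx : ∀ x, f (hX n ζ x) = f' (hX n ζ x)) :
    f = f' := by
  refine RingQuot.ringQuot_ext' _ _ _ (semi_hom_ext (fun A => ?_) hv hx)
  have := h A
  rwa [hU, AlgHom.comp_apply, uToSemi_toU] at this

/-! ### The Verma module of `H_ζ(gl_n)` -/

/-- The space which carries a vector of `U(gl_n) ⋉ S(V_n^*)` together with its images under the
action of `V_n`. -/
abbrev VermaPair (n : ℕ) : Type := SymSemi n × (V n →ₗ[ℂ] SymSemi n)

/-- The action of `gl_n` on pairs `(b, f)`: by left multiplication, and by `A f(y) - f(A y)`. -/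
def vermaGl (n : ℕ) : Gl n →ₗ[ℂ] Module.End ℂ (VermaPair n) where
  toFun A :=
    { toFun := fun z => (bU n (toU n A) * z.1,
        LinearMap.mulLeft ℂ (bU n (toU n A)) ∘ₗ z.2 - z.2 ∘ₗ (A.mulVecLin : V n →ₗ[ℂ] V n))
      map_add' := fun z w => by
        refine Prod.ext (mul_add _ _ _) (LinearMap.ext fun y => ?_)
        simp [mul_add]; abel
      map_smul' := fun c z => by
        refine Prod.ext (mul_smul_comm _ _ _) (LinearMap.ext fun y => ?_)
        simp [smul_sub] }
  map_add' A B := LinearMap.ext fun z => by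
    refine Prod.ext ?_ (LinearMap.ext fun y => ?_)
    · simp [toU_add, add_mul]
    · simp [toU_add, add_mul]; abel
  map_smul' c A := LinearMap.ext fun z => by
    refine Prod.ext ?_ (LinearMap.ext fun y => ?_)
    · simp [toU_smul]
    · simp [toU_smul, smul_sub]

lemma vermaGl_fst (A : Gl n) (z : VermaPair n) : (vermaGl n A z).1 = bU n (toU n A) * z.1 := rfl

lemma vermaGl_snd (A : Gl n) (z : VermaPair n) (y : V n) :
    (vermaGl n A z).2 y = bU n (toU n A) * z.2 y - z.2 (A *ᵥ y) := rfl

/-- The action of `V_n^*` on pairs `(b, f)`, which records `[y, x] = ζ(y, x)` in the second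
entry. -/
def vermaX : VDual n →ₗ[ℂ] Module.End ℂ (VermaPair n) where
  toFun x :=
    { toFun := fun z => (bX n x * z.1, LinearMap.mulLeft ℂ (bX n x) ∘ₗ z.2 +
        LinearMap.mulRight ℂ z.1 ∘ₗ (bU n).toLinearMap ∘ₗ (pairingHom ζ).flip x)
      map_add' := fun z w => by
        refine Prod.ext (mul_add _ _ _) (LinearMap.ext fun y => ?_)
        simp [mul_add]; abel
      map_smul' := fun c z => by
        refine Prod.ext (mul_smul_comm _ _ _) (LinearMap.ext fun y => ?_)
        simp }
  map_add' A B := LinearMap.ext fun z => by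
    refine Prod.ext ?_ (LinearMap.ext fun y => ?_)
    · simp [add_mul]
    · simp [add_mul]; abel
  map_smul' c A := LinearMap.ext fun z => by
    refine Prod.ext ?_ (LinearMap.ext fun y => ?_)
    · simp
    · simp

lemma vermaX_fst (x : VDual n) (z : VermaPair n) : (vermaX ζ x z).1 = bX n x * z.1 := rfl

lemma vermaX_snd (x : VDual n) (z : VermaPair n) (y : V n) :
    (vermaX ζ x z).2 y = bX n x * z.2 y + bU n (pairing n ζ y x) * z.1 := rfl

lemma bU_toU_lie (A B : Gl n) :
    bU n (toU n A) * bU n (toU n B) - bU n (toU n B) * bU n (toU n A) =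
      bU n (toU n (A * B - B * A)) := by
  rw [← map_mul, ← map_mul, ← map_sub (bU n), toU_lie]

/-- The representation of `U(gl_n) ⋉ S(V_n^*)` on pairs. -/
def vermaHom : SymSemi n →ₐ[ℂ] Module.End ℂ (VermaPair n) :=
  symSemiLift (E := Module.End ℂ (VermaPair n)) (vermaGl n) (vermaX ζ)
    (fun A B => LinearMap.ext fun z => by
      refine Prod.ext ?_ (LinearMap.ext fun y => ?_)
      · simp only [LinearMap.sub_apply, Module.End.mul_apply, Prod.fst_sub, vermaGl_fst,
          ← bU_toU_lie, sub_mul, mul_assoc]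
      · have h := congrArg (· * z.2 y) (bU_toU_lie A B)
        have hz : z.2 ((A * B - B * A) *ᵥ y) = z.2 ((A * B) *ᵥ y) - z.2 ((B * A) *ᵥ y) := by
          rw [Matrix.sub_mulVec, map_sub]
        simp only [sub_mul, mul_assoc] at h
        simp only [LinearMap.sub_apply, Module.End.mul_apply, Prod.snd_sub, vermaGl_snd, mul_sub,
          Matrix.mulVec_mulVec, hz, ← h]
        abel)
    (fun A x => LinearMap.ext fun z => by
      refine Prod.ext ?_ (LinearMap.ext fun y => ?_)
      · simp only [LinearMap.sub_apply, Module.End.mul_apply, Prod.fst_sub, vermaGl_fst,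
          vermaX_fst, ← bU_bX, sub_mul, mul_assoc]
      -- The compatibility of `A` with `x` in the second entry is the `gl_n`-invariance of `ζ`.
      · have h := congrArg (bU n) (toU_pairing_commutator ζ A y x)
        rw [map_sub, map_sub, map_mul, map_mul] at h
        have h2 : bU n (pairing n ζ y (-(x ᵥ* A))) * z.1 + bU n (pairing n ζ y (x ᵥ* A)) * z.1 =
            0 := by
          rw [← add_mul, ← map_add, ← pairingHom_apply, ← pairingHom_apply, ← map_add,
            neg_add_cancel, map_zero, map_zero, zero_mul]
        have h3 := congrArg (· * z.1) h
        simp only [sub_mul, mul_assoc] at h3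
        simp only [LinearMap.sub_apply, Module.End.mul_apply, Prod.snd_sub, vermaGl_snd,
          vermaX_snd, vermaGl_fst, ← bU_bX, sub_mul, mul_sub, mul_add, mul_assoc,
          eq_neg_of_add_eq_zero_left h2]
        rw [← sub_eq_zero] at h3 ⊢
        rw [← h3]
        abel)
    (fun x x' => LinearMap.ext fun z => by
      refine Prod.ext ?_ (LinearMap.ext fun y => ?_)
      · simp only [Module.End.mul_apply, vermaX_fst, ← mul_assoc, bX_comm x]
      -- Commutation of `x` and `x'` in the second entry is the Jacobi identity for `x, x', y`.
      · have h := map_pairing_commutator_symm' ζ (bU n) (bX n) bU_bX y x x'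
        have h3 := congrArg (· * z.1) h
        simp only [sub_mul, mul_assoc] at h3
        simp only [Module.End.mul_apply, vermaX_snd, vermaX_fst, mul_add, ← mul_assoc, bX_comm x]
        simp only [mul_assoc]
        rw [← sub_eq_zero] at h3 ⊢
        rw [← neg_eq_zero, ← h3]
        abel)

lemma vermaHom_toU (A : Gl n) : vermaHom ζ (bU n (toU n A)) = vermaGl n A :=
  (symSemiLift_bU _ _ _ _ _ _).trans (uLift_toU _ _ _)

lemma vermaHom_bX (x : VDual n) : vermaHom ζ (bX n x) = vermaX ζ x :=
  symSemiLift_bX _ _ _ _ _ _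

lemma vermaHom_fst (b : SymSemi n) (z : VermaPair n) : (vermaHom ζ b z).1 = b * z.1 := by
  have key := mem_subalgebra_symSemi
    (S := { carrier := {b | ∀ z : VermaPair n, (vermaHom ζ b z).1 = b * z.1}
            mul_mem' := fun {a b} ha hb z => by
              rw [map_mul, Module.End.mul_apply, ha, hb, mul_assoc]
            add_mem' := fun {a b} ha hb z => by
              rw [map_add, LinearMap.add_apply, Prod.fst_add, ha, hb, add_mul]
            algebraMap_mem' := fun c z => by
              rw [AlgHom.commutes, Module.algebraMap_end_apply, Prod.smul_fst, Algebra.smul_def] })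
    (fun A z => by rw [vermaHom_toU, vermaGl_fst])
    (fun x z => by rw [vermaHom_bX, vermaX_fst]) b
  exact key z

/-- The action of `V_n` on the Verma module `U(gl_n) ⋉ S(V_n^*)`. -/
def vermaV : V n →ₗ[ℂ] Module.End ℂ (SymSemi n) :=
  -- The pair `(1, 0)` encodes that every `y` kills `1`. The operator thus moves `y` to the right
  -- through `b` until it reaches the vacuum vector; constructing it from an algebra map makes it
  -- well defined.
  LinearMap.mk₂ ℂ (fun y b => (vermaHom ζ b (1, 0)).2 y)
    (fun y y' b => map_add _ _ _) (fun c y b => map_smul _ _ _)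
    (fun y b b' => by rw [map_add]; rfl) (fun c y b => by rw [map_smul]; rfl)

lemma vermaV_apply (y : V n) (b : SymSemi n) : vermaV ζ y b = (vermaHom ζ b (1, 0)).2 y := rfl

lemma vermaV_one (y : V n) : vermaV ζ y 1 = 0 := by
  rw [vermaV_apply, map_one]; rfl

lemma vermaV_toU_mul (y : V n) (A : Gl n) (b : SymSemi n) :
    vermaV ζ y (bU n (toU n A) * b) = bU n (toU n A) * vermaV ζ y b - vermaV ζ (A *ᵥ y) b := by
  simp only [vermaV_apply, map_mul, Module.End.mul_apply, vermaHom_toU, vermaGl_snd]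

lemma vermaV_bX_mul (y : V n) (x : VDual n) (b : SymSemi n) :
    vermaV ζ y (bX n x * b) = bX n x * vermaV ζ y b + bU n (pairing n ζ y x) * b := by
  simp only [vermaV_apply, map_mul, Module.End.mul_apply, vermaHom_bX, vermaX_snd, vermaHom_fst,
    mul_one]

/-- Left multiplication by elements of `U(gl_n)` on the Verma module. -/
def vermaU (n : ℕ) : U n →ₐ[ℂ] Module.End ℂ (SymSemi n) :=
  (Algebra.lmul ℂ (SymSemi n)).comp (bU n)

lemma vermaU_apply (u : U n) (b : SymSemi n) : vermaU n u b = bU n u * b := rfl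

lemma vermaU_vermaV (A : Gl n) (y : V n) :
    vermaU n (toU n A) * vermaV ζ y - vermaV ζ y * vermaU n (toU n A) = vermaV ζ (A *ᵥ y) := by
  refine LinearMap.ext fun b => ?_
  rw [LinearMap.sub_apply, Module.End.mul_apply, Module.End.mul_apply, vermaU_apply, vermaU_apply,
    vermaV_toU_mul, sub_sub_cancel]

lemma vermaV_comm (y y' : V n) : vermaV ζ y * vermaV ζ y' = vermaV ζ y' * vermaV ζ y := by
  have key := fun b => mem_subalgebra_symSemi
    -- The condition is that left multiplication by `b` preserves the vectors on which all operators
    -- of `V` commute. This form is closed under products and can be checked on generators; the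
    -- vector `1` starts it off.
    (S := { carrier := {b | ∀ c : SymSemi n,
              (∀ y y', vermaV ζ y (vermaV ζ y' c) = vermaV ζ y' (vermaV ζ y c)) →
              ∀ y y', vermaV ζ y (vermaV ζ y' (b * c)) = vermaV ζ y' (vermaV ζ y (b * c))}
            mul_mem' := fun {a b} ha hb c hc => by
              simp only [mul_assoc]
              exact ha _ (hb _ hc)
            add_mem' := fun {a b} ha hb c hc y y' => by
              simp only [add_mul, map_add, ha c hc y y', hb c hc y y']
            algebraMap_mem' := fun k c hc y y' => by
              rw [← Algebra.smul_def]
              simp only [map_smul, hc y y'] })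
    (fun A c hc y y' => by
      simp only [vermaV_toU_mul, map_sub, hc y y', hc y (A *ᵥ y'), hc (A *ᵥ y) y']
      abel)
    (fun x c hc y y' => by
      have h := LinearMap.congr_fun
        (map_pairing_commutator_symm ζ (vermaU n) (vermaV ζ) (vermaU_vermaV ζ) x y y') c
      simp only [LinearMap.sub_apply, Module.End.mul_apply, vermaU_apply] at h
      simp only [vermaV_bX_mul, map_add, hc y y']
      rw [← sub_eq_zero] at h ⊢
      rw [← neg_eq_zero, ← h]
      abel) b
  refine LinearMap.ext fun b => ?_
  have := key b 1 (fun y y' => by rw [vermaV_one, vermaV_one, map_zero, map_zero]) y y'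
  rwa [mul_one] at this

/-- The representation of `H_ζ(gl_n)` on `U(gl_n) ⋉ S(V_n^*)`, with `y ∈ V_n` acting by a skew
derivation. -/
def vermaRep : H n ζ →ₐ[ℂ] Module.End ℂ (SymSemi n) :=
  hLift (E := Module.End ℂ (SymSemi n)) ζ ((vermaU n).toLinearMap ∘ₗ
      (UniversalEnvelopingAlgebra.ι ℂ : Gl n →ₗ⁅ℂ⁆ U n).toLinearMap)
    (vermaV ζ) ((Algebra.lmul ℂ (SymSemi n)).toLinearMap ∘ₗ bX n)
    (fun A B => by
      simp only [LinearMap.comp_apply, AlgHom.toLinearMap_apply, ← toU_eq_linear]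
      rw [← map_mul, ← map_mul, ← map_sub (vermaU n), toU_lie])
    (vermaU_vermaV ζ)
    (fun A x => by
      have h := congrArg (Algebra.lmul ℂ (SymSemi n)) (bU_bX A x)
      rw [map_sub, map_mul, map_mul] at h
      exact h)
    (vermaV_comm ζ)
    (fun x x' => LinearMap.ext fun b => by
      change bX n x * (bX n x' * b) = bX n x' * (bX n x * b)
      rw [← mul_assoc, bX_comm, mul_assoc])
    (fun y x => by
      rw [uLift_comp]
      refine LinearMap.ext fun b => ?_
      change vermaV ζ y (bX n x * b) - bX n x * vermaV ζ y b = bU n _ * b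
      rw [vermaV_bX_mul, add_sub_cancel_left])

/-- An element of `U(gl_n)` is recovered from its action on the vacuum vector `1` of the Verma
module. -/
lemma hU_injective : Function.Injective (hU n ζ) := by
  have h : (vermaRep ζ).comp (hU n ζ) = vermaU n :=
    u_hom_ext fun A => (hLift_hU _ _ _ _ _ _ _ _ _ _ _).trans (uLift_toU _ _ _)
  intro u u' huu
  refine bU_injective n ?_
  have h1 := LinearMap.congr_fun (congrArg (vermaRep ζ) huu) 1
  rw [← AlgHom.comp_apply, ← AlgHom.comp_apply, h, vermaU_apply, vermaU_apply, mul_one,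
    mul_one] at h1
  exact h1

lemma hX_injective : Function.Injective (hX n ζ) := by
  have h : ∀ x, vermaRep ζ (hX n ζ x) 1 = bX n x := fun x =>
    (LinearMap.congr_fun (hLift_hX _ _ _ _ _ _ _ _ _ _ _) _).trans (mul_one (bX n x))
  intro x x' hxx
  refine bX_injective n ?_
  rw [← h, hxx, h]

end

section

/-! ### The standard filtrations -/

variable {n : ℕ} {N : ℕ} {ζ ζ' ζ'' : ℕ →₀ ℂ}

lemma stdFiltration_eq_span (n N : ℕ) (ζ : ℕ →₀ ℂ) (k : ℕ) :
    stdFiltration n N ζ k = Submodule.span ℂ {u | ∃ w : List (Gl n ⊕ V n ⊕ VDual n),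
      (w.map (letterDeg n N)).sum ≤ k ∧ u = (w.map fun l => proj n ζ (letter n l)).prod} := by
  rw [stdFiltration, tensorFiltration, Submodule.map_span]
  congr 1
  ext u
  constructor
  · rintro ⟨_, ⟨w, hw, rfl⟩, rfl⟩
    refine ⟨w, hw, ?_⟩
    rw [AlgHom.toLinearMap_apply, map_list_prod, List.map_map]
    rfl
  · rintro ⟨w, hw, rfl⟩
    refine ⟨_, ⟨w, hw, rfl⟩, ?_⟩
    rw [AlgHom.toLinearMap_apply, map_list_prod, List.map_map]
    rfl

lemma word_mem_stdFiltration (ζ : ℕ →₀ ℂ) {k : ℕ} (w : List (Gl n ⊕ V n ⊕ VDual n))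
    (hw : (w.map (letterDeg n N)).sum ≤ k) :
    (w.map fun l => proj n ζ (letter n l)).prod ∈ stdFiltration n N ζ k := by
  rw [stdFiltration_eq_span]
  exact Submodule.subset_span ⟨w, hw, rfl⟩

lemma mul_mem_stdFiltration {j k : ℕ} {a b : H n ζ} (ha : a ∈ stdFiltration n N ζ j)
    (hb : b ∈ stdFiltration n N ζ k) : a * b ∈ stdFiltration n N ζ (j + k) := by
  rw [stdFiltration_eq_span] at ha hb
  induction ha, hb using Submodule.span_induction₂ with
  | mem_mem x y hx hy =>
    obtain ⟨w, hw, rfl⟩ := hx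
    obtain ⟨w', hw', rfl⟩ := hy
    rw [← List.prod_append, ← List.map_append]
    refine word_mem_stdFiltration ζ _ ?_
    rw [List.map_append, List.sum_append]
    exact Nat.add_le_add hw hw'
  | zero_left y hy => rw [zero_mul]; exact Submodule.zero_mem _
  | zero_right x hx => rw [mul_zero]; exact Submodule.zero_mem _
  | add_left x y z _ _ _ h1 h2 => rw [add_mul]; exact Submodule.add_mem _ h1 h2
  | add_right x y z _ _ _ h1 h2 => rw [mul_add]; exact Submodule.add_mem _ h1 h2
  | smul_left r x y _ _ h => rw [smul_mul_assoc]; exact Submodule.smul_mem _ _ h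
  | smul_right r x y _ _ h => rw [mul_smul_comm]; exact Submodule.smul_mem _ _ h

lemma stdFiltration_mono {j k : ℕ} (h : j ≤ k) :
    stdFiltration n N ζ j ≤ stdFiltration n N ζ k := by
  rw [stdFiltration_eq_span, stdFiltration_eq_span]
  exact Submodule.span_mono fun _ ⟨w, hw, hu⟩ => ⟨w, hw.trans h, hu⟩

lemma one_mem_stdFiltration (k : ℕ) : (1 : H n ζ) ∈ stdFiltration n N ζ k :=
  word_mem_stdFiltration (N := N) ζ [] (Nat.zero_le k)

lemma hU_mem_stdFiltration (A : Gl n) : hU n ζ (toU n A) ∈ stdFiltration n N ζ 2 := by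
  have := word_mem_stdFiltration (N := N) (k := 2) ζ [Sum.inl A] (by simp [letterDeg])
  rwa [List.map_singleton, List.prod_singleton, letter, proj_tGl] at this

lemma hV_mem_stdFiltration (y : V n) : hV n ζ y ∈ stdFiltration n N ζ N := by
  have := word_mem_stdFiltration (N := N) (k := N) ζ [Sum.inr (Sum.inl y)] (by simp [letterDeg])
  rwa [List.map_singleton, List.prod_singleton] at this

lemma hX_mem_stdFiltration (x : VDual n) : hX n ζ x ∈ stdFiltration n N ζ N := by
  have := word_mem_stdFiltration (N := N) (k := N) ζ [Sum.inr (Sum.inr x)] (by simp [letterDeg])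
  rwa [List.map_singleton, List.prod_singleton] at this

/-- An algebra map which respects the degrees of the generators respects the filtrations. -/
lemma map_stdFiltration_le (f : H n ζ →ₐ[ℂ] H n ζ')
    (hg : ∀ A, f (hU n ζ (toU n A)) ∈ stdFiltration n N ζ' 2)
    (hv : ∀ y, f (hV n ζ y) ∈ stdFiltration n N ζ' N)
    (hx : ∀ x, f (hX n ζ x) ∈ stdFiltration n N ζ' N) (k : ℕ) :
    (stdFiltration n N ζ k).map f.toLinearMap ≤ stdFiltration n N ζ' k := by
  have hl : ∀ l : Gl n ⊕ V n ⊕ VDual n,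
      f (proj n ζ (letter n l)) ∈ stdFiltration n N ζ' (letterDeg n N l) := by
    rintro (A | y | x)
    · rw [letter, proj_tGl]; exact hg A
    · exact hv y
    · exact hx x
  have hw : ∀ w : List (Gl n ⊕ V n ⊕ VDual n), f (w.map fun l => proj n ζ (letter n l)).prod ∈
      stdFiltration n N ζ' (w.map (letterDeg n N)).sum := by
    intro w
    induction w with
    | nil =>
      simp only [List.map_nil, List.prod_nil, map_one]
      exact one_mem_stdFiltration _
    | cons l w ih =>
      simp only [List.map_cons, List.prod_cons, map_mul, List.sum_cons]
      exact mul_mem_stdFiltration (hl l) ih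
  rw [stdFiltration_eq_span n N ζ, Submodule.map_span, Submodule.span_le]
  rintro _ ⟨_, ⟨w, hwk, rfl⟩, rfl⟩
  exact stdFiltration_mono hwk (hw w)

lemma map_stdFiltration_eq (e : H n ζ ≃ₐ[ℂ] H n ζ')
    (h : ∀ k, (stdFiltration n N ζ k).map (e : H n ζ →ₐ[ℂ] H n ζ').toLinearMap ≤
      stdFiltration n N ζ' k)
    (h' : ∀ k, (stdFiltration n N ζ' k).map (e.symm : H n ζ' →ₐ[ℂ] H n ζ).toLinearMap ≤
      stdFiltration n N ζ k) (k : ℕ) :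
    (stdFiltration n N ζ k).map e.toLinearMap = stdFiltration n N ζ' k := by
  refine le_antisymm (h k) fun b hb => ?_
  exact ⟨e.symm b, h' k ⟨b, hb, rfl⟩, e.apply_symm_apply b⟩

lemma FilteredIso.trans (h : FilteredIso n N ζ ζ') (h' : FilteredIso n N ζ' ζ'') :
    FilteredIso n N ζ ζ'' := by
  obtain ⟨e, he⟩ := h
  obtain ⟨e', he'⟩ := h'
  refine ⟨e.trans e', fun k => ?_⟩
  rw [← he', ← he, ← Submodule.map_comp]
  rfl

/-! ### The isomorphisms -/

lemma phi_neg_phi (lam : ℂ) (u : U n) : phi n (-lam) (phi n lam u) = u := by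
  have h : (phi n (-lam)).comp (phi n lam) = AlgHom.id ℂ _ := u_hom_ext fun A => by
    rw [AlgHom.comp_apply, phi_toU, map_add, phi_toU, AlgHom.commutes, AlgHom.id_apply, add_assoc,
      ← map_add, neg_mul, neg_add_cancel, map_zero, add_zero]
  exact DFunLike.congr_fun h u

lemma negTransposeU_negTransposeU (u : U n) : negTransposeU n (negTransposeU n u) = u := by
  have h : (negTransposeU n).comp (negTransposeU n) = AlgHom.id ℂ _ := u_hom_ext fun A => by
    rw [AlgHom.comp_apply, negTransposeU_toU, map_neg, negTransposeU_toU, neg_neg,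
      Matrix.transpose_transpose, AlgHom.id_apply]
  exact DFunLike.congr_fun h u

lemma smul_commutator {E : Type*} [Ring E] [Algebra ℂ E] (c : ℂ) (a b : E) :
    a * c • b - c • b * a = c • (a * b - b * a) := by
  rw [smul_sub, mul_smul_comm, smul_mul_assoc]

lemma smul_commutator' {E : Type*} [Ring E] [Algebra ℂ E] (c : ℂ) (a b : E) :
    c • a * b - b * c • a = c • (a * b - b * a) := by
  rw [smul_sub, mul_smul_comm, smul_mul_assoc]

lemma commutator_swap {E : Type*} [Ring E] (a b : E) : a * b - b * a = -(b * a - a * b) :=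
  (neg_sub _ _).symm

/-- The homomorphism `A ↦ A + λ tr A`, `y ↦ c y`, `x ↦ x`. -/
def shiftHom (lam c : ℂ)
    (h : ∀ y x, phi n lam (pairing n ζ y x) = c • pairing n ζ' y x) : H n ζ →ₐ[ℂ] H n ζ' :=
  hLift (E := H n ζ') ζ (((hU n ζ').comp (phi n lam)).toLinearMap ∘ₗ
      (UniversalEnvelopingAlgebra.ι ℂ : Gl n →ₗ⁅ℂ⁆ U n).toLinearMap)
    (c • hV n ζ') (hX n ζ')
    (fun A B => by
      change hU n ζ' (phi n lam (toU n A)) * hU n ζ' (phi n lam (toU n B)) -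
        hU n ζ' (phi n lam (toU n B)) * hU n ζ' (phi n lam (toU n A)) =
          hU n ζ' (phi n lam (toU n _))
      rw [← toU_lie]
      simp only [map_mul, map_sub])
    (fun A y => by
      change hU n ζ' (phi n lam (toU n A)) * c • hV n ζ' y -
        c • hV n ζ' y * hU n ζ' (phi n lam (toU n A)) = c • hV n ζ' (A *ᵥ y)
      refine Eq.trans ?_ ((smul_commutator c (hU n ζ' (toU n A)) (hV n ζ' y)).trans
        (congrArg (c • ·) (hU_hV ζ' A y)))
      rw [phi_toU, map_add, AlgHom.commutes, add_mul, mul_add, Algebra.commutes]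
      abel)
    (fun A x => by
      change hU n ζ' (phi n lam (toU n A)) * hX n ζ' x -
        hX n ζ' x * hU n ζ' (phi n lam (toU n A)) = hX n ζ' _
      rw [phi_toU, map_add, AlgHom.commutes, add_mul, mul_add, Algebra.commutes, ← hU_hX]
      abel)
    (fun y y' => by
      simp only [LinearMap.smul_apply, smul_mul_smul_comm, hV_comm ζ' y])
    (hX_comm ζ')
    (fun y x => by
      rw [uLift_comp, AlgHom.comp_apply, h, map_smul, ← hV_hX]
      exact smul_commutator' c (hV n ζ' y) (hX n ζ' x))

section

variable (lam c : ℂ) (h : ∀ y x, phi n lam (pairing n ζ y x) = c • pairing n ζ' y x)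

lemma shiftHom_toU (A : Gl n) : shiftHom lam c h (hU n ζ (toU n A)) =
    hU n ζ' (toU n A) + algebraMap ℂ _ (lam * Matrix.trace A) := by
  rw [shiftHom, hLift_hU, uLift_comp, AlgHom.comp_apply, phi_toU, map_add, AlgHom.commutes]

lemma shiftHom_hV (y : V n) : shiftHom lam c h (hV n ζ y) = c • hV n ζ' y := by
  rw [shiftHom, hLift_hV]; rfl

lemma shiftHom_hX (x : VDual n) : shiftHom lam c h (hX n ζ x) = hX n ζ' x := by
  rw [shiftHom, hLift_hX]

lemma map_shiftHom_le (N k : ℕ) :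
    (stdFiltration n N ζ k).map (shiftHom lam c h).toLinearMap ≤ stdFiltration n N ζ' k := by
  refine map_stdFiltration_le _ (fun A => ?_) (fun y => ?_) (fun x => ?_) k
  · rw [shiftHom_toU, Algebra.algebraMap_eq_smul_one]
    exact Submodule.add_mem _ (hU_mem_stdFiltration A)
      (Submodule.smul_mem _ _ (one_mem_stdFiltration _))
  · rw [shiftHom_hV]
    exact Submodule.smul_mem _ _ (hV_mem_stdFiltration y)
  · rw [shiftHom_hX]
    exact hX_mem_stdFiltration x

lemma shiftHom_comp_shiftHom (hc : c ≠ 0)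
    (h' : ∀ y x, phi n (-lam) (pairing n ζ' y x) = c⁻¹ • pairing n ζ y x) :
    (shiftHom (-lam) c⁻¹ h').comp (shiftHom lam c h) = AlgHom.id ℂ _ := by
  refine h_hom_ext (E := H n ζ) (fun A => ?_) (fun y => ?_) (fun x => ?_)
  · rw [AlgHom.comp_apply, shiftHom_toU, map_add, shiftHom_toU, AlgHom.commutes, add_assoc,
      ← map_add, neg_mul, neg_add_cancel, map_zero, add_zero, AlgHom.id_apply]
  · rw [AlgHom.comp_apply, shiftHom_hV, map_smul, shiftHom_hV, smul_smul, mul_inv_cancel₀ hc,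
      one_smul, AlgHom.id_apply]
  · rw [AlgHom.comp_apply, shiftHom_hX, shiftHom_hX, AlgHom.id_apply]

end

lemma filteredIso_of_phi (N : ℕ) (lam θ : ℂ) (hθ : θ ≠ 0)
    (h : ∀ y x, pairing n ζ' y x = θ • phi n lam (pairing n ζ y x)) : FilteredIso n N ζ ζ' := by
  have h1 : ∀ y x, phi n lam (pairing n ζ y x) = θ⁻¹ • pairing n ζ' y x := fun y x => by
    rw [h, smul_smul, inv_mul_cancel₀ hθ, one_smul]
  have h2 : ∀ y x, phi n (-lam) (pairing n ζ' y x) = θ⁻¹⁻¹ • pairing n ζ y x := fun y x => by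
    rw [h, map_smul, phi_neg_phi, inv_inv]
  -- The lemma on composites is applied a second time, to `-λ` and the inverse scalar, and produces
  -- the doubly negated and inverted parameters.
  have h3 : ∀ y x, phi n (- -lam) (pairing n ζ y x) = θ⁻¹⁻¹⁻¹ • pairing n ζ' y x := by
    rw [neg_neg, inv_inv]
    exact h1
  have hθ' : θ⁻¹ ≠ 0 := inv_ne_zero hθ
  let e : H n ζ ≃ₐ[ℂ] H n ζ' := AlgEquiv.ofAlgHom (shiftHom lam θ⁻¹ h1) (shiftHom (-lam) θ⁻¹⁻¹ h2)
    (by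
      have := shiftHom_comp_shiftHom _ _ h2 (inv_ne_zero hθ') h3
      simpa only [neg_neg, inv_inv] using this)
    (shiftHom_comp_shiftHom _ _ h1 hθ' h2)
  exact ⟨e, map_stdFiltration_eq e (map_shiftHom_le _ _ h1 N) (map_shiftHom_le _ _ h2 N)⟩

/-- The homomorphism `A ↦ - Aᵀ` which exchanges `V_n` and `V_n^*`. -/
def swapHom (h : ∀ y x, negTransposeU n (pairing n ζ y x) = -pairing n ζ' x y) :
    H n ζ →ₐ[ℂ] H n ζ' :=
  hLift (E := H n ζ') ζ (((hU n ζ').comp (negTransposeU n)).toLinearMap ∘ₗ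
      (UniversalEnvelopingAlgebra.ι ℂ : Gl n →ₗ⁅ℂ⁆ U n).toLinearMap)
    (hX n ζ') (hV n ζ')
    (fun A B => by
      change hU n ζ' (negTransposeU n (toU n A)) * hU n ζ' (negTransposeU n (toU n B)) -
        hU n ζ' (negTransposeU n (toU n B)) * hU n ζ' (negTransposeU n (toU n A)) =
          hU n ζ' (negTransposeU n (toU n _))
      rw [← toU_lie]
      simp only [map_mul, map_sub])
    (fun A y => by
      change hU n ζ' (negTransposeU n (toU n A)) * hX n ζ' y -
        hX n ζ' y * hU n ζ' (negTransposeU n (toU n A)) = hX n ζ' (A *ᵥ y)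
      rw [negTransposeU_toU, ← toU_neg, hU_hX, Matrix.vecMul_neg, neg_neg, Matrix.vecMul_transpose])
    (fun A x => by
      change hU n ζ' (negTransposeU n (toU n A)) * hV n ζ' x -
        hV n ζ' x * hU n ζ' (negTransposeU n (toU n A)) = hV n ζ' (-(x ᵥ* A))
      rw [negTransposeU_toU, ← toU_neg, hU_hV, Matrix.neg_mulVec, Matrix.mulVec_transpose])
    (hX_comm ζ') (hV_comm ζ')
    (fun y x => by
      rw [uLift_comp, AlgHom.comp_apply, h, map_neg, ← hV_hX]
      -- Exchanging `V` and `V^*` reverses the commutator; this is the source of the sign in `-ζ^-`.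
      exact commutator_swap (hX n ζ' y) (hV n ζ' x))

section

variable (h : ∀ y x, negTransposeU n (pairing n ζ y x) = -pairing n ζ' x y)

lemma swapHom_hU (u : U n) : swapHom h (hU n ζ u) = hU n ζ' (negTransposeU n u) := by
  rw [swapHom, hLift_hU, uLift_comp, AlgHom.comp_apply]

lemma swapHom_hV (y : V n) : swapHom h (hV n ζ y) = hX n ζ' y := by
  rw [swapHom, hLift_hV]

lemma swapHom_hX (x : VDual n) : swapHom h (hX n ζ x) = hV n ζ' x := by
  rw [swapHom, hLift_hX]

lemma map_swapHom_le (N k : ℕ) :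
    (stdFiltration n N ζ k).map (swapHom h).toLinearMap ≤ stdFiltration n N ζ' k := by
  refine map_stdFiltration_le _ (fun A => ?_) (fun y => ?_) (fun x => ?_) k
  · rw [swapHom_hU, negTransposeU_toU, ← toU_neg]
    exact hU_mem_stdFiltration _
  · rw [swapHom_hV]
    exact hX_mem_stdFiltration y
  · rw [swapHom_hX]
    exact hV_mem_stdFiltration x

lemma swapHom_comp_swapHom (h' : ∀ y x, negTransposeU n (pairing n ζ' y x) = -pairing n ζ x y) :
    (swapHom h').comp (swapHom h) = AlgHom.id ℂ _ := by
  refine h_hom_ext (E := H n ζ) (fun A => ?_) (fun y => ?_) (fun x => ?_)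
  · rw [AlgHom.comp_apply, swapHom_hU, swapHom_hU, negTransposeU_negTransposeU, AlgHom.id_apply]
  · rw [AlgHom.comp_apply, swapHom_hV, swapHom_hX, AlgHom.id_apply]
  · rw [AlgHom.comp_apply, swapHom_hX, swapHom_hV, AlgHom.id_apply]

end

lemma pairing_neg (ζ : ℕ →₀ ℂ) (y : V n) (x : VDual n) : pairing n (-ζ) y x = -pairing n ζ y x := by
  rw [pairing_eq_sum, pairing_eq_sum, Finsupp.support_neg, ← Finset.sum_neg_distrib]
  simp only [Finsupp.neg_apply, neg_smul]

/-- The deformation `- ζ^-`. -/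
def dualDeformation (ζ : ℕ →₀ ℂ) : ℕ →₀ ℂ := -signTwist (-1) ζ

lemma negTransposeU_pairing_dual (ζ : ℕ →₀ ℂ) (y : V n) (x : VDual n) :
    negTransposeU n (pairing n ζ y x) = -pairing n (dualDeformation ζ) x y := by
  rw [negTransposeU_pairing, dualDeformation, pairing_neg, neg_neg]

lemma negTransposeU_pairing_dual' (ζ : ℕ →₀ ℂ) (y : V n) (x : VDual n) :
    negTransposeU n (pairing n (dualDeformation ζ) y x) = -pairing n ζ x y := by
  have h := congrArg (negTransposeU n) (negTransposeU_pairing_dual ζ x y)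
  rw [negTransposeU_negTransposeU, map_neg] at h
  rw [h, neg_neg]

/-- The isomorphism of `H_ζ(gl_n)` with `H_{- ζ^-}(gl_n)` which exchanges `V_n` and `V_n^*`. -/
def swapEquiv (n : ℕ) (ζ : ℕ →₀ ℂ) : H n ζ ≃ₐ[ℂ] H n (dualDeformation ζ) :=
  AlgEquiv.ofAlgHom (swapHom (negTransposeU_pairing_dual ζ))
    (swapHom (negTransposeU_pairing_dual' ζ))
    (swapHom_comp_swapHom _ _) (swapHom_comp_swapHom _ _)

lemma map_swapEquiv (N : ℕ) (ζ : ℕ →₀ ℂ) (k : ℕ) :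
    (stdFiltration n N ζ k).map (swapEquiv n ζ).toLinearMap =
      stdFiltration n N (dualDeformation ζ) k :=
  map_stdFiltration_eq (swapEquiv n ζ) (map_swapHom_le (negTransposeU_pairing_dual ζ) N)
    (map_swapHom_le (negTransposeU_pairing_dual' ζ) N) k

lemma hV_injective (ζ : ℕ →₀ ℂ) : Function.Injective (hV n ζ) := by
  intro y y' h
  refine hX_injective (dualDeformation ζ) ?_
  rw [← swapHom_hV (negTransposeU_pairing_dual ζ), h, swapHom_hV]

lemma filteredIso_of_phi_signTwist (N : ℕ) (lam θ : ℂ) (s : ℤˣ) (hθ : θ ≠ 0)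
    (h : ∀ y x, pairing n ζ' y x = θ • phi n lam (pairing n (signTwist s ζ) y x)) :
    FilteredIso n N ζ ζ' := by
  rcases Int.units_eq_one_or s with rfl | rfl
  · rw [signTwist_one] at h
    exact filteredIso_of_phi N lam θ hθ h
  · refine FilteredIso.trans ⟨swapEquiv n ζ, map_swapEquiv N ζ⟩
      (filteredIso_of_phi N lam (-θ) (neg_ne_zero.mpr hθ) fun y x => ?_)
    rw [dualDeformation, pairing_neg, map_neg, smul_neg, neg_smul, neg_neg, h]

end

section

/-! ### The low terms of the standard filtrations -/

variable {n : ℕ} {N : ℕ} {ζ ζ' : ℕ →₀ ℂ}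

/-- As `N ≥ 3`, a word of degree at most 2 is empty or a single letter from `gl_n`. -/
lemma exists_of_mem_stdFiltration_two (hN : 3 ≤ N) {b : H n ζ} (hb : b ∈ stdFiltration n N ζ 2) :
    ∃ (A : Gl n) (c : ℂ), b = hU n ζ (toU n A) + algebraMap ℂ (H n ζ) c := by
  rw [stdFiltration_eq_span] at hb
  induction hb using Submodule.span_induction with
  | mem u hu =>
    obtain ⟨w, hw, rfl⟩ := hu
    rcases w with _ | ⟨l, w⟩
    · refine ⟨0, 1, ?_⟩
      rw [toU_eq_linear, map_zero, map_zero, zero_add, map_one]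
      rfl
    · rcases l with A | l
      · rcases w with _ | ⟨l', w⟩
        · refine ⟨A, 0, ?_⟩
          rw [map_zero, add_zero, List.map_singleton, List.prod_singleton, letter, proj_tGl]
        · rcases l' with A' | l' <;> simp only [List.map_cons, List.sum_cons, letterDeg] at hw <;>
            omega
      · simp only [List.map_cons, List.sum_cons, letterDeg] at hw
        omega
  | zero => exact ⟨0, 0, by rw [toU_eq_linear, map_zero, map_zero, map_zero, add_zero]⟩
  | add x y _ _ hx hy =>
    obtain ⟨A, c, rfl⟩ := hx
    obtain ⟨B, d, rfl⟩ := hy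
    exact ⟨A + B, c + d, by rw [toU_add, map_add, map_add, add_add_add_comm]⟩
  | smul t x _ hx =>
    obtain ⟨A, c, rfl⟩ := hx
    refine ⟨t • A, t * c, ?_⟩
    rw [toU_smul, map_smul, smul_add, map_mul, ← Algebra.smul_def]

lemma exists_of_word_degree_lt (w : List (Gl n ⊕ V n ⊕ VDual n))
    (hw : (w.map (letterDeg n N)).sum < N) :
    ∃ u, (w.map fun l => proj n ζ (letter n l)).prod = hU n ζ u := by
  induction w with
  | nil => exact ⟨1, by rw [map_one]; rfl⟩
  | cons l w ih =>
    rcases l with A | l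
    · simp only [List.map_cons, List.sum_cons, letterDeg] at hw
      obtain ⟨u, hu⟩ := ih (by omega)
      refine ⟨toU n A * u, ?_⟩
      rw [List.map_cons, List.prod_cons, hu, letter, proj_tGl, map_mul]
    · simp only [List.map_cons, List.sum_cons, letterDeg] at hw
      omega

/-- A letter from `V` or `V^*` uses up the whole degree `N`, so such a word is that letter alone;
every other word lies in the image of `U(gl_n)`. -/
lemma exists_of_mem_stdFiltration_top (hN : 3 ≤ N) {b : H n ζ}
    (hb : b ∈ stdFiltration n N ζ N) :
    ∃ (u : U n) (y : V n) (x : VDual n), b = hU n ζ u + hV n ζ y + hX n ζ x := by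
  rw [stdFiltration_eq_span] at hb
  induction hb using Submodule.span_induction with
  | mem u hu =>
    obtain ⟨w, hw, rfl⟩ := hu
    rcases w with _ | ⟨l, w⟩
    · refine ⟨1, 0, 0, ?_⟩
      rw [map_one, map_zero, map_zero, add_zero, add_zero]
      rfl
    · rcases l with A | l
      · simp only [List.map_cons, List.sum_cons, letterDeg] at hw
        obtain ⟨u, hu⟩ := exists_of_word_degree_lt (ζ := ζ) (N := N) w (by omega)
        refine ⟨toU n A * u, 0, 0, ?_⟩
        rw [List.map_cons, List.prod_cons, hu, letter, proj_tGl, map_mul, map_zero, map_zero,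
          add_zero, add_zero]
      · simp only [List.map_cons, List.sum_cons, letterDeg] at hw
        rcases w with _ | ⟨l', w⟩
        · rcases l with y | x
          · refine ⟨0, y, 0, ?_⟩
            rw [map_zero, map_zero, zero_add, add_zero, List.map_singleton, List.prod_singleton,
              letter, proj_tV]
          · refine ⟨0, 0, x, ?_⟩
            rw [map_zero, map_zero, zero_add, zero_add, List.map_singleton, List.prod_singleton,
              letter, proj_tVDual]
        · rcases l' with A' | l' <;> simp only [List.map_cons, List.sum_cons, letterDeg] at hw <;>
            omega
  | zero => exact ⟨0, 0, 0, by simp only [map_zero, add_zero]⟩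
  | add a b _ _ ha hb =>
    obtain ⟨u, y, x, rfl⟩ := ha
    obtain ⟨u', y', x', rfl⟩ := hb
    exact ⟨u + u', y + y', x + x', by simp only [map_add]; abel⟩
  | smul t a _ ha =>
    obtain ⟨u, y, x, rfl⟩ := ha
    exact ⟨t • u, t • y, t • x, by simp only [map_smul, smul_add]⟩

/-! ### The weights of the identity matrix -/

lemma toU_one_mul (u : U n) : toU n 1 * u = u * toU n 1 := by
  let S := Subalgebra.centralizer ℂ {toU n (1 : Gl n)}
  have hS : ∀ A, toU n A ∈ S := fun A => by
    rw [Subalgebra.mem_centralizer_iff]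
    rintro _ rfl
    have h := toU_lie 1 A
    rwa [one_mul, mul_one, sub_self, toU_eq_linear 0, map_zero, sub_eq_zero] at h
  let f : U n →ₐ[ℂ] S := uLift
    ((UniversalEnvelopingAlgebra.ι ℂ : Gl n →ₗ⁅ℂ⁆ U n).toLinearMap.codRestrict
      (Subalgebra.toSubmodule S) hS) fun A B => Subtype.ext (toU_lie A B)
  have hf : S.val.comp f = AlgHom.id ℂ _ := u_hom_ext fun A => by
    rw [AlgHom.comp_apply, uLift_toU]; rfl
  have hu := (f u).2
  rw [Subalgebra.mem_centralizer_iff] at hu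
  have hfu : (f u : U n) = u := DFunLike.congr_fun hf u
  rw [← hfu]
  exact hu _ rfl

lemma hU_toU_eq_zero {A : Gl n} (h : hU n ζ (toU n A) = 0) : A = 0 := by
  refine Matrix.ext_of_mulVec_single fun i => hV_injective ζ ?_
  rw [← hU_hV, h, zero_mul, mul_zero, Matrix.zero_mulVec, map_zero]
  exact sub_zero (0 : H n ζ)

instance : Nontrivial (U n) := by
  have f : U n →ₐ[ℂ] ℂ := uLift 0 (by simp)
  exact f.toRingHom.domain_nontrivial

instance : Nontrivial (H n ζ) := (hU_injective ζ).nontrivial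

/-- Separation of the eigenvectors of `D` for `0, 1, -1`: applying `D` once and twice gives enough
equations to isolate the three components. -/
lemma eigen_eq {M : Type*} [AddCommGroup M] [Module ℂ M] (ε c : ℂ) (hε : ε ≠ 0) {p q r : M}
    (D : M →ₗ[ℂ] M) (hp : D p = 0) (hq : D q = q) (hr : D r = -r)
    (h : ε • (p + q + r) = c • (q - r)) : p = 0 ∧ (ε - c) • q = 0 ∧ (ε + c) • r = 0 := by
  have h1 := congrArg D h
  simp only [map_smul, map_add, map_sub, hp, hq, hr] at h1
  have h2 := congrArg D h1
  simp only [map_smul, map_add, map_sub, map_neg, hq, hr, map_zero] at h2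
  have hp0 : ε • p = 0 := by
    have : ε • p = ε • (p + q + r) - ε • (0 + q + - -r) := by module
    rw [this, h, h2]; module
  refine ⟨(smul_eq_zero.mp hp0).resolve_left hε, ?_, ?_⟩
  · have : (ε - c) • q = (2⁻¹ : ℂ) • ((ε • (0 + q + -r) - c • (q - -r)) +
      (ε • (0 + q + - -r) - c • (q + -r))) := by module
    rw [this, h1, h2]; module
  · have : (ε + c) • r = (2⁻¹ : ℂ) • ((ε • (0 + q + - -r) - c • (q + -r)) -
      (ε • (0 + q + -r) - c • (q - -r))) := by module
    rw [this, h1, h2]; module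

end

section

/-! ### Filtered isomorphisms come from the parameters -/

variable {n : ℕ} {N : ℕ} {ζ ζ' : ℕ →₀ ℂ}

section

variable {E F : Type*} [Ring E] [Algebra ℂ E] [Ring F] [Algebra ℂ F]

lemma lie_add_algebraMap (a b : E) (c : ℂ) : ⁅a + algebraMap ℂ E c, b⁆ = ⁅a, b⁆ := by
  rw [LieRing.of_associative_ring_bracket, add_mul, mul_add, Algebra.commutes,
    add_sub_add_right_eq_sub, LieRing.of_associative_ring_bracket]

lemma lie_add_algebraMap' (a b : E) (c d : ℂ) :
    ⁅a + algebraMap ℂ E c, b + algebraMap ℂ E d⁆ = ⁅a, b⁆ := by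
  rw [lie_add_algebraMap, ← lie_skew, lie_add_algebraMap, lie_skew]

lemma algEquiv_lie (e : E ≃ₐ[ℂ] F) (a b : E) : e ⁅a, b⁆ = ⁅e a, e b⁆ := by
  simp only [LieRing.of_associative_ring_bracket, map_sub, map_mul]

lemma algHom_lie (f : E →ₐ[ℂ] F) (a b : E) : f ⁅a, b⁆ = ⁅f a, f b⁆ := by
  simp only [LieRing.of_associative_ring_bracket, map_sub, map_mul]

end

lemma lie_toU (A B : Gl n) : ⁅toU n A, toU n B⁆ = toU n (A * B - B * A) := toU_lie A B

lemma hU_lie (u v : U n) : hU n ζ ⁅u, v⁆ = ⁅hU n ζ u, hU n ζ v⁆ := by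
  have h := algHom_lie (E := U n) (F := H n ζ) (hU n ζ) u v
  exact h

lemma equiv_lie (e : H n ζ ≃ₐ[ℂ] H n ζ') (a b : H n ζ) : e ⁅a, b⁆ = ⁅e a, e b⁆ := by
  have h := algEquiv_lie (E := H n ζ) (F := H n ζ') e a b
  exact h

lemma lie_hU_hV (A : Gl n) (y : V n) : ⁅hU n ζ (toU n A), hV n ζ y⁆ = hV n ζ (A *ᵥ y) :=
  hU_hV ζ A y

lemma lie_hU_hX (A : Gl n) (x : VDual n) : ⁅hU n ζ (toU n A), hX n ζ x⁆ = hX n ζ (-(x ᵥ* A)) :=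
  hU_hX ζ A x

lemma lie_hV_hX (y : V n) (x : VDual n) : ⁅hV n ζ y, hX n ζ x⁆ = hU n ζ (pairing n ζ y x) :=
  hV_hX ζ y x

lemma lie_toU_one (u : U n) : ⁅toU n 1, u⁆ = 0 := sub_eq_zero.mpr (toU_one_mul u)

lemma weight_eq {E : Type*} [Ring E] [Algebra ℂ E] {a p q r : E} {ε c χ : ℂ} (hε : ε ≠ 0)
    (hp : ⁅a, p⁆ = 0) (hq : ⁅a, q⁆ = q) (hr : ⁅a, r⁆ = -r)
    (h : ⁅c • a + algebraMap ℂ E χ, p + q + r⁆ = ε • (p + q + r)) : p = 0 ∧ (ε - c) • q = 0 ∧ (ε + c) • r = 0 := by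
  refine eigen_eq ε c hε (LinearMap.mulLeft ℂ a - LinearMap.mulRight ℂ a) hp hq hr ?_
  rw [← h, lie_add_algebraMap, smul_lie, lie_add, lie_add, hp, hq, hr, zero_add, sub_eq_add_neg]

lemma exists_linear_factor {M M' W : Type*} [AddCommGroup M] [Module ℂ M] [AddCommGroup M']
    [Module ℂ M'] [AddCommGroup W] [Module ℂ W] (f : M →ₗ[ℂ] W) (g : M' →ₗ[ℂ] W)
    (hg : Function.Injective g) (h : ∀ x, ∃ y, f x = g y) : ∃ P : M →ₗ[ℂ] M', ∀ x, f x = g (P x) := by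
  refine ⟨(LinearEquiv.ofInjective g hg).symm.toLinearMap ∘ₗ
    f.codRestrict (LinearMap.range g) fun x => ?_, fun x => ?_⟩
  · obtain ⟨y, hy⟩ := h x
    exact ⟨y, hy.symm⟩
  · have := LinearEquiv.ofInjective_symm_apply (f := g) (h := hg)
      (f.codRestrict (LinearMap.range g) (fun x => (h x).imp fun _ hy => hy.symm) x)
    exact this.symm

/-- `E_{ij} = E_{i i₀} E_{i₀ j}`; reversing the factors under `t` gives zero off the diagonal and
`E_{i₀ i₀}` on it. -/
lemma eq_mul_trace (hn : 1 ≤ n) (t : Gl n →ₗ[ℂ] ℂ) (ht : ∀ A B, t (A * B - B * A) = 0) :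
    ∃ lam : ℂ, ∀ A, t A = lam * Matrix.trace A := by
  have ht' : ∀ A B, t (A * B) = t (B * A) := fun A B => by
    rw [← sub_eq_zero, ← map_sub, ht]
  let i₀ : Fin n := ⟨0, hn⟩
  have h : ∀ i j c, t (Matrix.single i j c) =
      t (Matrix.single i₀ i₀ 1) * Matrix.trace (Matrix.single i j c) := fun i j c => by
    have h1 : Matrix.single i j c = Matrix.single i i₀ c * Matrix.single i₀ j (1 : ℂ) := by
      rw [Matrix.single_mul_single_same, mul_one]
    rw [h1, ht', Matrix.trace_mul_comm]
    rcases eq_or_ne j i with rfl | hij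
    · rw [Matrix.single_mul_single_same, one_mul, Matrix.trace_single_eq_same, mul_comm,
        ← smul_eq_mul, ← map_smul, Matrix.smul_single, smul_eq_mul, mul_one]
    · rw [Matrix.single_mul_single_of_ne _ _ _ _ hij, map_zero, Matrix.trace_zero, mul_zero]
  refine ⟨t (Matrix.single i₀ i₀ 1), fun A => ?_⟩
  induction A using Matrix.induction_on' with
  | h_zero => rw [map_zero, Matrix.trace_zero, mul_zero]
  | h_add A B hA hB => rw [map_add, Matrix.trace_add, mul_add, hA, hB]
  | h_std_basis i j c => exact h i j c

/-- Schur's lemma: the matrix of `S` commutes with all matrix units, hence is scalar. -/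
lemma exists_eq_smul_of_commute (S : VDual n →ₗ[ℂ] VDual n)
    (hS : ∀ (A : Gl n) x, S (x ᵥ* A) = S x ᵥ* A) : ∃ q : ℂ, ∀ x, S x = q • x := by
  have hK : ∀ x, S x = x ᵥ* (LinearMap.toMatrix' S)ᵀ := fun x => by
    rw [Matrix.vecMul_transpose, LinearMap.toMatrix'_mulVec]
  obtain ⟨q, hq⟩ : (LinearMap.toMatrix' S)ᵀ ∈ Set.range (Matrix.scalar (Fin n)) := by
    refine Matrix.mem_range_scalar_iff_commute_single'.mpr fun i j => ?_
    refine Matrix.ext_of_single_vecMul fun k => ?_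
    rw [← Matrix.vecMul_vecMul, ← Matrix.vecMul_vecMul, ← hK, ← hK, hS]
  refine ⟨q, fun x => ?_⟩
  rw [hK, ← hq, Matrix.scalar_apply, ← Matrix.smul_one_eq_diagonal, Matrix.vecMul_smul,
    Matrix.vecMul_one]

/-- The map `(A, c) ↦ A + c`. -/
def affineMap (n : ℕ) (ζ : ℕ →₀ ℂ) : Gl n × ℂ →ₗ[ℂ] H n ζ :=
  ((hU n ζ).toLinearMap ∘ₗ (UniversalEnvelopingAlgebra.ι ℂ : Gl n →ₗ⁅ℂ⁆ U n).toLinearMap).coprod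
    (Algebra.linearMap ℂ (H n ζ))

lemma affineMap_apply (p : Gl n × ℂ) :
    affineMap n ζ p = hU n ζ (toU n p.1) + algebraMap ℂ (H n ζ) p.2 := rfl

/-- Scalars have zero commutators, so if `A + c = 0` then `A` acts by zero on the embedded copy of
`V`. -/
lemma affineMap_injective : Function.Injective (affineMap n ζ) := by
  rw [injective_iff_map_eq_zero]
  rintro ⟨A, c⟩ h
  rw [affineMap_apply] at h
  have hA : A = 0 := Matrix.ext_of_mulVec_single fun i => hV_injective ζ (by
    rw [← lie_hU_hV, ← lie_add_algebraMap _ _ c, h, Matrix.zero_mulVec, map_zero]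
    exact zero_lie (L := H n ζ) (M := H n ζ) _)
  subst hA
  dsimp only at h
  rw [toU_eq_linear, map_zero, map_zero, zero_add] at h
  rw [(map_eq_zero_iff _ (algebraMap ℂ (H n ζ)).injective).mp h]
  rfl

lemma mem_of_map_eq {e : H n ζ ≃ₐ[ℂ] H n ζ'} {k : ℕ}
    (he : (stdFiltration n N ζ k).map e.toLinearMap = stdFiltration n N ζ' k) {a : H n ζ}
    (ha : a ∈ stdFiltration n N ζ k) : e a ∈ stdFiltration n N ζ' k := by
  rw [← he]
  exact ⟨a, ha, rfl⟩

section

variable (e : H n ζ ≃ₐ[ℂ] H n ζ')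
  (he : ∀ k, (stdFiltration n N ζ k).map e.toLinearMap = stdFiltration n N ζ' k) (hN : 3 ≤ N)

include he hN

/-- The identity matrix is central in `gl_n + ℂ`, which is mapped onto its counterpart. Its image
therefore has a matrix part commuting with all of `gl_n`, that is, a scalar matrix. -/
lemma exists_image_one : ∃ c χ : ℂ,
    e (hU n ζ (toU n 1)) = c • hU n ζ' (toU n 1) + algebraMap ℂ (H n ζ') χ := by
  obtain ⟨Z, χ, hZ⟩ := exists_of_mem_stdFiltration_two hN
    (mem_of_map_eq (he 2) (hU_mem_stdFiltration (1 : Gl n)))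
  have hcomm : ∀ B, Z * B - B * Z = 0 := fun B => by
    refine hU_toU_eq_zero (ζ := ζ') ?_
    have hB := hU_mem_stdFiltration (N := N) (ζ := ζ') B
    rw [← he 2] at hB
    obtain ⟨b, hb, hbB⟩ := hB
    obtain ⟨A, d, rfl⟩ := exists_of_mem_stdFiltration_two hN hb
    replace hbB : e _ = _ := hbB
    rw [← lie_toU, hU_lie, ← lie_add_algebraMap _ _ χ, ← hZ, ← hbB, ← equiv_lie,
      ← add_zero (hU n ζ (toU n 1)), ← map_zero (algebraMap ℂ (H n ζ)),
      lie_add_algebraMap' (E := H n ζ),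
      ← hU_lie, lie_toU_one, map_zero, map_zero]
  obtain ⟨c, rfl⟩ : Z ∈ Set.range (Matrix.scalar (Fin n)) :=
    Matrix.mem_range_scalar_iff_commute_single'.mpr fun i j => (sub_eq_zero.mp (hcomm _)).symm
  refine ⟨c, χ, ?_⟩
  rw [hZ, Matrix.scalar_apply, ← Matrix.smul_one_eq_diagonal, toU_smul, map_smul]

/-- A filtered isomorphism sends a weight vector for the identity matrix to the sum of a vector of
`V_n` and a vector of `V_n^*`. -/
lemma exists_image_weight {ε c χ : ℂ} (hε : ε ≠ 0)
    (h1 : e (hU n ζ (toU n 1)) = c • hU n ζ' (toU n 1) + algebraMap ℂ (H n ζ') χ) {a : H n ζ}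
    (ha : a ∈ stdFiltration n N ζ N)
    (hw : ⁅hU n ζ (toU n 1), a⁆ = ε • a) :
    ∃ (y : V n) (x : VDual n), e a = hV n ζ' y + hX n ζ' x ∧ (ε - c) • y = 0 ∧ (ε + c) • x = 0 := by
  obtain ⟨u, y, x, h⟩ := exists_of_mem_stdFiltration_top hN (mem_of_map_eq (he N) ha)
  have hw' := congrArg e hw
  rw [equiv_lie, map_smul, h1, h] at hw'
  obtain ⟨hp, hq, hr⟩ := weight_eq (E := H n ζ') hε
    (by rw [← hU_lie, lie_toU_one, map_zero])
    (by rw [lie_hU_hV, Matrix.one_mulVec]) (by rw [lie_hU_hX, Matrix.vecMul_one, map_neg]) hw'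
  refine ⟨y, x, by rw [h, hp, zero_add], hV_injective ζ' ?_, hX_injective ζ' ?_⟩
  · rw [map_smul, hq, map_zero]
  · rw [map_smul, hr, map_zero]

lemma exists_phi_of_weight_one (hn : 1 ≤ n) {χ : ℂ}
    (h1 : e (hU n ζ (toU n 1)) = (1 : ℂ) • hU n ζ' (toU n 1) + algebraMap ℂ (H n ζ') χ) :
    ∃ lam θ : ℂ, θ ≠ 0 ∧ ∀ y x, pairing n ζ' y x = θ • phi n lam (pairing n ζ y x) := by
  obtain ⟨P, hP⟩ := exists_linear_factor (W := H n ζ') (e.toLinearMap ∘ₗ hV n ζ) (hV n ζ')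
    (hV_injective ζ') (by
      intro y
      obtain ⟨y', x', h, -, hx⟩ := exists_image_weight e he hN one_ne_zero h1
        (hV_mem_stdFiltration y) (by rw [lie_hU_hV, Matrix.one_mulVec, one_smul])
      refine ⟨y', (?_ : e (hV n ζ y) = hV n ζ' y')⟩
      rw [(smul_eq_zero.mp hx).resolve_left (by norm_num), map_zero, add_zero] at h
      exact h)
  obtain ⟨Q, hQ⟩ := exists_linear_factor (W := H n ζ') (e.toLinearMap ∘ₗ hX n ζ) (hX n ζ')
    (hX_injective ζ') (by
      intro x
      obtain ⟨y', x', h, hy, -⟩ := exists_image_weight e he hN (neg_ne_zero.mpr one_ne_zero) h1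
        (hX_mem_stdFiltration x)
        (by rw [lie_hU_hX, Matrix.vecMul_one, ← neg_one_smul ℂ x, map_smul])
      refine ⟨x', (?_ : e (hX n ζ x) = hX n ζ' x')⟩
      rw [(smul_eq_zero.mp hy).resolve_left (by norm_num), map_zero, zero_add] at h
      exact h)
  obtain ⟨T, hT⟩ := exists_linear_factor (W := H n ζ') (e.toLinearMap ∘ₗ (hU n ζ).toLinearMap ∘ₗ
      (UniversalEnvelopingAlgebra.ι ℂ : Gl n →ₗ⁅ℂ⁆ U n).toLinearMap) (affineMap n ζ')
      affineMap_injective fun A => by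
    obtain ⟨B, c, h⟩ := exists_of_mem_stdFiltration_two hN
      (mem_of_map_eq (he 2) (hU_mem_stdFiltration A))
    exact ⟨(B, c), h⟩
  replace hP : ∀ y, e (hV n ζ y) = hV n ζ' (P y) := hP
  replace hQ : ∀ x, e (hX n ζ x) = hX n ζ' (Q x) := hQ
  replace hT : ∀ A, e (hU n ζ (toU n A)) =
    hU n ζ' (toU n (T A).1) + algebraMap ℂ (H n ζ') (T A).2 := hT
  have hPinj : Function.Injective P := fun y y' h => hV_injective ζ (e.injective (by
    rw [hP, hP, h]))
  have hQinj : Function.Injective Q := fun x x' h => hX_injective ζ (e.injective (by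
    rw [hQ, hQ, h]))
  obtain ⟨M, hM⟩ : ∃ M : Gl n, ∀ y, P y = M *ᵥ y :=
    ⟨LinearMap.toMatrix' P, fun y => (LinearMap.toMatrix'_mulVec P y).symm⟩
  have hMdet : IsUnit M.det := (Matrix.isUnit_iff_isUnit_det M).mp
    (Matrix.mulVec_injective_iff_isUnit.mp fun y y' h => hPinj (by rw [hM, hM]; exact h))
  have hM1 := Matrix.mul_nonsing_inv M hMdet
  have hM2 := Matrix.nonsing_inv_mul M hMdet
  -- Apply `e` to `[A, y] = A y`. The scalar part of `e(A)` does not affect commutators.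
  have hT1 : ∀ A, (T A).1 = M * A * M⁻¹ := fun A => by
    have h : (T A).1 * M = M * A := Matrix.ext_of_mulVec_single fun i => hV_injective ζ' (by
      rw [← Matrix.mulVec_mulVec, ← hM, ← lie_hU_hV, ← lie_add_algebraMap _ _ (T A).2, ← hT,
        ← hP, ← equiv_lie, lie_hU_hV, hP, hM, Matrix.mulVec_mulVec])
    rw [← h, mul_assoc, hM1, mul_one]
  -- The scalar part of `e` vanishes on commutators, since the bracket of two elements of `gl_n + ℂ`
  -- has no scalar term.
  obtain ⟨lam, hlam⟩ := eq_mul_trace hn (LinearMap.snd ℂ (Gl n) ℂ ∘ₗ T) fun A B => by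
    have h := hT (A * B - B * A)
    rw [← lie_toU, hU_lie, equiv_lie, hT, hT, lie_add_algebraMap' (E := H n ζ'), ← hU_lie,
      lie_toU] at h
    have h2 := affineMap_injective (a₁ := ((T A).1 * (T B).1 - (T B).1 * (T A).1, 0))
      (a₂ := T (A * B - B * A)) (by
        rw [affineMap_apply, affineMap_apply, map_zero, add_zero, h])
    exact (congrArg Prod.snd h2).symm
  have hcomp : ((e : H n ζ →ₐ[ℂ] H n ζ').comp (hU n ζ)) =
      ((hU n ζ').comp (phi n lam)).comp (conjU M M⁻¹ hM2) := by
    refine u_hom_ext (E := H n ζ') fun A => ?_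
    have htr : Matrix.trace (M * A * M⁻¹) = Matrix.trace A := by
      rw [Matrix.trace_mul_comm, ← mul_assoc, hM2, one_mul]
    have h : hU n ζ' (phi n lam (conjU M M⁻¹ hM2 (toU n A))) =
        hU n ζ' (toU n (T A).1) + algebraMap ℂ (H n ζ') (T A).2 := by
      have hA : (T A).2 = lam * Matrix.trace A := hlam A
      rw [conjU_toU, phi_toU, htr, hA, map_add, AlgHom.commutes, ← hT1]
    exact (hT A).trans h.symm
  -- Applying `e` to `[A, x]` shows that `Q` intertwines the action of `A` with that of `M A M⁻¹`.
  -- Composing with `M` gives an endomorphism of `V^*`, to which Schur's lemma applies.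
  obtain ⟨q, hq⟩ := exists_eq_smul_of_commute (M.vecMulLinear ∘ₗ Q) fun A x => by
    have h : Q (x ᵥ* A) = Q x ᵥ* (M * A * M⁻¹) := neg_injective (hX_injective ζ' (by
      rw [← map_neg, ← hQ, ← hT1, ← lie_hU_hX, ← lie_hU_hX,
        ← lie_add_algebraMap (hU n ζ' _) _ (T A).2, ← hT, ← hQ, ← equiv_lie]))
    change Q (x ᵥ* A) ᵥ* M = Q x ᵥ* M ᵥ* A
    rw [h, Matrix.vecMul_vecMul, Matrix.vecMul_vecMul, mul_assoc, hM2, mul_one]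
  have hQ' : ∀ x, Q x = q • (x ᵥ* M⁻¹) := fun x => by
    have h : Q x ᵥ* M = q • x := hq x
    rw [← Matrix.smul_vecMul, ← h, Matrix.vecMul_vecMul, hM1, Matrix.vecMul_one]
  have hq0 : q ≠ 0 := by
    rintro rfl
    have h : (Pi.single ⟨0, hn⟩ 1 : VDual n) = 0 := hQinj (by rw [hQ', zero_smul, map_zero])
    simpa using congrFun h ⟨0, hn⟩
  -- Apply `e` to `[y, x] = ζ(y, x)`. The invariance of `ζ` turns the conjugation by `M` into the
  -- arguments `M y` and `x M⁻¹`.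
  have key : ∀ y x, phi n lam (pairing n ζ (M *ᵥ y) (x ᵥ* M⁻¹)) =
      q • pairing n ζ' (M *ᵥ y) (x ᵥ* M⁻¹) := fun y x => hU_injective ζ' (by
    have h := DFunLike.congr_fun hcomp (pairing n ζ y x)
    rw [AlgHom.comp_apply, AlgHom.comp_apply, AlgHom.comp_apply, conjU_pairing] at h
    rw [← h, map_smul, ← lie_hV_hX (ζ := ζ')]
    refine Eq.trans ?_ (lie_smul (L := H n ζ') (M := H n ζ') q _ _)
    rw [← map_smul, ← hM, ← hQ', ← hP, ← hQ, ← equiv_lie, lie_hV_hX]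
    rfl)
  refine ⟨lam, q⁻¹, inv_ne_zero hq0, fun y x => ?_⟩
  have h := key (M⁻¹ *ᵥ y) (x ᵥ* M)
  rw [Matrix.mulVec_mulVec, Matrix.vecMul_vecMul, hM1, Matrix.one_mulVec, Matrix.vecMul_one] at h
  rw [h, smul_smul, inv_mul_cancel₀ hq0, one_smul]

end

end

/-! ### The case of weight `-1` and the classification of filtered isomorphisms. -/

section

variable {n : ℕ} {N : ℕ} {ζ ζ' : ℕ →₀ ℂ}

/-- The exchange of `V` and `V^*` sends the identity matrix to its negative, so precomposing `e`
with it gives weight `1`, now starting from `-ζ^-`. -/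
lemma exists_phi_of_weight_neg_one (hn : 1 ≤ n) (hN : 3 ≤ N) (e : H n ζ ≃ₐ[ℂ] H n ζ')
    (he : ∀ k, (stdFiltration n N ζ k).map e.toLinearMap = stdFiltration n N ζ' k) {χ : ℂ}
    (h1 : e (hU n ζ (toU n 1)) = (-1 : ℂ) • hU n ζ' (toU n 1) + algebraMap ℂ (H n ζ') χ) :
    ∃ lam θ : ℂ, θ ≠ 0 ∧
      ∀ y x, pairing n ζ' y x = θ • phi n lam (pairing n (signTwist (-1) ζ) y x) := by
  obtain ⟨lam, θ, hθ, h⟩ := exists_phi_of_weight_one ((swapEquiv n ζ).symm.trans e)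
    (fun k => by
      rw [← he, ← map_swapEquiv, ← Submodule.map_comp]
      congr 1
      refine LinearMap.ext fun a => ?_
      change e ((swapEquiv n ζ).symm (swapEquiv n ζ a)) = e a
      rw [AlgEquiv.symm_apply_apply]) hN hn (χ := -χ) (by
    change e (swapHom (negTransposeU_pairing_dual' ζ) (hU n (dualDeformation ζ) (toU n 1))) = _
    rw [swapHom_hU, negTransposeU_toU, Matrix.transpose_one, ← toU_neg, ← neg_one_smul ℂ (1 : Gl n),
      toU_smul, map_smul, map_smul, h1, smul_add, smul_smul, neg_one_mul, neg_neg,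
      Algebra.algebraMap_eq_smul_one, Algebra.algebraMap_eq_smul_one, smul_smul, neg_one_mul])
  refine ⟨lam, -θ, neg_ne_zero.mpr hθ, fun y x => ?_⟩
  rw [h, dualDeformation, pairing_neg, map_neg, smul_neg, neg_smul]

lemma FilteredIso.exists_phi (hn : 1 ≤ n) (hN : 3 ≤ N) (h : FilteredIso n N ζ ζ') :
    ∃ (lam θ : ℂ) (s : ℤˣ), θ ≠ 0 ∧
      ∀ y x, pairing n ζ' y x = θ • phi n lam (pairing n (signTwist s ζ) y x) := by
  obtain ⟨e, he⟩ := h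
  obtain ⟨c, χ, h1⟩ := exists_image_one e he hN
  have hy₀ : (Pi.single ⟨0, hn⟩ 1 : V n) ≠ 0 := fun h => by
    simpa using congrFun h ⟨0, hn⟩
  obtain ⟨y, x, h, hy, hx⟩ := exists_image_weight e he hN one_ne_zero h1
    (hV_mem_stdFiltration (Pi.single ⟨0, hn⟩ 1)) (by rw [lie_hU_hV, Matrix.one_mulVec, one_smul])
  -- The image of a nonzero vector of `V` has a nonzero component in `V` or in `V^*`, which forces
  -- `c = 1` or `c = -1`.
  rcases smul_eq_zero.mp hy with hc | rfl
  · obtain rfl : c = 1 := (sub_eq_zero.mp hc).symm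
    obtain ⟨lam, θ, hθ, H⟩ := exists_phi_of_weight_one e he hN hn h1
    exact ⟨lam, θ, 1, hθ, by rwa [signTwist_one]⟩
  · rcases smul_eq_zero.mp hx with hc | rfl
    · obtain rfl : c = -1 := (neg_eq_of_add_eq_zero_right hc).symm
      obtain ⟨lam, θ, hθ, H⟩ := exists_phi_of_weight_neg_one hn hN e he h1
      exact ⟨lam, θ, -1, hθ, H⟩
    · rw [map_zero, map_zero, add_zero] at h
      exact absurd (hV_injective ζ (((map_eq_zero_iff e e.injective).mp h).trans
        (map_zero (hV n ζ)).symm)) hy₀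

/-! ### Normalized parameters -/

lemma length_eq {m : ℕ} (h : ∀ j, m + 1 ≤ j → ζ j = 0) (hm : ζ m ≠ 0) : length ζ = m := by
  refine (length_isLeast ζ).unique ⟨⟨by omega, fun j hj => h j (by omega)⟩, fun k hk => ?_⟩
  by_contra hkm
  exact hm (hk.2 m (by omega))

lemma apply_eq_zero_of_length_lt {m : ℕ} (h : length ζ = m) (j : ℕ) (hj : m + 1 ≤ j) : ζ j = 0 :=
  (length_isLeast ζ).1.2 j (by omega)

lemma apply_length_ne_zero {m : ℕ} (h : length ζ = m) : ζ m ≠ 0 := by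
  intro h0
  have h2 : length ζ ≤ (m : ℤ) - 1 := (length_isLeast ζ).2 ⟨by omega, fun j hj => by
    rcases eq_or_ne j m with rfl | hjm
    · exact h0
    · exact apply_eq_zero_of_length_lt h j (by omega)⟩
  omega

/-- The coefficients of `θ φ_λ(ζ)`, for `ζ` which vanishes above `m`. -/
def shiftDeformation (n m : ℕ) (lam θ : ℂ) (ζ : ℕ →₀ ℂ) : ℕ →₀ ℂ :=
  Finsupp.onFinset (Finset.range (m + 1))
    (fun i => θ * ∑ j ∈ Finset.Ico i (m + 1), ζ j * (shiftCoeff n j i * lam ^ (j - i)))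
    fun i hi => by
      by_contra hi'
      rw [Finset.Ico_eq_empty (by rw [Finset.mem_range] at hi'; omega), Finset.sum_empty,
        mul_zero] at hi
      exact hi rfl

lemma shiftDeformation_apply (m : ℕ) (lam θ : ℂ) (ζ : ℕ →₀ ℂ) (i : ℕ) :
    shiftDeformation n m lam θ ζ i =
      θ * ∑ j ∈ Finset.Ico i (m + 1), ζ j * (shiftCoeff n j i * lam ^ (j - i)) := rfl

lemma shiftDeformation_of_lt {m : ℕ} (lam θ : ℂ) (ζ : ℕ →₀ ℂ) (i : ℕ) (hi : m + 1 ≤ i) :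
    shiftDeformation n m lam θ ζ i = 0 := by
  rw [shiftDeformation_apply, Finset.Ico_eq_empty (by omega), Finset.sum_empty, mul_zero]

lemma pairing_shiftDeformation {m : ℕ} (hζ : ∀ j, m + 1 ≤ j → ζ j = 0) (lam θ : ℂ) (y : V n)
    (x : VDual n) : pairing n (shiftDeformation n m lam θ ζ) y x =
      θ • phi n lam (pairing n ζ y x) := by
  rw [pairing_eq_sum_range ζ hζ,
    pairing_eq_sum_range _ (shiftDeformation_of_lt (n := n) lam θ ζ), map_sum]
  simp only [map_smul, phi_r, shiftDeformation_apply, mul_smul θ, ← Finset.smul_sum,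
    Finset.sum_smul]
  simp only [Finset.smul_sum, smul_smul]
  rw [Finset.range_eq_Ico, Finset.sum_sigma', Finset.sum_sigma']
  refine Finset.sum_bij' (fun p _ => ⟨p.2, p.1⟩) (fun p _ => ⟨p.2, p.1⟩) ?_ ?_ ?_ ?_ ?_
  · rintro ⟨i, j⟩ h
    simp only [Finset.mem_sigma, Finset.mem_Ico, Finset.mem_range] at h ⊢
    omega
  · rintro ⟨i, j⟩ h
    simp only [Finset.mem_sigma, Finset.mem_Ico, Finset.mem_range] at h ⊢
    omega
  · intros; rfl
  · intros; rfl
  · intros; rfl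

lemma exists_normalized (n : ℕ) {m : ℕ} (h : length ζ = m) :
    ∃ ζ' : ℕ →₀ ℂ, length ζ' = m ∧ ζ' m = 1 ∧ (1 ≤ m → ζ' (m - 1) = 0) ∧
      ∃ lam θ : ℂ, θ ≠ 0 ∧ ∀ y x, pairing n ζ' y x = θ • phi n lam (pairing n ζ y x) := by
  have hζ := apply_eq_zero_of_length_lt h
  have hm := apply_length_ne_zero h
  -- The left side is, up to the factor `θ`, the coefficient of `r_{m-1}` in `θ φ_λ(ζ)`: only
  -- `r_{m-1}` and `r_m` contribute to it.
  obtain ⟨lam, hlam⟩ : ∃ lam : ℂ, 1 ≤ m →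
      ζ (m - 1) + ζ m * (shiftCoeff n m (m - 1) * lam) = 0 := by
    rcases m with _ | m
    · exact ⟨0, fun h => absurd h (by omega)⟩
    · refine ⟨-(ζ m / (ζ (m + 1) * shiftCoeff n (m + 1) m)), fun _ => ?_⟩
      have hs := shiftCoeff_succ_ne_zero n m
      rw [Nat.add_sub_cancel]
      field_simp
      ring
  have hone : shiftDeformation n m lam (ζ m)⁻¹ ζ m = 1 := by
    rw [shiftDeformation_apply, Nat.Ico_succ_singleton, Finset.sum_singleton, shiftCoeff_self,
      Nat.sub_self, pow_zero, mul_one, mul_one, inv_mul_cancel₀ hm]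
  refine ⟨shiftDeformation n m lam (ζ m)⁻¹ ζ, length_eq (shiftDeformation_of_lt _ _ _)
    (by rw [hone]; exact one_ne_zero), hone, fun hm1 => ?_, lam, (ζ m)⁻¹, inv_ne_zero hm,
    pairing_shiftDeformation hζ _ _⟩
  obtain ⟨k, rfl⟩ : ∃ k, m = k + 1 := ⟨m - 1, by omega⟩
  have h0 := hlam hm1
  rw [Nat.add_sub_cancel] at h0 ⊢
  rw [shiftDeformation_apply, Finset.sum_Ico_succ_top (by omega), Nat.Ico_succ_singleton,
    Finset.sum_singleton, shiftCoeff_self, Nat.sub_self, Nat.add_sub_cancel_left, pow_zero, pow_one,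
    mul_one, mul_one, h0, mul_zero]

end

end InfCherednik

end

theorem lemma1p2 (n : ℕ) (hn : 1 ≤ n) :
    (∀ (ζ ζ' : ℕ →₀ ℂ) (N : ℕ),
      InfCherednik.length ζ + 1 ≤ N → InfCherednik.length ζ' + 1 ≤ N → 3 ≤ N →
        (InfCherednik.FilteredIso n N ζ ζ' ↔
          ∃ (lam θ : ℂ) (s : ℤˣ), θ ≠ 0 ∧
            ∀ (y : InfCherednik.V n) (x : InfCherednik.VDual n),
              InfCherednik.pairing n ζ' y x =
                θ • InfCherednik.phi n lam
                  (InfCherednik.pairing n (InfCherednik.signTwist s ζ) y x))) ∧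
    (∀ (m : ℕ) (ζ : ℕ →₀ ℂ), InfCherednik.length ζ = m →
      ∃ ζ' : ℕ →₀ ℂ, InfCherednik.length ζ' = m ∧ ζ' m = 1 ∧ (1 ≤ m → ζ' (m - 1) = 0) ∧
        ∀ N : ℕ, m + 1 ≤ N → 3 ≤ N → InfCherednik.FilteredIso n N ζ ζ') := by
  refine ⟨fun ζ ζ' N _ _ hN => ⟨fun h => h.exists_phi hn hN, ?_⟩, fun m ζ h => ?_⟩
  · rintro ⟨lam, θ, s, hθ, h⟩
    exact InfCherednik.filteredIso_of_phi_signTwist N lam θ s hθ h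
  · obtain ⟨ζ', hl, h1, h0, lam, θ, hθ, hp⟩ := InfCherednik.exists_normalized n h
    exact ⟨ζ', hl, h1, h0, fun N _ _ => InfCherednik.filteredIso_of_phi N lam θ hθ hp⟩
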